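/- **Conventions.** For a complex vector space $W$, a family $T(u)=\begin{pmatrix}A(u)&B(u)\\C(u)&D(u)\end{pmatrix}$ ($u\in\mathbb C$) of matrices of linear operators on $W$ is a representation of the QISM I algebra if $$R(u-v)\,(T(u)\otimes I)\,(I\otimes T(v))=(I\otimes T(v))\,(T(u)\otimes I)\,R(u-v),\qquad u,v\in\mathbb C,$$ where $R(u)=u+P$ and $P$ is the flip on $\mathbb C^2\otimes\mathbb C^2$. Its quantum determinant is $$\begin{aligned}\Delta(u)&=A(u-\tfrac12)D(u+\tfrac12)-C(u-\tfrac12)B(u+\tfrac12)=D(u-\tfrac12)A(u+\tfrac12)-B(u-\tfrac12)C(u+\tfrac12)\\&=D(u+\tfrac12)A(u-\tfrac12)-C(u+\tfrac12)B(u-\tfrac12)=A(u+\tfrac12)D(u-\tfrac12)-B(u+\tfrac12)C(u-\tfrac12).\end{aligned}$$ Let $\mathcal D=\{u_0+m\mid m\in\mathbb Z,\ j_-<m<j_+\}$, with $u_0\in\mathbb C$, $j_-\in\mathbb Z\cup\{-\infty\}$, $j_+\in\mathbb Z\cup\{+\infty\}$. Given vectors $F(u)\in W$ and scalar functions $\Delta_\pm$,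 we say that $T$ is *of string type on $\mathcal D$ with $F$ and $\Delta_\pm$* if: * $T$ is a QISM I representation, and for every $u\in\mathcal D$ the space $\ker C(u)$ is one-dimensional, $F(u)\ne0$ and $C(u)F(u)=0$; * for $u\in\mathcal D$ and $0\neq w\in\ker C(u)$: $A(u)w=0$ if and only if $u=u_0+j_-+1$, and $D(u)w=0$ if and only if $u=u_0+j_+-1$ (so never when $j_-$, resp. $j_+$, is infinite); * $A(u)F(u)=\Delta_-(u-\frac12)F(u-1)$ for $u\in\mathcal D$, $u\ne u_0+j_-+1$, and $D(u)F(u)=\Delta_+(u+\frac12)F(u+1)$ for $u\in\mathcal D$, $u\neq u_0+j_+-1$; * on $\mathrm{Span}\{F(v)\mid v\in\mathcal D\}$ the operator $\Delta(u)$ is the scalar $\Delta_+(u)\Delta_-(u)$ for $u\in\mathcal D\pm\frac12$, and it is $0$ for $u=u_0+j_\pm\mp\frac12$ ($j_\pm$ finite). **Type C'.** Let $W$ be the space of (complex-valued, real-)analytic functions $f$ on $(0,\infty)$ such that $f$ and all its derivatives are of at most polynomial growth as $x\to\infty$. For $f\in W$ the integral in $$(\partial_x-1)^{-1}f(x)=-e^x\int_x^\infty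 e^{-y}f(y)\,dy$$ converges absolutely, and this defines an operator on $W$ which is a two-sided inverse of $\partial_x-1$ on $W$. Let $c\in\mathbb C$. Then $$A(u)=x\partial_x-x+c-1+u,\quad B(u)=\partial_x-1,\quad C(u)=(\partial_x-1)^{-1}\bigl(x\partial_x^2+(c+u-x)\partial_x-u\bigr),\quad D(u)=\partial_x$$ act on $W$ (as does $x\partial_x^2+(c+u-x)\partial_x-u$), $B(u)$ is injective, and they form a representation of the QISM I algebra with quantum determinant $\Delta(u)=u-\frac12$. Let $F(u)(x)=\Psi(u,c+u;x)$ with $\Psi$ Tricomi's confluent hypergeometric function; then $F(u)\in W$. The representation is of string type with this $F$ and $\Delta_+(u)=-(u-\frac12)$, $\Delta_-(u)=-1$, on $\mathcal D=u_0+\mathbb Z$ for every $u_0\in\mathbb C\setminus\mathbb Z$, and on $\mathcal D=\{0,-1,-2,\dots\}$ (with $u_0=0$, $j_-=-\infty$, $j_+=1$). In the latter case $F(-n)(x)=(-1)^n\,n!\,L_n^{(c-n-1)}(x)$ is, up to a factor, a Laguerre polynomial ($n=0,1,2,\dots$). **Type C''.** Let $W$ be the space of analytic functions $f$ on $(0,\infty)$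 such that $f$ and all its derivatives tend to $0$ faster than any inverse power of $x$ as $x\to\infty$. For $f\in W$ the integral in $$\partial_x^{-1}f(x)=-\int_x^\infty f(y)\,dy$$ converges absolutely, and this defines an operator on $W$ which is a two-sided inverse of $\partial_x$ on $W$. Then $$A(u)=x\partial_x+2u,\quad B(u)=2x^{-1}\partial_x,\quad C(u)=\tfrac12\,\partial_x^{-1}\bigl(x\partial_x^2+(2u+1)\partial_x-x\bigr),\quad D(u)=x^{-1}\partial_x$$ act on $W$ (as does $x\partial_x^2+(2u+1)\partial_x-x$), $B(u)$ is injective, and they form a representation of the QISM I algebra with quantum determinant $\Delta(u)=1$. Let $F(u)(x)=x^{-u}K_u(x)$ with $K_u$ Macdonald's function (the modified Bessel function of the third kind); then $F(u)\in W$. The representation is of string type with this $F$ and $\Delta_+=\Delta_-=-1$, on $\mathcal D=u_0+\mathbb Z$ for every $u_0\in\mathbb C$. -/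

import Mathlib

open Filter Topology MeasureTheory Set
open scoped Kronecker

noncomputable section

/-! ### The QISM I algebra (with `κ = 1`) and its representations -/

section QISM

variable {W : Type*} [AddCommGroup W] [Module ℂ W]

/-- The rational `R`-matrix `R(u) = u + P`, with `P` the flip of `ℂ² ⊗ ℂ²`. -/
def rMatrix (u : ℂ) : Matrix (Fin 2 × Fin 2) (Fin 2 × Fin 2) ℂ :=
  u • 1 + Matrix.of fun p q => if p = q.swap then 1 else 0

/-- The same matrix, with scalars viewed as operators on `W`. -/
def rMatrixOp (W : Type*) [AddCommGroup W] [Module ℂ W] (u : ℂ) :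
    Matrix (Fin 2 × Fin 2) (Fin 2 × Fin 2) (Module.End ℂ W) :=
  (rMatrix u).map (algebraMap ℂ (Module.End ℂ W))

/-- A family of `2 × 2` matrices `T(u) = (A(u), B(u); C(u), D(u))` of operators on `W` is a
representation of the QISM I algebra:
`R(u-v) T⁽¹⁾(u) T⁽²⁾(v) = T⁽²⁾(v) T⁽¹⁾(u) R(u-v)` with `T⁽¹⁾ = T ⊗ I`, `T⁽²⁾ = I ⊗ T`. -/
def IsQISMIRep (T : ℂ → Matrix (Fin 2) (Fin 2) (Module.End ℂ W)) : Prop :=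
  ∀ u v : ℂ,
    rMatrixOp W (u - v) * (T u ⊗ₖ (1 : Matrix (Fin 2) (Fin 2) (Module.End ℂ W))) *
        ((1 : Matrix (Fin 2) (Fin 2) (Module.End ℂ W)) ⊗ₖ T v) =
      ((1 : Matrix (Fin 2) (Fin 2) (Module.End ℂ W)) ⊗ₖ T v) *
        (T u ⊗ₖ (1 : Matrix (Fin 2) (Fin 2) (Module.End ℂ W))) * rMatrixOp W (u - v)

/-- The quantum determinant `Δ(u) = A(u - 1/2) D(u + 1/2) - C(u - 1/2) B(u + 1/2)`. -/
def quantumDet (T : ℂ → Matrix (Fin 2) (Fin 2) (Module.End ℂ W)) (u : ℂ) : Module.End ℂ W :=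
  T (u - 1 / 2) 0 0 * T (u + 1 / 2) 1 1 - T (u - 1 / 2) 1 0 * T (u + 1 / 2) 0 1

/-- The quantum determinant, in each of its four forms, is the scalar function `q`. -/
def HasQuantumDet (T : ℂ → Matrix (Fin 2) (Fin 2) (Module.End ℂ W)) (q : ℂ → ℂ) : Prop :=
  ∀ u : ℂ,
    quantumDet T u = q u • (1 : Module.End ℂ W) ∧
    T (u - 1 / 2) 1 1 * T (u + 1 / 2) 0 0 - T (u - 1 / 2) 0 1 * T (u + 1 / 2) 1 0
      = q u • (1 : Module.End ℂ W) ∧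
    T (u + 1 / 2) 1 1 * T (u - 1 / 2) 0 0 - T (u + 1 / 2) 1 0 * T (u - 1 / 2) 0 1
      = q u • (1 : Module.End ℂ W) ∧
    T (u + 1 / 2) 0 0 * T (u - 1 / 2) 1 1 - T (u + 1 / 2) 0 1 * T (u - 1 / 2) 1 0
      = q u • (1 : Module.End ℂ W)

/-- The string `{u₀ + m | m ∈ ℤ, j₋ < m < j₊}`, where `j₋` is an integer or `-∞` and `j₊` is an
integer or `+∞`. -/
def paramString (u₀ : ℂ) (jm : WithBot ℤ) (jp : WithTop ℤ) : Set ℂ :=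
  {u | ∃ m : ℤ, jm < (m : WithBot ℤ) ∧ (m : WithTop ℤ) < jp ∧ u = u₀ + m}

/-- `u = u₀ + j₋ + 1` (with `j₋` finite): the lowest point of the string. -/
def IsLowest (u₀ : ℂ) (jm : WithBot ℤ) (u : ℂ) : Prop :=
  ∃ j : ℤ, jm = (j : WithBot ℤ) ∧ u = u₀ + j + 1

/-- `u = u₀ + j₊ - 1` (with `j₊` finite): the highest point of the string. -/
def IsHighest (u₀ : ℂ) (jp : WithTop ℤ) (u : ℂ) : Prop :=
  ∃ j : ℤ, jp = (j : WithTop ℤ) ∧ u = u₀ + j - 1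

/-- The hypotheses under which a QISM I representation shifts the parameter along the string
`{u₀ + m | j₋ < m < j₊}`, together with the choice of a nonzero `F(u)` in the kernel of `C(u)` for
every `u` in the string. -/
structure StringConditions (T : ℂ → Matrix (Fin 2) (Fin 2) (Module.End ℂ W))
    (u₀ : ℂ) (jm : WithBot ℤ) (jp : WithTop ℤ) (F : ℂ → W) : Prop where
  rep : IsQISMIRep T
  ker_one_dim : ∀ u ∈ paramString u₀ jm jp,
    Module.finrank ℂ (LinearMap.ker (T u 1 0)) = 1
  lower_iff : ∀ u ∈ paramString u₀ jm jp, ∀ w : W, w ≠ 0 → T u 1 0 w = 0 →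
    (T u 0 0 w = 0 ↔ IsLowest u₀ jm u)
  raise_iff : ∀ u ∈ paramString u₀ jm jp, ∀ w : W, w ≠ 0 → T u 1 0 w = 0 →
    (T u 1 1 w = 0 ↔ IsHighest u₀ jp u)
  F_ne_zero : ∀ u ∈ paramString u₀ jm jp, F u ≠ 0
  F_mem_ker : ∀ u ∈ paramString u₀ jm jp, T u 1 0 (F u) = 0

/-- The shift relations along the string, with given scalar factors `Δ₊`, `Δ₋`:
`A(u)F(u) = Δ₋(u - 1/2)F(u - 1)`, `D(u)F(u) = Δ₊(u + 1/2)F(u + 1)`, and the quantum determinant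
acts on the span of the `F(v)` as `Δ₊(u)Δ₋(u)`, and as `0` at the ends of the string. -/
structure StringShifts (T : ℂ → Matrix (Fin 2) (Fin 2) (Module.End ℂ W))
    (u₀ : ℂ) (jm : WithBot ℤ) (jp : WithTop ℤ) (F : ℂ → W) (Δp Δm : ℂ → ℂ) : Prop where
  lower : ∀ u ∈ paramString u₀ jm jp, ¬ IsLowest u₀ jm u →
    T u 0 0 (F u) = Δm (u - 1 / 2) • F (u - 1)
  raise : ∀ u ∈ paramString u₀ jm jp, ¬ IsHighest u₀ jp u →
    T u 1 1 (F u) = Δp (u + 1 / 2) • F (u + 1)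
  det : ∀ u : ℂ, (u - 1 / 2 ∈ paramString u₀ jm jp ∨ u + 1 / 2 ∈ paramString u₀ jm jp) →
    ∀ w ∈ Submodule.span ℂ (F '' paramString u₀ jm jp), quantumDet T u w = (Δp u * Δm u) • w
  det_end : ∀ u : ℂ, (IsLowest u₀ jm (u + 1 / 2) ∨ IsHighest u₀ jp (u - 1 / 2)) →
    ∀ w ∈ Submodule.span ℂ (F '' paramString u₀ jm jp), quantumDet T u w = 0

end QISM

/-! ### Functions on `(0, ∞)`

A complex function on `(0, ∞)` is represented by its extension by `0` to the real line. -/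

/-- The restriction of `g` to `(0, ∞)`, extended by `0`. -/
def onPos (g : ℝ → ℂ) : ℝ → ℂ := (Ioi (0 : ℝ)).indicator g

theorem iteratedDeriv_add_eventuallyEq {f g : ℝ → ℂ} (hf : AnalyticOnNhd ℝ f (Ioi 0))
    (hg : AnalyticOnNhd ℝ g (Ioi 0)) (p : ℕ) :
    iteratedDeriv p (f + g) =ᶠ[atTop] fun x => iteratedDeriv p f x + iteratedDeriv p g x := by
  filter_upwards [eventually_gt_atTop (0 : ℝ)] with x hx
  exact iteratedDeriv_add ((hf x hx).contDiffAt) ((hg x hx).contDiffAt)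

theorem iteratedDeriv_smul_eventuallyEq {f : ℝ → ℂ} (hf : AnalyticOnNhd ℝ f (Ioi 0)) (a : ℂ)
    (p : ℕ) : iteratedDeriv p (a • f) =ᶠ[atTop] fun x => a * iteratedDeriv p f x := by
  filter_upwards [eventually_gt_atTop (0 : ℝ)] with x hx
  exact iteratedDeriv_const_smul ((hf x hx).contDiffAt) a

/-- Analytic functions on `(0, ∞)` which, with all their derivatives, are of at most polynomial
growth at `∞`. -/
def polyGrowthSpace : Submodule ℂ (ℝ → ℂ) where
  carrier := {f | (∀ x ≤ 0, f x = 0) ∧ AnalyticOnNhd ℝ f (Ioi 0) ∧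
    ∀ p : ℕ, ∃ k : ℕ, iteratedDeriv p f =O[atTop] fun x : ℝ => x ^ k}
  zero_mem' := by
    refine ⟨fun _ _ => rfl, analyticOnNhd_const, fun p => ⟨0, ?_⟩⟩
    have h : iteratedDeriv p (0 : ℝ → ℂ) = fun _ => 0 := by
      ext x
      simp
    rw [h]
    exact Asymptotics.isBigO_zero _ _
  add_mem' := by
    rintro f g ⟨f0, fa, fg⟩ ⟨g0, ga, gg⟩
    refine ⟨fun x hx => by simp [f0 x hx, g0 x hx], fa.add ga, fun p => ?_⟩
    obtain ⟨k, hk⟩ := fg p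
    obtain ⟨l, hl⟩ := gg p
    have mono : ∀ m n : ℕ, m ≤ n → (fun x : ℝ => x ^ m) =O[atTop] fun x : ℝ => x ^ n := by
      intro m n hmn
      refine Asymptotics.IsBigO.of_bound 1 ?_
      filter_upwards [eventually_ge_atTop (1 : ℝ)] with x hx
      have hx0 : (0 : ℝ) ≤ x := by linarith
      rw [Real.norm_of_nonneg (pow_nonneg hx0 _), Real.norm_of_nonneg (pow_nonneg hx0 _), one_mul]
      exact pow_le_pow_right₀ hx hmn
    refine ⟨max k l, Asymptotics.IsBigO.congr' ?_
      (iteratedDeriv_add_eventuallyEq fa ga p).symm EventuallyEq.rfl⟩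
    exact (hk.trans (mono _ _ (le_max_left k l))).add (hl.trans (mono _ _ (le_max_right k l)))
  smul_mem' := by
    rintro a f ⟨f0, fa, fg⟩
    refine ⟨fun x hx => by simp [f0 x hx], fa.const_smul, fun p => ?_⟩
    obtain ⟨k, hk⟩ := fg p
    exact ⟨k, (hk.const_mul_left a).congr' (iteratedDeriv_smul_eventuallyEq fa a p).symm
      EventuallyEq.rfl⟩

/-- Analytic functions on `(0, ∞)` which, with all their derivatives, tend to `0` at `∞` faster
than any inverse power. -/
def rapidDecaySpace : Submodule ℂ (ℝ → ℂ) where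
  carrier := {f | (∀ x ≤ 0, f x = 0) ∧ AnalyticOnNhd ℝ f (Ioi 0) ∧
    ∀ p k : ℕ, Tendsto (fun x : ℝ => (x : ℂ) ^ k * iteratedDeriv p f x) atTop (𝓝 0)}
  zero_mem' := by
    refine ⟨fun _ _ => rfl, analyticOnNhd_const, fun p k => ?_⟩
    have h : iteratedDeriv p (0 : ℝ → ℂ) = fun _ => 0 := by
      ext x
      simp
    rw [h]
    simp
  add_mem' := by
    rintro f g ⟨f0, fa, fg⟩ ⟨g0, ga, gg⟩
    refine ⟨fun x hx => by simp [f0 x hx, g0 x hx], fa.add ga, fun p k => ?_⟩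
    have h := (fg p k).add (gg p k)
    rw [add_zero] at h
    refine h.congr' ?_
    filter_upwards [iteratedDeriv_add_eventuallyEq fa ga p] with x hx
    rw [hx, mul_add]
  smul_mem' := by
    rintro a f ⟨f0, fa, fg⟩
    refine ⟨fun x hx => by simp [f0 x hx], fa.const_smul, fun p k => ?_⟩
    have h := (fg p k).const_mul a
    rw [mul_zero] at h
    refine h.congr' ?_
    filter_upwards [iteratedDeriv_smul_eventuallyEq fa a p] with x hx
    rw [hx]
    ring

/-! ### The operators of type C' -/

/-- `A(u) = x∂ - x + c - 1 + u`. -/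
def opAC' (c u : ℂ) (f : ℝ → ℂ) : ℝ → ℂ :=
  onPos fun x => x * deriv f x - x * f x + (c - 1 + u) * f x

/-- `B₀ = ∂ - 1`. -/
def opBC' (f : ℝ → ℂ) : ℝ → ℂ := onPos fun x => deriv f x - f x

/-- `D(u) = ∂`. -/
def opDC' (f : ℝ → ℂ) : ℝ → ℂ := onPos (deriv f)

/-- `(∂ - 1)⁻¹ f(x) = -eˣ ∫ₓ^∞ e⁻ʸ f(y) dy`. -/
def invDerivSubOne (f : ℝ → ℂ) : ℝ → ℂ :=
  onPos fun x => -Complex.exp x * ∫ y in Ioi x, Complex.exp (-y) * f y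

/-- `x∂² + (c + u - x)∂ - u`. -/
def diffOpC' (c u : ℂ) (f : ℝ → ℂ) : ℝ → ℂ :=
  onPos fun x => x * deriv (deriv f) x + (c + u - x) * deriv f x - u * f x

/-- `C(u) = (∂ - 1)⁻¹ (x∂² + (c + u - x)∂ - u)`. -/
def opCC' (c u : ℂ) (f : ℝ → ℂ) : ℝ → ℂ := invDerivSubOne (diffOpC' c u f)

/-! ### The operators of type C'' -/

/-- `A(u) = x∂ + 2u`. -/
def opAC'' (u : ℂ) (f : ℝ → ℂ) : ℝ → ℂ := onPos fun x => x * deriv f x + 2 * u * f x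

/-- `B₀ = 2x⁻¹∂`. -/
def opBC'' (f : ℝ → ℂ) : ℝ → ℂ := onPos fun x => 2 * (x : ℂ)⁻¹ * deriv f x

/-- `D(u) = x⁻¹∂`. -/
def opDC'' (f : ℝ → ℂ) : ℝ → ℂ := onPos fun x => (x : ℂ)⁻¹ * deriv f x

/-- `∂⁻¹ f(x) = -∫ₓ^∞ f(y) dy`. -/
def invDeriv (f : ℝ → ℂ) : ℝ → ℂ := onPos fun x => -∫ y in Ioi x, f y

/-- `x∂² + (2u + 1)∂ - x`. -/
def diffOpC'' (u : ℂ) (f : ℝ → ℂ) : ℝ → ℂ :=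
  onPos fun x => x * deriv (deriv f) x + (2 * u + 1) * deriv f x - x * f x

/-- `C(u) = (1/2) ∂⁻¹ (x∂² + (2u + 1)∂ - x)`. -/
def opCC'' (u : ℂ) (f : ℝ → ℂ) : ℝ → ℂ := (1 / 2 : ℂ) • invDeriv (diffOpC'' u f)

/-! ### Special functions -/

/-- Tricomi's function `Ψ(a, c; x)`, `x > 0`, for arbitrary complex `a`, `c`. With
`g(t) = e^{-xt} (1+t)^{c-a-1}` it is `Γ(a)⁻¹ ∫₀^∞ t^{a-1} g(t) dt` for `Re a > 0`; its analytic
continuation in `a` is `(-1)^N Γ(a+N)⁻¹ ∫₀^∞ t^{a+N-1} g^{(N)}(t) dt` for any `N` such that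
`Re a + N > 0` (integration by parts). Below, `N` is the least such natural number. -/
def tricomiPsi (a c : ℂ) (x : ℝ) : ℂ :=
  (-1) ^ ⌊1 - a.re⌋₊ / Complex.Gamma (a + ⌊1 - a.re⌋₊) *
    ∫ t in Ioi (0 : ℝ), (t : ℂ) ^ (a + ⌊1 - a.re⌋₊ - 1) *
      iteratedDeriv ⌊1 - a.re⌋₊
        (fun s : ℝ => Complex.exp (-(x * s)) * (1 + (s : ℂ)) ^ (c - a - 1)) t

theorem tricomiPsi_of_re_pos {a : ℂ} (ha : 0 < a.re) (c : ℂ) (x : ℝ) :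
    tricomiPsi a c x = (Complex.Gamma a)⁻¹ * ∫ t in Ioi (0 : ℝ), (t : ℂ) ^ (a - 1) *
      (Complex.exp (-(x * t)) * (1 + (t : ℂ)) ^ (c - a - 1)) := by
  have h : ⌊1 - a.re⌋₊ = 0 := Nat.floor_eq_zero.2 (by linarith)
  simp [tricomiPsi, h]

/-- Macdonald's function (modified Bessel function of the third kind), `x > 0`:
`K_ν(x) = (1/2) (x/2)^ν ∫₀^∞ e^{-t - x²/(4t)} t^{-ν-1} dt`. -/
def macdonaldK (ν : ℂ) (x : ℝ) : ℂ :=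
  1 / 2 * ((x : ℂ) / 2) ^ ν *
    ∫ t in Ioi (0 : ℝ), Complex.exp (-t - x ^ 2 / (4 * t)) * (t : ℂ) ^ (-ν - 1)

/-- The Laguerre polynomial
`L_n^α(x) = ∑ₖ (-1)^k (α+k+1)_{n-k} x^k / (k! (n-k)!)`, for arbitrary complex `α`. -/
def laguerreL (n : ℕ) (α x : ℂ) : ℂ :=
  ∑ k ∈ Finset.range (n + 1), (-1) ^ k * (ascPochhammer ℂ (n - k)).eval (α + k + 1) /
    ((k.factorial : ℂ) * ((n - k).factorial : ℂ)) * x ^ k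

end

/-!
Both families have the form `T(u) = (a + αu, b; k + u, d)`, where `b` is injective and a linear
combination of `d` and `1`, and `da - bk` is a scalar. Multiplying by `b` on the left and cancelling
it reduces all QISM relations, and the four forms of the quantum determinant, to the commutation
relation of `a` and `d`.

The functions `F(u)` are Laplace–Mellin integrals. Integration by parts and differentiation under
the integral sign give their contiguous relations: `A(u)` and `D(u)` shift the parameter. Hence
`D(u - 1)A(u)` multiplies `F(u)` by the same scalar as the quantum determinant
`D(u - 1)A(u) - B(u - 1)C(u)` does, and `C(u)F(u) = 0` because `B` is injective. That `F(u) ≠ 0`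
follows from the limit of a rescaled integral, which is a value of the Gamma function.

A function `f` with `C(u)f = 0` solves a second order linear equation. The Wronskian of two
solutions, multiplied by the integrating factor, is constant and tends to `0` at infinity by the
growth conditions, so the kernel is a line.
-/

noncomputable section

/-! ### Representations that are linear in the spectral parameter -/

section CommutationRelations

variable {R S : Type*} [CommRing R] [Ring S] [Algebra R S] {a b k d : S} {α r s : R}

theorem lower_right_commute_upper_right (hbd : b = α • d - s • 1) : d * b = b * d := by
  simp only [hbd, mul_sub, sub_mul, mul_smul_comm, smul_mul_assoc, mul_one, one_mul]

theorem upper_left_mul_upper_right (had : a * d = d * a - b) (hbd : b = α • d - s • 1) :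
    a * b = b * a - α • b :=
  calc a * b = α • (a * d) - s • a := by simp only [hbd, mul_sub, mul_smul_comm, mul_one]
    _ = (α • d - s • 1) * a - α • b := by
      simp only [had, sub_mul, smul_mul_assoc, one_mul]
      module
    _ = b * a - α • b := by rw [← hbd]

theorem lower_left_mul_upper_right (hb : IsLeftRegular b) (hdb : d * b = b * d)
    (hab : a * b = b * a - α • b) (hda : d * a = b * k + r • 1) : k * b = b * k - α • d := by
  have hbk : b * k = d * a - r • 1 := eq_sub_of_add_eq hda.symm
  refine hb ?_
  calc b * (k * b) = d * (a * b) - r • b := by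
        rw [← mul_assoc, hbk, sub_mul, mul_assoc, smul_one_mul]
    _ = d * b * a - α • (d * b) - r • b := by rw [hab, mul_sub, mul_smul_comm, mul_assoc]
    _ = b * (d * a - r • 1 - α • d) := by
        simp only [hdb, mul_sub, mul_smul_comm, mul_one, mul_assoc]
        abel
    _ = b * (b * k - α • d) := by rw [hbk]

theorem lower_left_mul_lower_right (hb : IsLeftRegular b) (hdb : d * b = b * d)
    (had : a * d = d * a - b) (hda : d * a = b * k + r • 1) : k * d = d * k - d := by
  have hbk : b * k = d * a - r • 1 := eq_sub_of_add_eq hda.symm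
  refine hb ?_
  calc b * (k * d) = d * (a * d) - r • d := by
        rw [← mul_assoc, hbk, sub_mul, mul_assoc, smul_one_mul]
    _ = d * (d * a - r • 1) - d * b := by
        simp only [had, mul_sub, mul_smul_comm, mul_one]
        abel
    _ = b * (d * k - d) := by rw [← hbk, ← mul_assoc, hdb, mul_assoc, mul_sub]

theorem upper_left_mul_lower_left (hb : IsLeftRegular b) (hab : a * b = b * a - α • b)
    (had : a * d = d * a - b) (hda : d * a = b * k + r • 1) : a * k = k * a + α • k - a := by
  have hbk : b * k = d * a - r • 1 := eq_sub_of_add_eq hda.symm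
  have hba : b * a = a * b + α • b := by rw [hab, sub_add_cancel]
  refine hb ?_
  calc b * (a * k) = a * (b * k) + α • (b * k) := by
        rw [← mul_assoc, hba, add_mul, mul_assoc, smul_mul_assoc]
    _ = (a * d) * a - r • a + α • (b * k) := by
        rw [hbk, mul_sub, mul_smul_comm, mul_one, mul_assoc]
    _ = (d * a - r • 1) * a + α • (b * k) - b * a := by
        simp only [had, sub_mul, smul_mul_assoc, one_mul]
        abel
    _ = b * (k * a + α • k - a) := by
        rw [← hbk, mul_sub, mul_add, mul_assoc, mul_smul_comm]

end CommutationRelations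

section LinearFamily

variable {W : Type*} [AddCommGroup W] [Module ℂ W]

theorem rMatrixOp_eq (u : ℂ) :
    rMatrixOp W u = u • 1 + (Equiv.prodComm (Fin 2) (Fin 2)).toPEquiv.toMatrix := by
  ext1 p q
  simp only [rMatrixOp, rMatrix, Matrix.map_apply, Matrix.add_apply, Matrix.smul_apply,
    Matrix.one_apply, Matrix.of_apply, PEquiv.toMatrix_apply, Equiv.toPEquiv_apply,
    Equiv.prodComm_apply, Option.mem_some_iff, Prod.swap_eq_iff_eq_swap, smul_eq_mul, mul_ite,
    mul_one, mul_zero, smul_ite, smul_zero, map_add, apply_ite (algebraMap ℂ (Module.End ℂ W)),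
    Algebra.algebraMap_eq_smul_one, one_smul, zero_smul]

theorem rMatrixOp_mul_apply (u : ℂ)
    (M : Matrix (Fin 2 × Fin 2) (Fin 2 × Fin 2) (Module.End ℂ W)) (i k : Fin 2)
    (q : Fin 2 × Fin 2) : (rMatrixOp W u * M) (i, k) q = u • M (i, k) q + M (k, i) q := by
  rw [rMatrixOp_eq, add_mul, PEquiv.toMatrix_toPEquiv_mul, smul_one_mul]
  rfl

theorem mul_rMatrixOp_apply (u : ℂ)
    (M : Matrix (Fin 2 × Fin 2) (Fin 2 × Fin 2) (Module.End ℂ W)) (p : Fin 2 × Fin 2)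
    (j l : Fin 2) : (M * rMatrixOp W u) p (j, l) = u • M p (j, l) + M p (l, j) := by
  rw [rMatrixOp_eq, mul_add, PEquiv.mul_toMatrix_toPEquiv, mul_smul_one]
  rfl

theorem kronecker_one_mul_one_kronecker_apply (M N : Matrix (Fin 2) (Fin 2) (Module.End ℂ W))
    (i j k l : Fin 2) :
    ((M ⊗ₖ (1 : Matrix (Fin 2) (Fin 2) (Module.End ℂ W))) *
      ((1 : Matrix (Fin 2) (Fin 2) (Module.End ℂ W)) ⊗ₖ N)) (i, k) (j, l) = M i j * N k l := by
  simp [Matrix.mul_apply, Fintype.sum_prod_type, Matrix.one_apply]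

theorem one_kronecker_mul_kronecker_one_apply (M N : Matrix (Fin 2) (Fin 2) (Module.End ℂ W))
    (i j k l : Fin 2) :
    (((1 : Matrix (Fin 2) (Fin 2) (Module.End ℂ W)) ⊗ₖ N) *
      (M ⊗ₖ (1 : Matrix (Fin 2) (Fin 2) (Module.End ℂ W)))) (i, k) (j, l) = N k l * M i j := by
  simp [Matrix.mul_apply, Fintype.sum_prod_type, Matrix.one_apply]

theorem isQISMIRep_iff_commutator {T : ℂ → Matrix (Fin 2) (Fin 2) (Module.End ℂ W)} :
    IsQISMIRep T ↔ ∀ u v i j k l,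
      (u - v) • (T u i j * T v k l - T v k l * T u i j) =
        T v k j * T u i l - T u k j * T v i l := by
  refine forall₂_congr fun u v => ?_
  simp only [← Matrix.ext_iff, Prod.forall, mul_assoc, rMatrixOp_mul_apply]
  simp only [← mul_assoc, mul_rMatrixOp_apply, kronecker_one_mul_one_kronecker_apply,
    one_kronecker_mul_kronecker_one_apply, smul_sub, sub_eq_sub_iff_add_eq_add]
  constructor
  · intro h i j k l
    rw [h i k j l, add_comm]
  · intro h i k j l
    rw [h i j k l, add_comm]

/-- The family `(a + αu, b; k + u, d)` of operator matrices, the common shape of both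
representations: only the first column depends on the spectral parameter. -/
def linearFamily (α : ℂ) (a b k d : Module.End ℂ W) (u : ℂ) :
    Matrix (Fin 2) (Fin 2) (Module.End ℂ W) :=
  !![a + (α * u) • 1, b; k + u • 1, d]

variable {a b k d : Module.End ℂ W} {α r s : ℂ}

theorem isQISMIRep_linearFamily_of_commutators (hdb : d * b = b * d)
    (hkb : k * b = b * k - α • d) (hkd : k * d = d * k - d) (hab : a * b = b * a - α • b)
    (had : a * d = d * a - b) (hak : a * k = k * a + α • k - a) :
    IsQISMIRep (linearFamily α a b k d) := by
  rw [isQISMIRep_iff_commutator]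
  intro u v i j k' l
  fin_cases i <;> fin_cases j <;> fin_cases k' <;> fin_cases l <;>
    simp only [linearFamily, Matrix.of_apply, Matrix.cons_val', Matrix.cons_val_zero,
      Matrix.cons_val_one, Matrix.cons_val_fin_one, Fin.zero_eta, Fin.mk_one, add_mul, mul_add,
      mul_one, one_mul, smul_mul_assoc, mul_smul_comm, hdb, hkb, hkd, hab, had, hak] <;>
    module

theorem isQISMIRep_linearFamily (hb : Function.Injective b) (had : a * d = d * a - b)
    (hda : d * a = b * k + r • 1) (hbd : b = α • d - s • 1) :
    IsQISMIRep (linearFamily α a b k d) := by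
  have hb' : IsLeftRegular b := fun x y hxy => LinearMap.ext fun w => hb congr($hxy w)
  have hdb := lower_right_commute_upper_right hbd
  have hab := upper_left_mul_upper_right had hbd
  exact isQISMIRep_linearFamily_of_commutators hdb (lower_left_mul_upper_right hb' hdb hab hda)
    (lower_left_mul_lower_right hb' hdb had hda) hab had
    (upper_left_mul_lower_left hb' hab had hda)

theorem hasQuantumDet_linearFamily (hb : Function.Injective b) (had : a * d = d * a - b)
    (hda : d * a = b * k + r • 1) (hbd : b = α • d - s • 1) :
    HasQuantumDet (linearFamily α a b k d) fun u => r + s * (u + 1 / 2) := by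
  have hb' : IsLeftRegular b := fun x y hxy => LinearMap.ext fun w => hb congr($hxy w)
  have hkb := lower_left_mul_upper_right hb' (lower_right_commute_upper_right hbd)
    (upper_left_mul_upper_right had hbd) hda
  have hdet : ∀ u, r • (1 : Module.End ℂ W) + (α * u) • d - u • b = (r + s * u) • 1 := by
    intro u
    rw [hbd]
    module
  intro u
  refine ⟨?_, ?_, ?_, ?_⟩ <;> rw [← hdet (u + 1 / 2)] <;>
    simp only [quantumDet, linearFamily, Matrix.of_apply, Matrix.cons_val', Matrix.cons_val_zero,
      Matrix.cons_val_one, Matrix.cons_val_fin_one, add_mul, mul_add, smul_one_mul, mul_smul_one,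
      had, hkb, hda] <;>
    module

end LinearFamily

section Strings

variable {W : Type*} [AddCommGroup W] [Module ℂ W]
  {T : ℂ → Matrix (Fin 2) (Fin 2) (Module.End ℂ W)} {F : ℂ → W} {Δp Δm : ℂ → ℂ}
  {u₀ u : ℂ} {jm : WithBot ℤ} {jp : WithTop ℤ}

theorem not_isLowest_bot (u₀ u : ℂ) : ¬ IsLowest u₀ ⊥ u := by
  rintro ⟨j, hj, -⟩
  exact WithBot.bot_ne_coe hj

theorem not_isHighest_top (u₀ u : ℂ) : ¬ IsHighest u₀ ⊤ u := by
  rintro ⟨j, hj, -⟩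
  exact WithTop.top_ne_coe hj

theorem isHighest_coe_iff {j : ℤ} : IsHighest u₀ (j : WithTop ℤ) u ↔ u = u₀ + j - 1 := by
  simp only [IsHighest, WithTop.coe_inj, exists_eq_left']

theorem IsLowest.mem_paramString (hu : IsLowest u₀ jm u) (hne : (paramString u₀ jm jp).Nonempty) :
    u ∈ paramString u₀ jm jp := by
  obtain ⟨j, rfl, rfl⟩ := hu
  obtain ⟨-, m, hjm, hmj, -⟩ := hne
  refine ⟨j + 1, WithBot.coe_lt_coe.2 (lt_add_one j), lt_of_le_of_lt ?_ hmj, by push_cast; ring⟩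
  exact WithTop.coe_le_coe.2 (WithBot.coe_lt_coe.1 hjm)

theorem IsHighest.mem_paramString (hu : IsHighest u₀ jp u)
    (hne : (paramString u₀ jm jp).Nonempty) : u ∈ paramString u₀ jm jp := by
  obtain ⟨j, rfl, rfl⟩ := hu
  obtain ⟨-, m, hjm, hmj, -⟩ := hne
  refine ⟨j - 1, lt_of_lt_of_le hjm ?_, WithTop.coe_lt_coe.2 (sub_one_lt j), by push_cast; ring⟩
  exact WithBot.coe_le_coe.2 (Int.le_sub_one_of_lt (WithTop.coe_lt_coe.1 hmj))

theorem HasQuantumDet.quantumDet_apply {q : ℂ → ℂ} (hdet : HasQuantumDet T q) (u : ℂ) (w : W) :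
    quantumDet T u w = q u • w := by
  rw [(hdet u).1, LinearMap.smul_apply, Module.End.one_apply]

/-- Nonzero vectors `F(u)`, one for every complex `u`, which `A(u)` and `D(u)` move to `F(u - 1)`
and `F(u + 1)` up to the scalars `Δ₋(u - 1/2)` and `Δ₊(u + 1/2)`, where `Δ₊Δ₋` is the quantum
determinant; the strings of the theorem are all cut out of such families. -/
structure IsShiftFamily (T : ℂ → Matrix (Fin 2) (Fin 2) (Module.End ℂ W)) (F : ℂ → W)
    (Δp Δm : ℂ → ℂ) : Prop where
  ne_zero : ∀ u, F u ≠ 0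
  lower : ∀ u, T u 0 0 (F u) = Δm (u - 1 / 2) • F (u - 1)
  raise : ∀ u, T u 1 1 (F u) = Δp (u + 1 / 2) • F (u + 1)
  det : HasQuantumDet T fun u => Δp u * Δm u

/-- Moving down and up again multiplies by `Δ₊Δ₋`, which the determinant
`DA - BC` does as well; hence `BC F(u) = 0`. -/
theorem IsShiftFamily.mem_ker (hF : IsShiftFamily T F Δp Δm)
    (hB : ∀ u, Function.Injective (T u 0 1)) (u : ℂ) : T u 1 0 (F u) = 0 := by
  have hDA : T (u - 1) 1 1 (T u 0 0 (F u)) = (Δp (u - 1 / 2) * Δm (u - 1 / 2)) • F u := by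
    have hraise := hF.raise (u - 1)
    rw [sub_add_cancel, show u - 1 + 1 / 2 = u - 1 / 2 by ring] at hraise
    rw [hF.lower, map_smul, hraise, smul_smul, mul_comm]
  have hdetF := congr($((hF.det (u - 1 / 2)).2.1) (F u))
  rw [show u - 1 / 2 - 1 / 2 = u - 1 by ring, sub_add_cancel, LinearMap.sub_apply,
    Module.End.mul_apply, Module.End.mul_apply, hDA, LinearMap.smul_apply, Module.End.one_apply,
    sub_eq_self] at hdetF
  exact hB _ (hdetF.trans (map_zero _).symm)

theorem apply_eq_zero_iff_of_mem_span_singleton {K V V' : Type*} [Field K] [AddCommGroup V]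
    [AddCommGroup V'] [Module K V] [Module K V'] (f : V →ₗ[K] V') {v w : V} (hw : w ≠ 0)
    (hwv : w ∈ K ∙ v) : f w = 0 ↔ f v = 0 := by
  obtain ⟨z, rfl⟩ := Submodule.mem_span_singleton.1 hwv
  rw [map_smul, smul_eq_zero_iff_right (left_ne_zero_of_smul hw)]

theorem IsShiftFamily.stringConditions (hF : IsShiftFamily T F Δp Δm) (hrep : IsQISMIRep T)
    (hB : ∀ u, Function.Injective (T u 0 1))
    (hker : ∀ u, LinearMap.ker (T u 1 0) ≤ ℂ ∙ F u)
    (hlow : ∀ u ∈ paramString u₀ jm jp, Δm (u - 1 / 2) = 0 ↔ IsLowest u₀ jm u)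
    (hhigh : ∀ u ∈ paramString u₀ jm jp, Δp (u + 1 / 2) = 0 ↔ IsHighest u₀ jp u) :
    StringConditions T u₀ jm jp F where
  rep := hrep
  ker_one_dim u _ := by
    have hker_eq : LinearMap.ker (T u 1 0) = ℂ ∙ F u :=
      (hker u).antisymm ((Submodule.span_singleton_le_iff_mem _ _).2 (hF.mem_ker hB u))
    rw [hker_eq, finrank_span_singleton (hF.ne_zero u)]
  lower_iff u hu w hw hCw := by
    rw [apply_eq_zero_iff_of_mem_span_singleton _ hw (hker u hCw), hF.lower,
      smul_eq_zero_iff_left (hF.ne_zero _), hlow u hu]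
  raise_iff u hu w hw hCw := by
    rw [apply_eq_zero_iff_of_mem_span_singleton _ hw (hker u hCw), hF.raise,
      smul_eq_zero_iff_left (hF.ne_zero _), hhigh u hu]
  F_ne_zero u _ := hF.ne_zero u
  F_mem_ker u _ := hF.mem_ker hB u

theorem IsShiftFamily.stringShifts (hF : IsShiftFamily T F Δp Δm)
    (hlow : ∀ u ∈ paramString u₀ jm jp, IsLowest u₀ jm u → Δm (u - 1 / 2) = 0)
    (hhigh : ∀ u ∈ paramString u₀ jm jp, IsHighest u₀ jp u → Δp (u + 1 / 2) = 0) :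
    StringShifts T u₀ jm jp F Δp Δm where
  lower u _ _ := hF.lower u
  raise u _ _ := hF.raise u
  det u _ w _ := hF.det.quantumDet_apply u w
  det_end u hu w hw := by
    rw [hF.det.quantumDet_apply]
    rcases (paramString u₀ jm jp).eq_empty_or_nonempty with hempty | hne
    · rw [hempty, image_empty, Submodule.span_empty, Submodule.mem_bot] at hw
      rw [hw, smul_zero]
    · rcases hu with hu | hu
      · have hΔm := hlow _ (hu.mem_paramString hne) hu
        rw [add_sub_cancel_right] at hΔm
        rw [hΔm, mul_zero, zero_smul]
      · have hΔp := hhigh _ (hu.mem_paramString hne) hu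
        rw [sub_add_cancel] at hΔp
        rw [hΔp, zero_mul, zero_smul]

end Strings

/-! ### Analytic functions on `(0, ∞)` with growth conditions -/

section HalfLine

theorem onPos_of_pos (g : ℝ → ℂ) {x : ℝ} (hx : 0 < x) : onPos g x = g x :=
  indicator_of_mem (mem_Ioi.2 hx) g

theorem onPos_of_nonpos (g : ℝ → ℂ) {x : ℝ} (hx : x ≤ 0) : onPos g x = 0 :=
  indicator_of_notMem (notMem_Ioi.2 hx) g

theorem onPos_eventuallyEq_nhds (g : ℝ → ℂ) {x : ℝ} (hx : 0 < x) : onPos g =ᶠ[𝓝 x] g := by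
  filter_upwards [Ioi_mem_nhds hx] with y hy using onPos_of_pos g hy

theorem onPos_eventuallyEq_atTop (g : ℝ → ℂ) : onPos g =ᶠ[atTop] g := by
  filter_upwards [eventually_gt_atTop 0] with y hy using onPos_of_pos g hy

theorem analyticOnNhd_onPos {g : ℝ → ℂ} (hg : AnalyticOnNhd ℝ g (Ioi 0)) :
    AnalyticOnNhd ℝ (onPos g) (Ioi 0) :=
  fun x hx => (hg x hx).congr (onPos_eventuallyEq_nhds g hx).symm

theorem eq_of_eqOn_pos {f g : ℝ → ℂ} (hf : ∀ x ≤ 0, f x = 0) (hg : ∀ x ≤ 0, g x = 0)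
    (h : ∀ x, 0 < x → f x = g x) : f = g := by
  funext x
  rcases le_or_gt x 0 with hx | hx
  · rw [hf x hx, hg x hx]
  · exact h x hx

theorem iteratedDeriv_eventuallyEq_of_eqOn_pos {f g : ℝ → ℂ} (h : ∀ x, 0 < x → f x = g x) (p : ℕ) :
    iteratedDeriv p f =ᶠ[atTop] iteratedDeriv p g := by
  filter_upwards [eventually_gt_atTop 0] with x hx
  refine Filter.EventuallyEq.iteratedDeriv_eq p ?_
  filter_upwards [Ioi_mem_nhds hx] with y hy using h y hy

theorem eq_of_hasDerivAt_zero {w : ℝ → ℂ} {s : Set ℝ} (hs : Convex ℝ s)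
    (hw : ∀ x ∈ s, HasDerivAt w 0 x) {x y : ℝ} (hx : x ∈ s) (hy : y ∈ s) : w x = w y := by
  have hbound := hs.norm_image_sub_le_of_norm_hasDerivWithin_le (C := 0)
    (fun z hz => (hw z hz).hasDerivWithinAt) (fun _ _ => norm_zero.le) hy hx
  rwa [zero_mul, norm_le_zero_iff, sub_eq_zero] at hbound

theorem ofReal_ne_zero_of_pos {x : ℝ} (hx : 0 < x) : (x : ℂ) ≠ 0 :=
  Complex.ofReal_ne_zero.2 hx.ne'

theorem deriv_inv_ofReal_pow (n : ℕ) {x : ℝ} (hx : 0 < x) :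
    deriv (fun y : ℝ => ((y : ℂ)⁻¹) ^ n) x = -n * ((x : ℂ)⁻¹) ^ (n + 1) := by
  have hx' := ofReal_ne_zero_of_pos hx
  have hderiv : HasDerivAt (fun y : ℝ => ((y : ℂ)⁻¹) ^ n)
      (n * ((x : ℂ)⁻¹) ^ (n - 1) * (-1 / (x : ℂ) ^ 2)) x :=
    ((Complex.ofRealCLM.hasDerivAt (x := x)).fun_inv hx').fun_pow n
  rw [hderiv.deriv]
  rcases n with _ | n
  · simp only [Nat.cast_zero, zero_mul, neg_zero]
  · simp only [Nat.add_sub_cancel, pow_succ]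
    field_simp

end HalfLine

section GrowthClasses

/-- At most polynomial growth at `∞`. -/
def PolyBounded (g : ℝ → ℂ) : Prop := ∃ k : ℕ, g =O[atTop] fun x : ℝ => x ^ k

/-- Decay at `∞` faster than any inverse power. -/
def RapidlyDecaying (g : ℝ → ℂ) : Prop :=
  ∀ k : ℕ, Tendsto (fun x : ℝ => (x : ℂ) ^ k * g x) atTop (𝓝 0)

/-- A growth condition at `∞`, at least as strong as polynomial growth, which is stable under sums
and under multiplication by functions of at most polynomial growth. It lets the spaces of types C'
and C'' be treated together. -/
structure IsGrowthClass (G : (ℝ → ℂ) → Prop) : Prop where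
  zero : G fun _ => 0
  add : ∀ {f g : ℝ → ℂ}, G f → G g → G fun x => f x + g x
  congr : ∀ {f g : ℝ → ℂ}, G f → f =ᶠ[atTop] g → G g
  mul : ∀ {m f : ℝ → ℂ}, PolyBounded m → G f → G fun x => m x * f x
  polyBounded : ∀ {f : ℝ → ℂ}, G f → PolyBounded f

theorem isGrowthClass_polyBounded : IsGrowthClass PolyBounded where
  zero := ⟨0, Asymptotics.isBigO_zero _ _⟩
  add := by
    rintro f g ⟨k, hk⟩ ⟨l, hl⟩
    have hpow : ∀ {m n : ℕ}, m ≤ n → (fun x : ℝ => x ^ m) =O[atTop] fun x : ℝ => x ^ n :=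
      fun hmn => Asymptotics.IsBigO.pow_of_le_right (eventually_ge_atTop (1 : ℝ)) hmn
    exact ⟨max k l, (hk.trans (hpow (le_max_left k l))).add (hl.trans (hpow (le_max_right k l)))⟩
  congr := by
    rintro f g ⟨k, hk⟩ h
    exact ⟨k, hk.congr' h EventuallyEq.rfl⟩
  mul := by
    rintro f g ⟨k, hk⟩ ⟨l, hl⟩
    refine ⟨k + l, ?_⟩
    simp only [pow_add]
    exact hk.mul hl
  polyBounded := id

theorem isGrowthClass_rapidlyDecaying : IsGrowthClass RapidlyDecaying where
  zero k := by simp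
  add hf hg k := by simpa [mul_add] using (hf k).add (hg k)
  congr hf h k := (hf k).congr' (by filter_upwards [h] with x hx; rw [hx])
  mul := by
    rintro m f ⟨l, hl⟩ hf k
    have hl' : m =O[atTop] fun x : ℝ => (x : ℂ) ^ l :=
      hl.trans (Asymptotics.IsBigO.of_bound 1 (Eventually.of_forall fun x => by simp))
    have hmul := (Asymptotics.isBigO_refl (fun x : ℝ => (x : ℂ) ^ k * f x) atTop).mul hl'
    refine Asymptotics.IsBigO.trans_tendsto ?_ (hf (l + k))
    exact (hmul.congr_left fun x => by ring).congr_right fun x => by ring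
  polyBounded hf := ⟨0, by simpa only [pow_zero, one_mul] using (hf 0).isBigO_one ℝ⟩

theorem polyBounded_const (a : ℂ) : PolyBounded fun _ => a :=
  ⟨0, by simpa using Asymptotics.isBigO_const_const a (one_ne_zero (α := ℝ)) atTop⟩

theorem polyBounded_cpow (a : ℂ) : PolyBounded fun x : ℝ => (x : ℂ) ^ a := by
  obtain ⟨k, hk⟩ := exists_nat_ge a.re
  refine ⟨k, Asymptotics.IsBigO.of_bound 1 ?_⟩
  filter_upwards [eventually_ge_atTop 1] with x hx
  rw [Complex.norm_cpow_eq_rpow_re_of_pos (by linarith), one_mul,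
    Real.norm_of_nonneg (by positivity), ← Real.rpow_natCast]
  exact Real.rpow_le_rpow_of_exponent_le hx hk

variable {G : (ℝ → ℂ) → Prop}

theorem IsGrowthClass.sum (hG : IsGrowthClass G) {ι : Type*} (s : Finset ι) {f : ι → ℝ → ℂ}
    (h : ∀ i ∈ s, G (f i)) : G fun x => ∑ i ∈ s, f i x := by
  classical
  induction s using Finset.induction_on with
  | empty => simpa using hG.zero
  | insert a s ha ih =>
    simp only [Finset.sum_insert ha]
    exact hG.add (h a (Finset.mem_insert_self a s))
      (ih fun i hi => h i (Finset.mem_insert_of_mem hi))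

theorem IsGrowthClass.iteratedDeriv_mul (hG : IsGrowthClass G) {m f : ℝ → ℂ}
    (hm : AnalyticOnNhd ℝ m (Ioi 0)) (hf : AnalyticOnNhd ℝ f (Ioi 0)) {n : ℕ}
    (hm' : ∀ i ≤ n, PolyBounded (iteratedDeriv i m)) (hf' : ∀ i ≤ n, G (iteratedDeriv i f)) :
    G (iteratedDeriv n fun x => m x * f x) := by
  have hleibniz : G fun x => ∑ i ∈ Finset.range (n + 1),
      (n.choose i : ℂ) * (iteratedDeriv i m x * iteratedDeriv (n - i) f x) :=
    hG.sum _ fun i hi => hG.mul (polyBounded_const _)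
      (hG.mul (hm' i (Nat.lt_succ_iff.1 (Finset.mem_range.1 hi))) (hf' _ (Nat.sub_le n i)))
  refine hG.congr hleibniz ?_
  filter_upwards [eventually_gt_atTop 0] with x hx
  have h := _root_.iteratedDeriv_mul (n := n) (hm x hx).contDiffAt (hf x hx).contDiffAt
  rw [show (fun x => m x * f x) = m * f from rfl, h]
  simp only [mul_assoc]

/-- Analytic functions on `(0, ∞)`, extended by `0`, all of whose derivatives satisfy the growth
condition `G`. -/
def AnalyticOfGrowth (G : (ℝ → ℂ) → Prop) (f : ℝ → ℂ) : Prop :=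
  (∀ x ≤ 0, f x = 0) ∧ AnalyticOnNhd ℝ f (Ioi 0) ∧ ∀ p : ℕ, G (iteratedDeriv p f)

namespace AnalyticOfGrowth

variable {m f : ℝ → ℂ}

theorem growth (hf : AnalyticOfGrowth G f) : G f := by
  simpa using hf.2.2 0

theorem growth_deriv (hf : AnalyticOfGrowth G f) : G (_root_.deriv f) := by
  simpa using hf.2.2 1

theorem continuousOn (hf : AnalyticOfGrowth G f) : ContinuousOn f (Ioi 0) :=
  hf.2.1.continuousOn

theorem hasDerivAt (hf : AnalyticOfGrowth G f) {x : ℝ} (hx : 0 < x) :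
    HasDerivAt f (_root_.deriv f x) x := (hf.2.1 x hx).differentiableAt.hasDerivAt

theorem zero (hG : IsGrowthClass G) : AnalyticOfGrowth G fun _ => 0 :=
  ⟨fun _ _ => rfl, analyticOnNhd_const, fun p => by
    convert hG.zero using 1
    exact funext fun x => by simp only [iteratedDeriv_const, ite_self]⟩

theorem deriv (hG : IsGrowthClass G) (hf : AnalyticOfGrowth G f) :
    AnalyticOfGrowth G (onPos (deriv f)) := by
  refine ⟨fun x hx => onPos_of_nonpos _ hx, analyticOnNhd_onPos hf.2.1.deriv, fun p => ?_⟩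
  refine hG.congr (hf.2.2 (p + 1)) ?_
  rw [iteratedDeriv_succ']
  exact iteratedDeriv_eventuallyEq_of_eqOn_pos (fun x hx => (onPos_of_pos _ hx).symm) p

theorem mul (hG : IsGrowthClass G) (hm : AnalyticOfGrowth PolyBounded m)
    (hf : AnalyticOfGrowth G f) : AnalyticOfGrowth G fun x => m x * f x :=
  ⟨fun x hx => by simp only [hf.1 x hx, mul_zero], hm.2.1.mul hf.2.1, fun _ =>
    hG.iteratedDeriv_mul hm.2.1 hf.2.1 (fun i _ => hm.2.2 i) fun i _ => hf.2.2 i⟩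

theorem of_deriv_eq (hG : IsGrowthClass G) {ι : Type*} {F m h : ι → ℝ → ℂ} {σ : ι → ι}
    (hF0 : ∀ i, ∀ x ≤ 0, F i x = 0) (hFa : ∀ i, AnalyticOnNhd ℝ (F i) (Ioi 0))
    (hFG : ∀ i, G (F i)) (hm : ∀ i, AnalyticOfGrowth PolyBounded (m i))
    (hh : ∀ i, AnalyticOfGrowth G (h i))
    (hderiv : ∀ i x, 0 < x → _root_.deriv (F i) x = m i x * F (σ i) x + h i x) (i : ι) :
    AnalyticOfGrowth G (F i) := by
  suffices hiter : ∀ p i, G (iteratedDeriv p (F i)) from ⟨hF0 i, hFa i, fun p => hiter p i⟩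
  intro p
  induction p using Nat.strong_induction_on with
  | _ p ih =>
    intro i
    rcases p with _ | n
    · simpa only [iteratedDeriv_zero] using hFG i
    refine hG.congr (hG.add (hG.iteratedDeriv_mul (hm i).2.1 (hFa (σ i)) (n := n)
      (fun j _ => (hm i).2.2 j) fun j hj => ih j (Nat.lt_succ_of_le hj) (σ i)) ((hh i).2.2 n)) ?_
    rw [iteratedDeriv_succ']
    exact (iteratedDeriv_add_eventuallyEq ((hm i).2.1.mul (hFa (σ i))) (hh i).2.1 n).symm.trans
      (iteratedDeriv_eventuallyEq_of_eqOn_pos (fun x hx => (hderiv i x hx).symm) n)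

theorem const (a : ℂ) : AnalyticOfGrowth PolyBounded (onPos fun _ => a) := by
  have hzero := zero isGrowthClass_polyBounded
  refine of_deriv_eq isGrowthClass_polyBounded (ι := Unit) (F := fun _ => onPos fun _ => a)
    (m := fun _ _ => 0) (h := fun _ _ => 0) (σ := id)
    (fun _ x hx => onPos_of_nonpos _ hx) (fun _ => analyticOnNhd_onPos analyticOnNhd_const)
    (fun _ => ?_) (fun _ => hzero) (fun _ => hzero) (fun _ x hx => ?_) ()
  · exact isGrowthClass_polyBounded.congr (polyBounded_const a) (onPos_eventuallyEq_atTop _).symm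
  · rw [(onPos_eventuallyEq_nhds _ hx).deriv_eq, deriv_const, zero_mul, add_zero]

theorem ofReal : AnalyticOfGrowth PolyBounded (onPos fun x => (x : ℂ)) := by
  have hzero := zero isGrowthClass_polyBounded
  refine of_deriv_eq isGrowthClass_polyBounded (ι := Unit)
    (F := fun _ => onPos fun x => (x : ℂ)) (m := fun _ _ => 0)
    (h := fun _ => onPos fun _ => 1) (σ := id)
    (fun _ x hx => onPos_of_nonpos _ hx)
    (fun _ => analyticOnNhd_onPos fun x _ => Complex.ofRealCLM.analyticAt x) (fun _ => ?_)
    (fun _ => hzero) (fun _ => const 1) (fun _ x hx => ?_) ()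
  · refine isGrowthClass_polyBounded.congr ⟨1, ?_⟩ (onPos_eventuallyEq_atTop _).symm
    exact Asymptotics.IsBigO.of_bound 1 (Eventually.of_forall fun x => by simp)
  · rw [(onPos_eventuallyEq_nhds _ hx).deriv_eq, onPos_of_pos _ hx, zero_mul, zero_add,
      onPos_of_pos _ hx]
    exact (hasDerivAt_id x).ofReal_comp.deriv

/-- The negative powers form a family closed under differentiation. -/
theorem inv_ofReal : AnalyticOfGrowth PolyBounded (onPos fun x => (x : ℂ)⁻¹) := by
  suffices hpow : ∀ n : ℕ, AnalyticOfGrowth PolyBounded (onPos fun x => ((x : ℂ)⁻¹) ^ n) by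
    simpa only [pow_one] using hpow 1
  refine of_deriv_eq isGrowthClass_polyBounded
    (m := fun n => onPos fun _ => -(n : ℂ)) (h := fun _ _ => 0) (σ := fun n => n + 1)
    (fun _ x hx => onPos_of_nonpos _ hx)
    (fun n => analyticOnNhd_onPos fun x hx =>
      ((Complex.ofRealCLM.analyticAt x).inv (ofReal_ne_zero_of_pos hx)).pow n)
    (fun n => ?_) (fun n => const _) (fun _ => zero isGrowthClass_polyBounded) (fun n x hx => ?_)
  · refine isGrowthClass_polyBounded.congr ⟨0, ?_⟩ (onPos_eventuallyEq_atTop _).symm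
    refine Asymptotics.IsBigO.of_bound 1 ?_
    filter_upwards [eventually_ge_atTop 1] with x hx
    simp only [norm_pow, norm_inv, Complex.norm_real, Real.norm_eq_abs, pow_zero, norm_one,
      mul_one]
    exact pow_le_one₀ (by positivity) (inv_le_one_of_one_le₀ (hx.trans (le_abs_self x)))
  · rw [(onPos_eventuallyEq_nhds _ hx).deriv_eq, onPos_of_pos _ hx, onPos_of_pos _ hx,
      deriv_inv_ofReal_pow n hx, add_zero]

end AnalyticOfGrowth

end GrowthClasses

section GrowthSpaces

/-- A space of analytic functions on `(0, ∞)` defined by a growth condition `G`. -/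
class IsGrowthSpace (V : Submodule ℂ (ℝ → ℂ)) (G : outParam ((ℝ → ℂ) → Prop)) : Prop where
  isGrowthClass : IsGrowthClass G
  mem_iff : ∀ f, f ∈ V ↔ AnalyticOfGrowth G f

instance : IsGrowthSpace polyGrowthSpace PolyBounded where
  isGrowthClass := isGrowthClass_polyBounded
  mem_iff _ := Iff.rfl

instance : IsGrowthSpace rapidDecaySpace RapidlyDecaying where
  isGrowthClass := isGrowthClass_rapidlyDecaying
  mem_iff _ := Iff.rfl

variable {G : (ℝ → ℂ) → Prop} {V : Submodule ℂ (ℝ → ℂ)}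

theorem analyticOfGrowth_coe [IsGrowthSpace V G] (f : V) : AnalyticOfGrowth G f :=
  (IsGrowthSpace.mem_iff _).1 f.2

theorem coe_eq_zero_of_nonpos [IsGrowthSpace V G] (f : V) : ∀ x ≤ 0, (f : ℝ → ℂ) x = 0 :=
  (analyticOfGrowth_coe f).1

theorem coe_eq_onPos [IsGrowthSpace V G] {f : V} {g : ℝ → ℂ}
    (h : ∀ x, 0 < x → (f : ℝ → ℂ) x = g x) : (f : ℝ → ℂ) = onPos g :=
  eq_of_eqOn_pos (coe_eq_zero_of_nonpos f) (fun _ hx => onPos_of_nonpos _ hx) fun x hx => by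
    rw [h x hx, onPos_of_pos _ hx]

theorem ext_of_pos [IsGrowthSpace V G] {f g : V}
    (h : ∀ x, 0 < x → (f : ℝ → ℂ) x = (g : ℝ → ℂ) x) : f = g :=
  Subtype.ext (eq_of_eqOn_pos (coe_eq_zero_of_nonpos f) (coe_eq_zero_of_nonpos g) h)

variable [IsGrowthSpace V G]

variable (V) in
/-- The operator `∂`. -/
def derivEnd : Module.End ℂ V where
  toFun f := ⟨onPos (deriv f), (IsGrowthSpace.mem_iff _).2
    ((analyticOfGrowth_coe f).deriv (IsGrowthSpace.isGrowthClass V))⟩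
  map_add' f g := ext_of_pos fun x hx => by
    simp only [Submodule.coe_add, Pi.add_apply, onPos_of_pos _ hx]
    exact deriv_add ((analyticOfGrowth_coe f).hasDerivAt hx).differentiableAt
      ((analyticOfGrowth_coe g).hasDerivAt hx).differentiableAt
  map_smul' a f := ext_of_pos fun x hx => by
    simp only [Submodule.coe_smul, Pi.smul_apply, onPos_of_pos _ hx, RingHom.id_apply]
    exact deriv_const_smul a ((analyticOfGrowth_coe f).hasDerivAt hx).differentiableAt

variable (V) in
/-- Multiplication by a function of at most polynomial growth. -/
def mulEnd {m : ℝ → ℂ} (hm : AnalyticOfGrowth PolyBounded m) : Module.End ℂ V where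
  toFun f := ⟨fun x => m x * (f : ℝ → ℂ) x, (IsGrowthSpace.mem_iff _).2
    (hm.mul (IsGrowthSpace.isGrowthClass V) (analyticOfGrowth_coe f))⟩
  map_add' _ _ := Subtype.ext (funext fun _ => mul_add _ _ _)
  map_smul' _ _ := Subtype.ext (funext fun _ => mul_left_comm _ _ _)

variable (V) in
/-- Multiplication by `x`. -/
def mulXEnd : Module.End ℂ V := mulEnd V AnalyticOfGrowth.ofReal

variable (V) in
/-- Multiplication by `x⁻¹`. -/
def mulInvXEnd : Module.End ℂ V := mulEnd V AnalyticOfGrowth.inv_ofReal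

theorem coe_derivEnd (f : V) : (derivEnd V f : ℝ → ℂ) = onPos (deriv f) := rfl

theorem derivEnd_apply (f : V) {x : ℝ} (hx : 0 < x) :
    (derivEnd V f : ℝ → ℂ) x = deriv f x := onPos_of_pos _ hx

theorem deriv_derivEnd_apply (f : V) {x : ℝ} (hx : 0 < x) :
    deriv (derivEnd V f : ℝ → ℂ) x = deriv (deriv f) x :=
  (onPos_eventuallyEq_nhds _ hx).deriv_eq

theorem mulXEnd_apply (f : V) {x : ℝ} (hx : 0 < x) :
    (mulXEnd V f : ℝ → ℂ) x = x * (f : ℝ → ℂ) x :=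
  congrArg (· * (f : ℝ → ℂ) x) (onPos_of_pos _ hx)

theorem mulInvXEnd_apply (f : V) {x : ℝ} (hx : 0 < x) :
    (mulInvXEnd V f : ℝ → ℂ) x = (x : ℂ)⁻¹ * (f : ℝ → ℂ) x :=
  congrArg (· * (f : ℝ → ℂ) x) (onPos_of_pos _ hx)

theorem derivEnd_mulXEnd (f : V) :
    derivEnd V (mulXEnd V f) = mulXEnd V (derivEnd V f) + f := by
  refine ext_of_pos fun x hx => ?_
  have hmul : (mulXEnd V f : ℝ → ℂ) =ᶠ[𝓝 x] fun y : ℝ => (y : ℂ) * (f : ℝ → ℂ) y := by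
    filter_upwards [Ioi_mem_nhds hx] with y hy using mulXEnd_apply f hy
  have hderiv := (hasDerivAt_id x).ofReal_comp.fun_mul ((analyticOfGrowth_coe f).hasDerivAt hx)
  rw [derivEnd_apply _ hx, hmul.deriv_eq, Submodule.coe_add, Pi.add_apply, mulXEnd_apply _ hx,
    derivEnd_apply _ hx]
  refine hderiv.deriv.trans ?_
  simp only [id, Complex.ofReal_one]
  ring

theorem mulInvXEnd_mulXEnd (f : V) : mulInvXEnd V (mulXEnd V f) = f :=
  ext_of_pos fun x hx => by
    rw [mulInvXEnd_apply _ hx, mulXEnd_apply _ hx, inv_mul_cancel_left₀ (ofReal_ne_zero_of_pos hx)]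

theorem mulXEnd_mulInvXEnd (f : V) : mulXEnd V (mulInvXEnd V f) = f :=
  ext_of_pos fun x hx => by
    rw [mulXEnd_apply _ hx, mulInvXEnd_apply _ hx, mul_inv_cancel_left₀ (ofReal_ne_zero_of_pos hx)]

end GrowthSpaces

section Primitives

theorem exists_complex_extension_of_analyticAt {f : ℝ → ℂ} {x : ℝ} (hf : AnalyticAt ℝ f x) :
    ∃ g : ℂ → ℂ, AnalyticAt ℂ g x ∧ ∀ᶠ y : ℝ in 𝓝 x, g y = f y := by
  obtain ⟨p, hp⟩ := hf
  set q : FormalMultilinearSeries ℂ ℂ ℂ := FormalMultilinearSeries.ofScalars ℂ p.coeff with hq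
  have hradius : q.radius = p.radius := by
    have hnorm : ∀ n, ‖q n‖ = ‖p n‖ := fun n => by
      rw [FormalMultilinearSeries.norm_apply_eq_norm_coef,
        FormalMultilinearSeries.norm_apply_eq_norm_coef, hq,
        FormalMultilinearSeries.coeff_ofScalars]
    simp only [FormalMultilinearSeries.radius, hnorm]
  have hsum : HasFPowerSeriesAt q.sum q 0 :=
    (q.hasFPowerSeriesOnBall (hradius ▸ hp.radius_pos)).hasFPowerSeriesAt
  have htranslate : Tendsto (fun y : ℝ => y - x) (𝓝 x) (𝓝 0) :=
    tendsto_sub_nhds_zero_iff.2 tendsto_id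
  have hcast : Tendsto (fun y : ℝ => ((y - x : ℝ) : ℂ)) (𝓝 x) (𝓝 0) :=
    (Complex.continuous_ofReal.tendsto' 0 0 Complex.ofReal_zero).comp htranslate
  refine ⟨fun z => q.sum (z - x), ?_, ?_⟩
  · refine AnalyticAt.fun_comp (g := q.sum) ?_ (analyticAt_id.sub analyticAt_const)
    simpa only [id, sub_self] using hsum.analyticAt
  filter_upwards [htranslate.eventually (hasFPowerSeriesAt_iff.1 hp),
    hcast.eventually (hasFPowerSeriesAt_iff.1 hsum)] with y hreal hcomplex
  rw [add_sub_cancel] at hreal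
  rw [zero_add, Complex.ofReal_sub] at hcomplex
  refine hcomplex.unique (hreal.congr_fun fun n => ?_)
  rw [hq, FormalMultilinearSeries.coeff_ofScalars, smul_eq_mul, Complex.real_smul]
  push_cast
  rfl

theorem exists_primitive_of_analyticAt {g : ℂ → ℂ} {z : ℂ} (hg : AnalyticAt ℂ g z) :
    ∃ P : ℂ → ℂ, AnalyticAt ℂ P z ∧ ∀ᶠ w in 𝓝 z, HasDerivAt P (g w) w := by
  obtain ⟨r, hr, hgr⟩ := hg.exists_ball_analyticOnNhd
  obtain ⟨P, hP⟩ := hgr.differentiableOn.isExactOn_ball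
  have hball := Metric.ball_mem_nhds z hr
  exact ⟨P, DifferentiableOn.analyticAt
    (fun w hw => (hP w hw).differentiableAt.differentiableWithinAt) hball,
    eventually_of_mem hball hP⟩

/-- On a real neighbourhood, `F` differs by a constant from a primitive of a holomorphic extension
of `f`. -/
theorem analyticAt_of_hasDerivAt {f F : ℝ → ℂ} {x : ℝ} (hf : AnalyticAt ℝ f x)
    (hF : ∀ᶠ y in 𝓝 x, HasDerivAt F (f y) y) : AnalyticAt ℝ F x := by
  obtain ⟨g, hg, hgf⟩ := exists_complex_extension_of_analyticAt hf
  obtain ⟨P, hP, hPg⟩ := exists_primitive_of_analyticAt hg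
  have hdiff : ∀ᶠ y in 𝓝 x, HasDerivAt (fun y : ℝ => F y - P y) 0 y := by
    filter_upwards [hF, hgf, Complex.continuous_ofReal.continuousAt.eventually hPg]
      with y hFy hgfy hPy
    simpa only [hgfy, sub_self] using hFy.fun_sub hPy.comp_ofReal
  obtain ⟨r, hr, hball⟩ := Metric.eventually_nhds_iff_ball.1 hdiff
  have hPan : AnalyticAt ℝ (fun y : ℝ => P y) x :=
    hP.restrictScalars.fun_comp (g := P) (Complex.ofRealCLM.analyticAt x)
  refine (hPan.add (analyticAt_const (v := F x - P x))).congr ?_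
  filter_upwards [Metric.ball_mem_nhds x hr] with y hy
  rw [Pi.add_apply, ← eq_of_hasDerivAt_zero (convex_ball x r) hball hy (Metric.mem_ball_self hr),
    add_sub_cancel]

end Primitives

/-! ### The inverse of `∂ - μ` -/

section InvDerivSub

/-- `(∂ - μ)⁻¹ f(x) = -e^{μx} ∫ₓ^∞ e^{-μy} f(y) dy`, the common form of `invDerivSubOne` (`μ = 1`)
and `invDeriv` (`μ = 0`). -/
def invDerivSub (μ : ℂ) (f : ℝ → ℂ) : ℝ → ℂ :=
  onPos fun x => -Complex.exp (μ * x) * ∫ y in Ioi x, Complex.exp (-(μ * y)) * f y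

theorem invDerivSub_one (f : ℝ → ℂ) : invDerivSub 1 f = invDerivSubOne f := by
  simp only [invDerivSubOne, invDerivSub, one_mul]

theorem invDerivSub_zero (f : ℝ → ℂ) : invDerivSub 0 f = invDeriv f := by
  simp only [invDeriv, invDerivSub, zero_mul, neg_zero, Complex.exp_zero, one_mul, neg_mul]

theorem hasDerivAt_exp_mul (μ : ℂ) (x : ℝ) :
    HasDerivAt (fun x : ℝ => Complex.exp (μ * x)) (μ * Complex.exp (μ * x)) x := by
  simpa only [Complex.ofRealCLM_apply, Complex.ofReal_one, mul_one, mul_comm]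
    using ((Complex.ofRealCLM.hasDerivAt (x := x)).const_mul μ).cexp

theorem analyticAt_exp_mul (μ : ℂ) (x : ℝ) :
    AnalyticAt ℝ (fun x : ℝ => Complex.exp (μ * x)) x :=
  (analyticAt_cexp.restrictScalars (𝕜 := ℝ)).comp
    (f := fun x : ℝ => μ * (x : ℂ)) (analyticAt_const.mul (Complex.ofRealCLM.analyticAt x))

theorem exp_mul_exp_neg (z : ℂ) : Complex.exp z * Complex.exp (-z) = 1 := by
  rw [← Complex.exp_add, add_neg_cancel, Complex.exp_zero]

theorem hasDerivAt_integral_Ioi {g : ℝ → ℂ} (hg : ContinuousOn g (Ioi 0))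
    (hinteg : ∀ x, 0 < x → IntegrableOn g (Ioi x)) {x : ℝ} (hx : 0 < x) :
    HasDerivAt (fun x => ∫ y in Ioi x, g y) (-g x) x := by
  have hhalf : 0 < x / 2 := half_pos hx
  have hftc : HasDerivAt (fun z => ∫ y in x / 2..z, g y) (g x) x := by
    refine intervalIntegral.integral_hasDerivAt_right ?_ ?_ ?_
    · rw [intervalIntegrable_iff_integrableOn_Ioc_of_le (half_le_self hx.le)]
      exact (hinteg _ hhalf).mono_set Ioc_subset_Ioi_self
    · exact hg.stronglyMeasurableAtFilter isOpen_Ioi x hx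
    · exact hg.continuousAt (Ioi_mem_nhds hx)
  refine (hftc.const_sub (∫ y in Ioi (x / 2), g y)).congr_of_eventuallyEq ?_
  filter_upwards [Ioi_mem_nhds (half_lt_self hx)] with z hz
  rw [← intervalIntegral.integral_Ioi_sub_Ioi (hinteg _ hhalf) (le_of_lt hz), sub_sub_cancel]

variable {μ : ℂ} {f : ℝ → ℂ}

theorem hasDerivAt_invDerivSub (hf : ContinuousOn f (Ioi 0))
    (hinteg : ∀ x : ℝ, 0 < x → IntegrableOn (fun y : ℝ => Complex.exp (-(μ * y)) * f y) (Ioi x))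
    {x : ℝ} (hx : 0 < x) :
    HasDerivAt (invDerivSub μ f) (μ * invDerivSub μ f x + f x) x := by
  have hcont : ContinuousOn (fun y : ℝ => Complex.exp (-(μ * y)) * f y) (Ioi 0) :=
    ContinuousOn.mul (by fun_prop) hf
  have hprod := (hasDerivAt_exp_mul μ x).neg.mul (hasDerivAt_integral_Ioi hcont hinteg hx)
  refine (hprod.congr_of_eventuallyEq (onPos_eventuallyEq_nhds _ hx)).congr_deriv ?_
  rw [invDerivSub, onPos_of_pos _ hx, Pi.neg_apply]
  linear_combination f x * exp_mul_exp_neg (μ * x)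

theorem analyticOnNhd_invDerivSub (hf : AnalyticOnNhd ℝ f (Ioi 0))
    (hinteg : ∀ x : ℝ, 0 < x → IntegrableOn (fun y : ℝ => Complex.exp (-(μ * y)) * f y) (Ioi x)) :
    AnalyticOnNhd ℝ (invDerivSub μ f) (Ioi 0) := by
  have hanalytic : AnalyticOnNhd ℝ (fun y : ℝ => Complex.exp (-(μ * y)) * f y) (Ioi 0) :=
    fun y hy => by simpa only [neg_mul] using (analyticAt_exp_mul (-μ) y).fun_mul (hf y hy)
  refine analyticOnNhd_onPos fun x hx => ?_
  refine (analyticAt_exp_mul μ x).neg.mul (analyticAt_of_hasDerivAt (hanalytic x hx).neg ?_)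
  filter_upwards [Ioi_mem_nhds hx] with y hy
  exact hasDerivAt_integral_Ioi hanalytic.continuousOn hinteg hy

theorem invDerivSub_of_hasDerivAt {g : ℝ → ℂ} (hg : ∀ x ≤ 0, g x = 0)
    (hderiv : ∀ x, 0 < x → HasDerivAt g (μ * g x + f x) x)
    (hinteg : ∀ x : ℝ, 0 < x → IntegrableOn (fun y : ℝ => Complex.exp (-(μ * y)) * f y) (Ioi x))
    (hlim : Tendsto (fun x : ℝ => Complex.exp (-(μ * x)) * g x) atTop (𝓝 0)) :
    invDerivSub μ f = g := by
  refine eq_of_eqOn_pos (fun x hx => onPos_of_nonpos _ hx) hg fun x hx => ?_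
  have hprimitive : ∀ y ∈ Ici x, HasDerivAt (fun y : ℝ => Complex.exp (-(μ * y)) * g y)
      (Complex.exp (-(μ * y)) * f y) y := by
    intro y hy
    have hprod := (hasDerivAt_exp_mul (-μ) y).fun_mul (hderiv y (hx.trans_le hy))
    simp only [neg_mul] at hprod
    refine hprod.congr_deriv ?_
    ring
  rw [invDerivSub, onPos_of_pos _ hx,
    integral_Ioi_of_hasDerivAt_of_tendsto' hprimitive (hinteg x hx) hlim]
  linear_combination g x * exp_mul_exp_neg (μ * x)

theorem AnalyticOfGrowth.invDerivSub {G : (ℝ → ℂ) → Prop} (hG : IsGrowthClass G)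
    (hf : AnalyticOfGrowth G f)
    (hinteg : ∀ x : ℝ, 0 < x → IntegrableOn (fun y : ℝ => Complex.exp (-(μ * y)) * f y) (Ioi x))
    (hgrowth : G (invDerivSub μ f)) : AnalyticOfGrowth G (invDerivSub μ f) := by
  refine of_deriv_eq hG (ι := Unit) (F := fun _ => _root_.invDerivSub μ f)
    (m := fun _ => onPos fun _ => μ) (h := fun _ => f) (σ := id)
    (fun _ x hx => onPos_of_nonpos _ hx) (fun _ => analyticOnNhd_invDerivSub hf.2.1 hinteg)
    (fun _ => hgrowth) (fun _ => const μ) (fun _ => hf) (fun _ x hx => ?_) ()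
  rw [(hasDerivAt_invDerivSub hf.continuousOn hinteg hx).deriv, onPos_of_pos _ hx]

end InvDerivSub

section DerivSubEquiv

/-- The estimates which make `∂ - μ` invertible on the functions of growth `G`. -/
structure IsDerivSubInvertible (G : (ℝ → ℂ) → Prop) (μ : ℂ) : Prop where
  integrableOn : ∀ {f : ℝ → ℂ}, ContinuousOn f (Ioi 0) → G f → ∀ x : ℝ, 0 < x →
    IntegrableOn (fun y : ℝ => Complex.exp (-(μ * y)) * f y) (Ioi x)
  tendsto : ∀ {f : ℝ → ℂ}, G f → Tendsto (fun x : ℝ => Complex.exp (-(μ * x)) * f x) atTop (𝓝 0)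
  growth : ∀ {f : ℝ → ℂ}, ContinuousOn f (Ioi 0) → G f → G (invDerivSub μ f)

variable {G : (ℝ → ℂ) → Prop} {μ : ℂ} (V : Submodule ℂ (ℝ → ℂ)) [IsGrowthSpace V G]

/-- The operator `∂ - μ`, with its inverse `invDerivSub μ`. -/
def derivSubEquiv (h : IsDerivSubInvertible G μ) : V ≃ₗ[ℂ] V where
  __ := derivEnd V - μ • 1
  invFun f := ⟨invDerivSub μ f, (IsGrowthSpace.mem_iff _).2 <|
    have hf := analyticOfGrowth_coe f
    hf.invDerivSub (IsGrowthSpace.isGrowthClass V) (h.integrableOn hf.continuousOn hf.growth)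
      (h.growth hf.continuousOn hf.growth)⟩
  left_inv f := by
    have hf := analyticOfGrowth_coe f
    have hf' := analyticOfGrowth_coe ((derivEnd V - μ • 1) f)
    refine Subtype.ext (invDerivSub_of_hasDerivAt hf.1 (fun x hx => ?_)
      (h.integrableOn hf'.continuousOn hf'.growth) (h.tendsto hf.growth))
    refine (hf.hasDerivAt hx).congr_deriv ?_
    simp only [AddHom.toFun_eq_coe, LinearMap.coe_toAddHom, LinearMap.sub_apply,
      LinearMap.smul_apply, Module.End.one_apply, AddSubgroupClass.coe_sub, Submodule.coe_smul,
      Pi.sub_apply, Pi.smul_apply, smul_eq_mul, derivEnd_apply f hx, add_sub_cancel]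
  right_inv f := ext_of_pos fun x hx => by
    have hf := analyticOfGrowth_coe f
    simp only [AddHom.toFun_eq_coe, LinearMap.coe_toAddHom, LinearMap.sub_apply,
      LinearMap.smul_apply, Module.End.one_apply, AddSubgroupClass.coe_sub, Submodule.coe_smul,
      Pi.sub_apply, Pi.smul_apply, smul_eq_mul, derivEnd_apply _ hx,
      (hasDerivAt_invDerivSub hf.continuousOn (h.integrableOn hf.continuousOn hf.growth) hx).deriv,
      add_sub_cancel_left]

variable {V}

end DerivSubEquiv

section Invertibility

theorem integrableOn_Ioi_of_isBigO {g : ℝ → ℂ} {φ : ℝ → ℝ} (hg : ContinuousOn g (Ioi 0))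
    (hgφ : g =O[atTop] φ) (hφ : IntegrableAtFilter φ atTop) {x : ℝ} (hx : 0 < x) :
    IntegrableOn g (Ioi x) :=
  (integrableOn_Ici_iff_integrableOn_Ioi (by finiteness)).1 <|
    ((hg.mono fun _ hy => hx.trans_le (mem_Ici.1 hy)).locallyIntegrableOn
      measurableSet_Ici).integrableOn_of_isBigO_atTop hgφ hφ

theorem norm_exp_neg_ofReal (y : ℝ) : ‖Complex.exp (-(y : ℂ))‖ = Real.exp (-y) := by
  rw [← Complex.ofReal_neg, Complex.norm_exp_ofReal]

variable {f : ℝ → ℂ}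

theorem PolyBounded.exp_neg_mul_isBigO (hf : PolyBounded f) :
    (fun y : ℝ => Complex.exp (-y) * f y) =O[atTop] fun y : ℝ => Real.exp (-(1 / 2) * y) := by
  obtain ⟨k, hk⟩ := hf
  have hexp : (fun y : ℝ => Complex.exp (-y)) =O[atTop] fun y : ℝ => Real.exp (-y) :=
    Asymptotics.isBigO_of_le _ fun y => by rw [norm_exp_neg_ofReal, Real.norm_eq_abs, Real.abs_exp]
  have hpow := hk.trans (isLittleO_pow_exp_pos_mul_atTop k (b := 1 / 2) one_half_pos).isBigO
  refine (hexp.mul hpow).congr_right fun y => ?_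
  rw [← Real.exp_add]
  ring_nf

theorem integrableAtFilter_exp_neg_mul {b : ℝ} (hb : 0 < b) :
    IntegrableAtFilter (fun y : ℝ => Real.exp (-b * y)) atTop :=
  ⟨Ioi 0, Ioi_mem_atTop 0, exp_neg_integrableOn_Ioi 0 hb⟩

theorem norm_integral_Ioi_le_of_hasDerivAt {h : ℝ → ℂ} {g g' : ℝ → ℝ} {x : ℝ}
    (hderiv : ∀ y ∈ Ici x, HasDerivAt g (g' y) y) (hle : ∀ y ∈ Ioi x, ‖h y‖ ≤ g' y)
    (hlim : Tendsto g atTop (𝓝 0)) : ‖∫ y in Ioi x, h y‖ ≤ -g x := by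
  have hpos : ∀ y ∈ Ioi x, 0 ≤ g' y := fun y hy => (norm_nonneg _).trans (hle y hy)
  rw [← zero_sub, ← integral_Ioi_of_hasDerivAt_of_nonneg' hderiv hpos hlim]
  refine norm_integral_le_of_norm_le (integrableOn_Ioi_deriv_of_nonneg' hderiv hpos hlim) ?_
  filter_upwards [ae_restrict_mem measurableSet_Ioi] with y hy using hle y hy

theorem pow_le_two_mul_pow_sub {k : ℕ} {y : ℝ} (hy : 0 ≤ y) (hky : 2 * k ≤ y) :
    y ^ k ≤ 2 * (y ^ k - k * y ^ (k - 1)) := by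
  rcases k with _ | k
  · norm_num
  · have hmul := mul_le_mul_of_nonneg_left hky (pow_nonneg hy k)
    rw [← pow_succ] at hmul
    rw [Nat.add_sub_cancel]
    linarith

/-- For `y ≥ 2k` the integrand `y ^ k * exp (-y)` is at most twice the derivative of
`-exp (-y) * y ^ k`. -/
theorem norm_integral_exp_neg_mul_le {k : ℕ} {M x : ℝ} (hM : 0 ≤ M) (hx : 0 < x)
    (hkx : 2 * k ≤ x) (hf : ∀ y, x < y → ‖f y‖ ≤ M * y ^ k) :
    ‖∫ y in Ioi x, Complex.exp (-y) * f y‖ ≤ 2 * M * (Real.exp (-x) * x ^ k) := by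
  have hderiv : ∀ y ∈ Ici x, HasDerivAt (fun y : ℝ => -(2 * M) * (Real.exp (-y) * y ^ k))
      (Real.exp (-y) * (M * (2 * (y ^ k - k * y ^ (k - 1))))) y := by
    intro y _
    refine (((hasDerivAt_neg y).exp.mul (hasDerivAt_pow k y)).const_mul (-(2 * M))).congr_deriv ?_
    ring
  have hle : ∀ y ∈ Ioi x, ‖Complex.exp (-y) * f y‖ ≤
      Real.exp (-y) * (M * (2 * (y ^ k - k * y ^ (k - 1)))) := by
    intro y hy
    rw [norm_mul, norm_exp_neg_ofReal]
    gcongr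
    exact (hf y hy).trans (mul_le_mul_of_nonneg_left
      (pow_le_two_mul_pow_sub (hx.trans hy).le (hkx.trans (le_of_lt hy))) hM)
  have hlim : Tendsto (fun y : ℝ => -(2 * M) * (Real.exp (-y) * y ^ k)) atTop (𝓝 0) := by
    simpa only [mul_comm (_ ^ _), mul_zero] using
      (Real.tendsto_pow_mul_exp_neg_atTop_nhds_zero k).const_mul (-(2 * M))
  refine (norm_integral_Ioi_le_of_hasDerivAt hderiv hle hlim).trans_eq ?_
  ring

theorem polyBounded_invDerivSubOne (hf : PolyBounded f) : PolyBounded (invDerivSubOne f) := by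
  obtain ⟨k, hk⟩ := hf
  obtain ⟨M, hM, hfM⟩ := hk.exists_pos
  obtain ⟨X, hX⟩ := eventually_atTop.1 hfM.bound
  refine ⟨k, Asymptotics.IsBigO.of_bound (2 * M) ?_⟩
  filter_upwards [eventually_ge_atTop X, eventually_ge_atTop (2 * k : ℝ),
    eventually_gt_atTop 0] with x hXx hkx hx
  have hbound := norm_integral_exp_neg_mul_le hM.le hx hkx fun y hxy => by
    simpa only [norm_pow, Real.norm_of_nonneg (hx.trans hxy).le] using hX y (hXx.trans hxy.le)
  rw [invDerivSubOne, onPos_of_pos _ hx, norm_mul, norm_neg, Complex.norm_exp_ofReal, norm_pow,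
    Real.norm_of_nonneg hx.le]
  calc Real.exp x * ‖∫ y in Ioi x, Complex.exp (-y) * f y‖
      ≤ Real.exp x * (2 * M * (Real.exp (-x) * x ^ k)) := by gcongr
    _ = (2 * M * x ^ k) * (Real.exp x * Real.exp (-x)) := by ring
    _ = 2 * M * x ^ k := by rw [← Real.exp_add, add_neg_cancel, Real.exp_zero, mul_one]

theorem isDerivSubInvertible_polyBounded : IsDerivSubInvertible PolyBounded 1 where
  integrableOn hcont hf x hx := by
    simpa only [one_mul] using integrableOn_Ioi_of_isBigO (ContinuousOn.fun_mul (by fun_prop) hcont)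
      hf.exp_neg_mul_isBigO (integrableAtFilter_exp_neg_mul one_half_pos) hx
  tendsto hf := by
    simpa only [one_mul] using hf.exp_neg_mul_isBigO.trans_tendsto
      (Real.tendsto_exp_atBot.comp (tendsto_id.const_mul_atTop_of_neg (by norm_num)))
  growth _ hf := by simpa only [invDerivSub_one] using polyBounded_invDerivSubOne hf

theorem RapidlyDecaying.isBigO_rpow (hf : RapidlyDecaying f) :
    f =O[atTop] fun y : ℝ => y ^ (-2 : ℝ) := by
  refine Asymptotics.IsBigO.of_bound 1 ?_
  filter_upwards [(hf 2).norm.eventually_le_const (u := 1) (by rw [norm_zero]; exact one_pos),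
    eventually_gt_atTop 0] with y hle hy
  rw [norm_mul, norm_pow, Complex.norm_real, Real.norm_of_nonneg hy.le] at hle
  rw [Real.rpow_neg hy.le, Real.rpow_two, Real.norm_of_nonneg (by positivity), one_mul,
    ← one_div, le_div_iff₀' (by positivity)]
  exact hle

theorem RapidlyDecaying.integrableOn_Ioi (hf : RapidlyDecaying f) (hcont : ContinuousOn f (Ioi 0))
    {x : ℝ} (hx : 0 < x) : IntegrableOn f (Ioi x) :=
  integrableOn_Ioi_of_isBigO hcont hf.isBigO_rpow
    ⟨Ioi 1, Ioi_mem_atTop 1, integrableOn_Ioi_rpow_of_lt (by norm_num) one_pos⟩ hx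

theorem RapidlyDecaying.pow_mul (hf : RapidlyDecaying f) (k : ℕ) :
    RapidlyDecaying fun y : ℝ => (y : ℂ) ^ k * f y :=
  fun l => (hf (l + k)).congr fun y => by ring

/-- `x ^ k` times the tail integral of `f` at `x` is at most the tail integral of
`|y ^ k * f y|`. -/
theorem rapidlyDecaying_invDeriv (hf : RapidlyDecaying f) (hcont : ContinuousOn f (Ioi 0)) :
    RapidlyDecaying (invDeriv f) := by
  intro k
  have hinteg : IntegrableOn (fun y : ℝ => ‖(y : ℂ) ^ k * f y‖) (Ioi 1) :=
    ((hf.pow_mul k).integrableOn_Ioi (ContinuousOn.mul (by fun_prop) hcont) one_pos).norm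
  have htail : Tendsto (fun x : ℝ => ∫ y in Ioi x, ‖(y : ℂ) ^ k * f y‖) atTop (𝓝 0) :=
    tendsto_integral_Ioi_zero tendsto_id
  refine squeeze_zero_norm' ?_ htail
  filter_upwards [eventually_ge_atTop 1] with x hx
  have hx0 : 0 < x := one_pos.trans_le hx
  rw [invDeriv, onPos_of_pos _ hx0, mul_neg, norm_neg, ← integral_const_mul]
  refine norm_integral_le_of_norm_le (hinteg.mono_set (Ioi_subset_Ioi hx)) ?_
  filter_upwards [ae_restrict_mem measurableSet_Ioi] with y hy
  simp only [norm_mul, norm_pow, Complex.norm_real, Real.norm_of_nonneg hx0.le,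
    Real.norm_of_nonneg (hx0.trans hy).le]
  gcongr
  exact le_of_lt hy

theorem isDerivSubInvertible_rapidlyDecaying : IsDerivSubInvertible RapidlyDecaying 0 where
  integrableOn hcont hf x hx := by
    simpa only [zero_mul, neg_zero, Complex.exp_zero, one_mul] using hf.integrableOn_Ioi hcont hx
  tendsto hf := by
    simpa only [zero_mul, neg_zero, Complex.exp_zero, pow_zero] using hf 0
  growth hcont hf := by simpa only [invDerivSub_zero] using rapidlyDecaying_invDeriv hf hcont

end Invertibility

/-! ### Uniqueness for second order equations -/

section Wronskian

/-- The Wronskian `f g' - f' g`. -/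
def wronskian (f g : ℝ → ℂ) (x : ℝ) : ℂ := f x * deriv g x - deriv f x * g x

variable {f g m P Q : ℝ → ℂ}

theorem hasDerivAt_wronskian {x : ℝ} (hf : AnalyticAt ℝ f x) (hg : AnalyticAt ℝ g x) :
    HasDerivAt (wronskian f g) (f x * deriv (deriv g) x - deriv (deriv f) x * g x) x := by
  have hf' := hf.deriv.differentiableAt.hasDerivAt
  have hg' := hg.deriv.differentiableAt.hasDerivAt
  refine ((hf.differentiableAt.hasDerivAt.fun_mul hg').fun_sub
    (hf'.fun_mul hg.differentiableAt.hasDerivAt)).congr_deriv ?_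
  ring

/-- Abel's identity: the Wronskian times an integrating factor is constant. -/
theorem wronskian_eq_zero_of_ode (hf : AnalyticOnNhd ℝ f (Ioi 0)) (hg : AnalyticOnNhd ℝ g (Ioi 0))
    (hm : ∀ x, 0 < x → m x ≠ 0) (hm' : ∀ x, 0 < x → HasDerivAt m (P x * m x) x)
    (hodef : ∀ x, 0 < x → deriv (deriv f) x + P x * deriv f x + Q x * f x = 0)
    (hodeg : ∀ x, 0 < x → deriv (deriv g) x + P x * deriv g x + Q x * g x = 0)
    (hlim : Tendsto (fun x => m x * wronskian f g x) atTop (𝓝 0)) {x : ℝ} (hx : 0 < x) :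
    wronskian f g x = 0 := by
  have hderiv : ∀ y ∈ Ioi (0 : ℝ), HasDerivAt (fun x => m x * wronskian f g x) 0 y := by
    intro y hy
    refine ((hm' y hy).fun_mul (hasDerivAt_wronskian (hf y hy) (hg y hy))).congr_deriv ?_
    rw [wronskian]
    linear_combination m y * f y * hodeg y hy - m y * g y * hodef y hy
  have hconst : Tendsto (fun x => m x * wronskian f g x) atTop (𝓝 (m x * wronskian f g x)) := by
    refine tendsto_const_nhds.congr' ?_
    filter_upwards [eventually_gt_atTop 0] with y hy
      using eq_of_hasDerivAt_zero (convex_Ioi 0) hderiv hx hy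
  exact (mul_eq_zero.1 (tendsto_nhds_unique hconst hlim)).resolve_left (hm x hx)

/-- The quotient `g / f` is constant near a point where `f` does not vanish. -/
theorem eqOn_smul_of_wronskian_eq_zero (hf : AnalyticOnNhd ℝ f (Ioi 0))
    (hg : AnalyticOnNhd ℝ g (Ioi 0)) (hw : ∀ x, 0 < x → wronskian f g x = 0) {x₀ : ℝ}
    (hx₀ : 0 < x₀) (hfx₀ : f x₀ ≠ 0) : EqOn ((g x₀ / f x₀) • f) g (Ioi 0) := by
  obtain ⟨ε, hε, hball⟩ : ∃ ε > 0, ∀ y ∈ Metric.ball x₀ ε, 0 < y ∧ f y ≠ 0 :=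
    Metric.eventually_nhds_iff_ball.1
      ((eventually_gt_nhds hx₀).and ((hf x₀ hx₀).continuousAt.eventually_ne hfx₀))
  have hquot : ∀ y ∈ Metric.ball x₀ ε, HasDerivAt (fun z => g z / f z) 0 y := by
    intro y hy
    obtain ⟨hy0, hfy⟩ := hball y hy
    refine ((hg y hy0).differentiableAt.hasDerivAt.fun_div
      (hf y hy0).differentiableAt.hasDerivAt hfy).congr_deriv ?_
    have hwy := hw y hy0
    rw [wronskian] at hwy
    rw [div_eq_zero_iff]
    left
    linear_combination hwy
  refine hf.const_smul.eqOn_of_preconnected_of_eventuallyEq hg isPreconnected_Ioi hx₀ ?_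
  filter_upwards [Metric.ball_mem_nhds x₀ hε] with y hy
  rw [Pi.smul_apply, smul_eq_mul, eq_of_hasDerivAt_zero (convex_ball x₀ ε) hquot
    (Metric.mem_ball_self hε) hy, div_mul_cancel₀ _ (hball y hy).2]

theorem hasDerivAt_ofReal_cpow (s : ℂ) {t : ℝ} (ht : 0 < t) :
    HasDerivAt (fun t : ℝ => (t : ℂ) ^ s) (s * (t : ℂ) ^ (s - 1)) t := by
  simpa only [id_eq, mul_one] using ((hasDerivAt_id (t : ℂ)).cpow_const (c := s)
    (Complex.ofReal_mem_slitPlane.2 ht)).comp_ofReal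

theorem AnalyticOfGrowth.growth_wronskian {G : (ℝ → ℂ) → Prop} (hG : IsGrowthClass G)
    (hf : AnalyticOfGrowth G f) (hg : AnalyticOfGrowth G g) : G (wronskian f g) := by
  have hadd := hG.add (hG.mul (hG.polyBounded hf.growth) hg.growth_deriv)
    (hG.mul (polyBounded_const (-1)) (hG.mul (hG.polyBounded hf.growth_deriv) hg.growth))
  refine hG.congr hadd (.of_forall fun x => ?_)
  rw [wronskian]
  ring

variable {G : (ℝ → ℂ) → Prop} {V : Submodule ℂ (ℝ → ℂ)}

theorem mem_span_singleton_of_ode [IsGrowthSpace V G] {f g : V} (hf : f ≠ 0)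
    (hm : ∀ x, 0 < x → m x ≠ 0) (hm' : ∀ x, 0 < x → HasDerivAt m (P x * m x) x)
    (hodef : ∀ x, 0 < x → deriv (deriv f) x + P x * deriv f x + Q x * (f : ℝ → ℂ) x = 0)
    (hodeg : ∀ x, 0 < x → deriv (deriv g) x + P x * deriv g x + Q x * (g : ℝ → ℂ) x = 0)
    (hlim : Tendsto (fun x => m x * wronskian f g x) atTop (𝓝 0)) : g ∈ ℂ ∙ f := by
  obtain ⟨x₀, hx₀, hfx₀⟩ : ∃ x, 0 < x ∧ (f : ℝ → ℂ) x ≠ 0 := by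
    by_contra! hzero
    exact hf (ext_of_pos hzero)
  have hfan := (analyticOfGrowth_coe f).2.1
  have hgan := (analyticOfGrowth_coe g).2.1
  refine Submodule.mem_span_singleton.2 ⟨(g : ℝ → ℂ) x₀ / (f : ℝ → ℂ) x₀, ext_of_pos ?_⟩
  exact eqOn_smul_of_wronskian_eq_zero hfan hgan
    (fun x hx => wronskian_eq_zero_of_ode hfan hgan hm hm' hodef hodeg hlim hx) hx₀ hfx₀

theorem mem_span_singleton_of_linear_ode [IsGrowthSpace V G] {μ r : ℂ}
    (h : IsDerivSubInvertible G μ) {f g : V} (hf : f ≠ 0) (hodef : ∀ x : ℝ, 0 < x →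
      x * deriv (deriv f) x + (r - μ * x) * deriv f x + Q x * (f : ℝ → ℂ) x = 0)
    (hodeg : ∀ x : ℝ, 0 < x →
      x * deriv (deriv g) x + (r - μ * x) * deriv g x + Q x * (g : ℝ → ℂ) x = 0) :
    g ∈ ℂ ∙ f := by
  have hnormalize : ∀ {k k' k'' : ℂ} {x : ℝ}, 0 < x →
      x * k'' + (r - μ * x) * k' + Q x * k = 0 → k'' + (r / x - μ) * k' + Q x / x * k = 0 := by
    intro k k' k'' x hx hode
    have hx' := ofReal_ne_zero_of_pos hx
    refine mul_left_cancel₀ hx' ?_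
    rw [← hode.trans (mul_zero _).symm]
    field_simp
  refine mem_span_singleton_of_ode (m := fun x : ℝ => Complex.exp (-μ * x) * (x : ℂ) ^ r)
    (P := fun x => r / x - μ) (Q := fun x => Q x / x) hf (fun x hx => ?_) (fun x hx => ?_)
    (fun x hx => hnormalize hx (hodef x hx)) (fun x hx => hnormalize hx (hodeg x hx)) ?_
  · exact mul_ne_zero (Complex.exp_ne_zero _)
      (Complex.cpow_ne_zero_iff.2 (.inl (ofReal_ne_zero_of_pos hx)))
  · refine ((hasDerivAt_exp_mul (-μ) x).mul (hasDerivAt_ofReal_cpow r hx)).congr_deriv ?_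
    rw [Complex.cpow_sub _ _ (ofReal_ne_zero_of_pos hx), Complex.cpow_one]
    ring
  · have hG := IsGrowthSpace.isGrowthClass V
    have hgrowth := hG.mul (polyBounded_cpow r)
      ((analyticOfGrowth_coe f).growth_wronskian hG (analyticOfGrowth_coe g))
    refine (h.tendsto hgrowth).congr fun x => ?_
    rw [neg_mul, mul_assoc]

end Wronskian

/-! ### Laplace–Mellin integrals -/

section LaplaceMellin

/-- The integral `∫₀^∞ t^{s-1} e^{-zt} ψ(t) dt`: the Mellin transform in `t`, at `s`, of `ψ` damped
by an exponential. Macdonald's and Tricomi's functions are of this form as functions of `z`. -/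
def laplaceMellin (ψ : ℝ → ℂ) (s z : ℂ) : ℂ :=
  mellin (fun t : ℝ => Complex.exp (-(z * t)) * ψ t) s

/-- Absolute convergence of the integral `laplaceMellin ψ s z` on the half-plane `Re z > 0`; by
monotonicity it is enough to ask for it at the positive real `z`. -/
def LaplaceMellinConvergent (ψ : ℝ → ℂ) (s : ℂ) : Prop :=
  ∀ x : ℝ, 0 < x → MellinConvergent (fun t : ℝ => Complex.exp (-((x : ℂ) * t)) * ψ t) s

variable {ψ ψ' φ B : ℝ → ℂ} {s z : ℂ}

theorem norm_exp_neg_mul (z : ℂ) (t : ℝ) : ‖Complex.exp (-(z * t))‖ = Real.exp (-(z.re * t)) := by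
  rw [Complex.norm_exp, Complex.neg_re, Complex.re_mul_ofReal]

theorem hasDerivAt_exp_neg_mul (z : ℂ) (t : ℝ) :
    HasDerivAt (fun t : ℝ => Complex.exp (-(z * t))) (-z * Complex.exp (-(z * t))) t := by
  simpa only [neg_mul] using hasDerivAt_exp_mul (-z) t

theorem tendsto_nhdsGT_exp_neg_mul (z : ℂ) :
    Tendsto (fun t : ℝ => Complex.exp (-(z * t))) (𝓝[>] 0) (𝓝 1) := by
  have hlim := (hasDerivAt_exp_neg_mul z 0).continuousAt.tendsto
  rw [Complex.ofReal_zero, mul_zero, neg_zero, Complex.exp_zero] at hlim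
  exact hlim.mono_left nhdsWithin_le_nhds

namespace LaplaceMellinConvergent

theorem mellinConvergent (h : LaplaceMellinConvergent ψ s) (hz : 0 < z.re) :
    MellinConvergent (fun t : ℝ => Complex.exp (-(z * t)) * ψ t) s := by
  refine Integrable.mono (h z.re hz) ?_ (Eventually.of_forall fun t => ?_)
  · have hcont : Continuous fun t : ℝ => Complex.exp ((z.re - z) * t) := by fun_prop
    refine (hcont.aestronglyMeasurable.mul (h z.re hz).aestronglyMeasurable).congr
      (Eventually.of_forall fun t => ?_)
    simp only [Pi.mul_apply, smul_eq_mul]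
    rw [mul_left_comm, ← mul_assoc (Complex.exp _), ← Complex.exp_add]
    ring_nf
  · simp only [norm_smul, norm_mul, norm_exp_neg_mul, Complex.ofReal_re, le_refl]

theorem add_one (h : LaplaceMellinConvergent ψ s) : LaplaceMellinConvergent ψ (s + 1) := by
  intro x hx
  have hcont : Continuous fun t : ℝ => (t : ℂ) * Complex.exp (-((x / 2 : ℝ) * t)) := by fun_prop
  refine ((h (x / 2) (half_pos hx)).bdd_mul (c := (x / 2)⁻¹) hcont.aestronglyMeasurable ?_).congr ?_
  · filter_upwards [ae_restrict_mem measurableSet_Ioi] with t (ht : 0 < t)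
    have hexp := Real.add_one_le_exp (x / 2 * t)
    rw [norm_mul, norm_exp_neg_mul, Complex.ofReal_re, Complex.norm_real, Real.norm_of_nonneg ht.le,
      Real.exp_neg, ← div_eq_mul_inv, div_le_iff₀ (Real.exp_pos _), ← div_eq_inv_mul,
      le_div_iff₀ (half_pos hx)]
    linarith
  · filter_upwards [ae_restrict_mem measurableSet_Ioi] with t ht
    have hexp : Complex.exp (-((x : ℂ) * t)) =
        Complex.exp (-((x / 2 : ℝ) * t)) * Complex.exp (-((x / 2 : ℝ) * t)) := by
      rw [← Complex.exp_add]
      push_cast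
      ring_nf
    rw [show s + 1 - 1 = s - 1 + 1 by ring, Complex.cpow_add _ _ (ofReal_ne_zero_of_pos ht),
      Complex.cpow_one, hexp]
    simp only [smul_eq_mul]
    ring

theorem cpow_mul {r : ℂ} (h : LaplaceMellinConvergent ψ (s + r)) :
    LaplaceMellinConvergent (fun t => (t : ℂ) ^ r * ψ t) s := fun x hx => by
  simpa only [smul_eq_mul, mul_left_comm] using MellinConvergent.cpow_smul.2 (h x hx)

theorem const_mul (a : ℂ) (h : LaplaceMellinConvergent ψ s) :
    LaplaceMellinConvergent (fun t => a * ψ t) s := fun x hx => by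
  simpa only [smul_eq_mul, mul_left_comm] using (h x hx).const_smul a

theorem of_isBigO {b : ℝ} {k : ℕ} (hcont : ContinuousOn ψ (Ioi 0))
    (htop : ψ =O[atTop] fun t : ℝ => t ^ k) (hzero : ψ =O[𝓝[>] 0] fun t : ℝ => t ^ (-b))
    (hb : b < s.re) : LaplaceMellinConvergent ψ s := by
  intro x hx
  have hexp (l : Filter ℝ) : (fun t : ℝ => Complex.exp (-((x : ℂ) * t))) =O[l]
      fun t : ℝ => Real.exp (-(x * t)) :=
    Asymptotics.IsBigO.of_norm_le fun t => by rw [norm_exp_neg_mul, Complex.ofReal_re]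
  refine mellinConvergent_of_isBigO_rpow_exp (half_pos hx) ?_ ?_ ?_ hb
  · exact (ContinuousOn.mul (by fun_prop) hcont).locallyIntegrableOn measurableSet_Ioi
  · refine ((hexp atTop).mul (htop.trans
      (isLittleO_pow_exp_pos_mul_atTop k (half_pos hx)).isBigO)).congr_right fun t => ?_
    rw [← Real.exp_add]
    ring_nf
  · have hbdd : (fun t : ℝ => Complex.exp (-((x : ℂ) * t))) =O[𝓝[>] 0] fun _ => (1 : ℝ) :=
      (tendsto_nhdsGT_exp_neg_mul x).isBigO_one ℝ
    exact (hbdd.mul hzero).congr_right fun t => one_mul _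

end LaplaceMellinConvergent

theorem laplaceMellin_cpow_mul (r : ℂ) :
    laplaceMellin (fun t => (t : ℂ) ^ r * ψ t) s z = laplaceMellin ψ (s + r) z := by
  simpa only [laplaceMellin, smul_eq_mul, mul_left_comm]
    using mellin_cpow_smul (fun t : ℝ => Complex.exp (-(z * t)) * ψ t) s r

theorem laplaceMellin_const_mul (a : ℂ) :
    laplaceMellin (fun t => a * ψ t) s z = a * laplaceMellin ψ s z := by
  simpa only [laplaceMellin, smul_eq_mul, mul_left_comm]
    using mellin_const_smul (fun t : ℝ => Complex.exp (-(z * t)) * ψ t) s a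

theorem laplaceMellin_add (hψ : LaplaceMellinConvergent ψ s) (hφ : LaplaceMellinConvergent φ s)
    (hz : 0 < z.re) :
    laplaceMellin (fun t => ψ t + φ t) s z = laplaceMellin ψ s z + laplaceMellin φ s z := by
  simpa only [laplaceMellin, mul_add]
    using (hasMellin_add (hψ.mellinConvergent hz) (hφ.mellinConvergent hz)).2

theorem laplaceMellin_congr (h : EqOn ψ φ (Ioi 0)) : laplaceMellin ψ s z = laplaceMellin φ s z :=
  setIntegral_congr_fun measurableSet_Ioi fun t ht => by simp only [h ht]

/-- At `s = 0` the integral `mellin f 0` is multiplied by `0` and need not converge. -/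
theorem mul_mellin_add_mellin_deriv {f f' : ℝ → ℂ} {l : ℂ}
    (hderiv : ∀ t, 0 < t → HasDerivAt f (f' t) t) (hf : s ≠ 0 → MellinConvergent f s)
    (hf_succ : MellinConvergent f (s + 1)) (hf' : MellinConvergent f' (s + 1))
    (hlim : Tendsto (fun t : ℝ => (t : ℂ) ^ s * f t) (𝓝[>] 0) (𝓝 l)) :
    s * mellin f s + mellin f' (s + 1) = -l := by
  have hu : ∀ t ∈ Ioi (0 : ℝ), HasDerivAt (fun t : ℝ => (t : ℂ) ^ s) (s * (t : ℂ) ^ (s - 1)) t :=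
    fun t ht => hasDerivAt_ofReal_cpow s ht
  have hinteg : IntegrableOn (fun t : ℝ => s * (t : ℂ) ^ (s - 1) * f t) (Ioi 0) := by
    rcases eq_or_ne s 0 with rfl | hs
    · simp only [zero_mul, integrableOn_zero]
    · simp only [mul_assoc]
      exact Integrable.const_mul (hf hs) s
  have hinteg' : IntegrableOn (fun t : ℝ => (t : ℂ) ^ s * f' t) (Ioi 0) := by
    simpa only [MellinConvergent, add_sub_cancel_right, smul_eq_mul] using hf'
  have hinteg_prod : IntegrableOn (fun t : ℝ => (t : ℂ) ^ s * f t) (Ioi 0) := by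
    simpa only [MellinConvergent, add_sub_cancel_right, smul_eq_mul] using hf_succ
  have htop : Tendsto (fun t : ℝ => (t : ℂ) ^ s * f t) atTop (𝓝 0) :=
    tendsto_zero_of_hasDerivAt_of_integrableOn_Ioi (fun t ht => (hu t ht).mul (hderiv t ht))
      (hinteg.add hinteg') hinteg_prod
  have hparts := integral_Ioi_deriv_mul_eq_sub hu hderiv (hinteg.add hinteg') hlim htop
  rw [integral_add hinteg hinteg', zero_sub] at hparts
  rw [← hparts, mellin, mellin, ← integral_const_mul]
  simp only [smul_eq_mul, mul_assoc, add_sub_cancel_right]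

theorem laplaceMellin_by_parts {l : ℂ} (hderiv : ∀ t, 0 < t → HasDerivAt ψ (ψ' t) t)
    (hψ : s ≠ 0 → LaplaceMellinConvergent ψ s) (hψ_succ : LaplaceMellinConvergent ψ (s + 1))
    (hψ' : LaplaceMellinConvergent ψ' (s + 1))
    (hlim : Tendsto (fun t : ℝ => (t : ℂ) ^ s * ψ t) (𝓝[>] 0) (𝓝 l)) (hz : 0 < z.re) :
    s * laplaceMellin ψ s z + laplaceMellin ψ' (s + 1) z = z * laplaceMellin ψ (s + 1) z - l := by
  have hsum := hasMellin_add ((hψ_succ.mellinConvergent hz).const_smul (-z))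
    (hψ'.mellinConvergent hz)
  rw [mellin_const_smul] at hsum
  have hparts := mul_mellin_add_mellin_deriv (l := l)
    (fun t ht => ((hasDerivAt_exp_neg_mul z t).mul (hderiv t ht)).congr_deriv ?_)
    (fun hs => (hψ hs).mellinConvergent hz) (hψ_succ.mellinConvergent hz) hsum.1 ?_
  · rw [hsum.2] at hparts
    simp only [laplaceMellin, smul_eq_mul] at hparts ⊢
    linear_combination hparts
  · simp only [smul_eq_mul, mul_assoc]
  · refine ((tendsto_nhdsGT_exp_neg_mul z).mul hlim).congr (fun t => ?_) |>.trans_eq ?_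
    · simp only [Pi.mul_apply, mul_left_comm]
    · rw [one_mul]

theorem norm_cpow_smul_exp_neg_mul_le {w : ℂ} {t : ℝ} (ht : 0 < t) (hzw : z.re ≤ w.re) (r a : ℂ) :
    ‖(t : ℂ) ^ r • (Complex.exp (-(w * t)) * a)‖ ≤
      ‖(t : ℂ) ^ r • (Complex.exp (-(z * t)) * a)‖ := by
  simp only [norm_smul, norm_mul, norm_exp_neg_mul]
  gcongr

theorem hasDerivAt_cpow_smul_exp_neg_mul {t : ℝ} (ht : 0 < t) (a w : ℂ) :
    HasDerivAt (fun w : ℂ => (t : ℂ) ^ (s - 1) • (Complex.exp (-(w * t)) * a))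
      (-((t : ℂ) ^ (s + 1 - 1) • (Complex.exp (-(w * t)) * a))) w := by
  have hlin : HasDerivAt (fun w : ℂ => -(w * t)) (-t) w := by
    simpa only [id_eq, one_mul] using ((hasDerivAt_id w).mul_const (t : ℂ)).fun_neg
  refine ((hlin.cexp.mul_const a).const_smul ((t : ℂ) ^ (s - 1))).congr_deriv ?_
  rw [show s + 1 - 1 = s - 1 + 1 by ring, Complex.cpow_add _ _ (ofReal_ne_zero_of_pos ht),
    Complex.cpow_one]
  simp only [smul_eq_mul]
  ring

theorem hasDerivAt_laplaceMellin (h : LaplaceMellinConvergent ψ s) (hz : 0 < z.re) :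
    HasDerivAt (laplaceMellin ψ s) (-laplaceMellin ψ (s + 1) z) z := by
  have hz_half : 0 < (z / 2).re := by
    rw [Complex.div_ofNat_re]
    linarith
  have hnhds : {w : ℂ | (z / 2).re < w.re} ∈ 𝓝 z := by
    refine (isOpen_lt continuous_const Complex.continuous_re).mem_nhds ?_
    rw [mem_ofPred_eq, Complex.div_ofNat_re]
    linarith
  have hderiv := hasDerivAt_integral_of_dominated_loc_of_deriv_le (μ := volume.restrict (Ioi 0))
    (F := fun (w : ℂ) (t : ℝ) => (t : ℂ) ^ (s - 1) • (Complex.exp (-(w * t)) * ψ t))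
    (F' := fun (w : ℂ) (t : ℝ) => -((t : ℂ) ^ (s + 1 - 1) • (Complex.exp (-(w * t)) * ψ t)))
    (bound := fun t : ℝ => ‖(t : ℂ) ^ (s + 1 - 1) • (Complex.exp (-(z / 2 * t)) * ψ t)‖)
    hnhds ?_ (h.mellinConvergent hz) (h.add_one.mellinConvergent hz).aestronglyMeasurable.neg ?_
    (h.add_one.mellinConvergent hz_half).norm ?_
  · refine hderiv.2.congr_deriv ?_
    rw [integral_neg, laplaceMellin, mellin]
  · filter_upwards [hnhds] with w (hw : (z / 2).re < w.re)
    exact (h.mellinConvergent (hz_half.trans hw)).aestronglyMeasurable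
  · filter_upwards [ae_restrict_mem measurableSet_Ioi] with t ht w (hw : (z / 2).re < w.re)
    rw [norm_neg]
    exact norm_cpow_smul_exp_neg_mul_le ht hw.le _ _
  · filter_upwards [ae_restrict_mem measurableSet_Ioi] with t ht w _
    exact hasDerivAt_cpow_smul_exp_neg_mul ht _ _

theorem hasDerivAt_laplaceMellin_ofReal (h : LaplaceMellinConvergent ψ s) {x : ℝ} (hx : 0 < x) :
    HasDerivAt (fun x : ℝ => laplaceMellin ψ s x) (-laplaceMellin ψ (s + 1) x) x :=
  (hasDerivAt_laplaceMellin h (z := x) hx).comp_ofReal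

theorem analyticOnNhd_laplaceMellin (h : LaplaceMellinConvergent ψ s) :
    AnalyticOnNhd ℝ (fun x : ℝ => laplaceMellin ψ s x) (Ioi 0) := by
  intro x hx
  have hdiff : DifferentiableOn ℂ (laplaceMellin ψ s) {w : ℂ | 0 < w.re} := fun w hw =>
    (hasDerivAt_laplaceMellin h hw).differentiableAt.differentiableWithinAt
  have hana := (hdiff.analyticAt (z := (x : ℂ)) ((isOpen_lt continuous_const
    Complex.continuous_re).mem_nhds hx)).restrictScalars (𝕜 := ℝ)
  exact hana.comp (f := fun y : ℝ => (y : ℂ)) (Complex.ofRealCLM.analyticAt x)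

theorem isBigO_one_laplaceMellin (h : LaplaceMellinConvergent ψ s) :
    (fun x : ℝ => laplaceMellin ψ s x) =O[atTop] fun _ => (1 : ℝ) := by
  refine Asymptotics.IsBigO.of_bound
    (∫ t in Ioi (0 : ℝ), ‖(t : ℂ) ^ (s - 1) • (Complex.exp (-((1 : ℝ) * t)) * ψ t)‖) ?_
  filter_upwards [eventually_ge_atTop 1] with x hx
  rw [norm_one, mul_one]
  refine norm_integral_le_of_norm_le (h 1 one_pos).norm ?_
  filter_upwards [ae_restrict_mem measurableSet_Ioi] with t ht
  exact norm_cpow_smul_exp_neg_mul_le ht hx _ _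

theorem LaplaceMellinConvergent.analyticOfGrowth (h : LaplaceMellinConvergent ψ s) :
    AnalyticOfGrowth PolyBounded (onPos fun x => laplaceMellin ψ s x) := by
  refine AnalyticOfGrowth.of_deriv_eq isGrowthClass_polyBounded
    (ι := {s : ℂ // LaplaceMellinConvergent ψ s}) (F := fun s => onPos fun x => laplaceMellin ψ s x)
    (m := fun _ => onPos fun _ => -1) (h := fun _ _ => 0) (σ := fun s => ⟨s + 1, s.2.add_one⟩)
    (fun _ x hx => onPos_of_nonpos _ hx)
    (fun s => analyticOnNhd_onPos (analyticOnNhd_laplaceMellin s.2)) (fun s => ?_)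
    (fun _ => AnalyticOfGrowth.const _) (fun _ => AnalyticOfGrowth.zero isGrowthClass_polyBounded)
    (fun s x hx => ?_) ⟨s, h⟩
  · refine isGrowthClass_polyBounded.congr ⟨0, ?_⟩ (onPos_eventuallyEq_atTop _).symm
    simpa only [pow_zero] using isBigO_one_laplaceMellin s.2
  · rw [(onPos_eventuallyEq_nhds _ hx).deriv_eq, (hasDerivAt_laplaceMellin_ofReal s.2 hx).deriv,
      onPos_of_pos _ hx, onPos_of_pos _ hx, neg_one_mul, add_zero]

theorem exp_neg_mul_comp_inv_mul {x : ℝ} (hx : 0 < x) (ψ : ℝ → ℂ) (t : ℝ) :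
    Complex.exp (-((x : ℂ) * (x⁻¹ * t : ℝ))) * ψ (x⁻¹ * t) =
      Complex.exp (-(1 * t)) * ψ (t / x) := by
  rw [Complex.ofReal_mul, Complex.ofReal_inv, mul_inv_cancel_left₀ (ofReal_ne_zero_of_pos hx),
    one_mul, inv_mul_eq_div]

theorem LaplaceMellinConvergent.mellinConvergent_comp_div (h : LaplaceMellinConvergent ψ s) {x : ℝ}
    (hx : 0 < x) : MellinConvergent (fun t : ℝ => Complex.exp (-(1 * t)) * ψ (t / x)) s := by
  simpa only [exp_neg_mul_comp_inv_mul hx]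
    using (MellinConvergent.comp_mul_left (inv_pos.2 hx)).2 (h x hx)

theorem laplaceMellin_comp_div {x : ℝ} (hx : 0 < x) :
    laplaceMellin (fun t => ψ (t / x)) s 1 = ((x⁻¹ : ℝ) : ℂ) ^ (-s) * laplaceMellin ψ s x := by
  simpa only [laplaceMellin, exp_neg_mul_comp_inv_mul hx, smul_eq_mul] using mellin_comp_mul_left
    (fun t : ℝ => Complex.exp (-((x : ℂ) * t)) * ψ t) s (inv_pos.2 hx)

theorem laplaceMellin_one (hs : 0 < s.re) : laplaceMellin (fun _ => 1) s 1 = Complex.Gamma s := by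
  rw [Complex.Gamma_eq_integral hs, Complex.GammaIntegral_eq_mellin, laplaceMellin]
  simp only [one_mul, mul_one, Complex.ofReal_exp, Complex.ofReal_neg]

theorem tendsto_laplaceMellin_comp_div (h : LaplaceMellinConvergent ψ s) (hs : 0 < s.re)
    {l : Filter ℝ} [l.IsCountablyGenerated] (hl : ∀ᶠ x in l, 0 < x)
    (hlim : ∀ t, 0 < t → Tendsto (fun x => ψ (t / x)) l (𝓝 1))
    (hbound : ∀ᶠ x in l, ∀ t, 0 < t → ‖ψ (t / x)‖ ≤ ‖B t‖) (hB : LaplaceMellinConvergent B s) :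
    Tendsto (fun x => laplaceMellin (fun t => ψ (t / x)) s 1) l (𝓝 (Complex.Gamma s)) := by
  rw [← laplaceMellin_one hs]
  refine tendsto_integral_filter_of_dominated_convergence
    (fun t : ℝ => ‖(t : ℂ) ^ (s - 1) • (Complex.exp (-(1 * t)) * B t)‖) ?_ ?_
    (hB.mellinConvergent (z := 1) (by rw [Complex.one_re]; exact one_pos)).norm ?_
  · filter_upwards [hl] with x hx using (h.mellinConvergent_comp_div hx).aestronglyMeasurable
  · filter_upwards [hbound] with x hx
    filter_upwards [ae_restrict_mem measurableSet_Ioi] with t ht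
    simp only [norm_smul, norm_mul]
    gcongr
    exact hx t ht
  · filter_upwards [ae_restrict_mem measurableSet_Ioi] with t ht
    exact ((hlim t ht).const_mul _).const_smul _

theorem exists_laplaceMellin_ne_zero (h : LaplaceMellinConvergent ψ s) (hs : 0 < s.re)
    {l : Filter ℝ} [l.NeBot] [l.IsCountablyGenerated] (hl : ∀ᶠ x in l, 0 < x)
    (hlim : ∀ t, 0 < t → Tendsto (fun x => ψ (t / x)) l (𝓝 1))
    (hbound : ∀ᶠ x in l, ∀ t, 0 < t → ‖ψ (t / x)‖ ≤ ‖B t‖) (hB : LaplaceMellinConvergent B s) :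
    ∃ x : ℝ, 0 < x ∧ laplaceMellin ψ s x ≠ 0 := by
  by_contra! hzero
  refine Complex.Gamma_ne_zero_of_re_pos hs (tendsto_nhds_unique
    (tendsto_laplaceMellin_comp_div h hs hl hlim hbound hB) (tendsto_const_nhds.congr' ?_))
  filter_upwards [hl] with x hx
  rw [laplaceMellin_comp_div hx, hzero x hx, mul_zero]

end LaplaceMellin

/-! ### Macdonald's function -/

section Macdonald

theorem norm_exp_neg_inv (t : ℝ) : ‖Complex.exp (-(t : ℂ)⁻¹)‖ = Real.exp (-t⁻¹) := by
  rw [Complex.norm_exp, ← Complex.ofReal_inv, ← Complex.ofReal_neg, Complex.ofReal_re]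

theorem norm_exp_neg_inv_le_one {t : ℝ} (ht : 0 < t) : ‖Complex.exp (-(t : ℂ)⁻¹)‖ ≤ 1 := by
  rw [norm_exp_neg_inv, Real.exp_le_one_iff, neg_nonpos]
  exact (inv_pos.2 ht).le

theorem exp_neg_inv_isLittleO_rpow (b : ℝ) :
    (fun t : ℝ => Complex.exp (-(t : ℂ)⁻¹)) =o[𝓝[>] 0] fun t : ℝ => t ^ (-b) := by
  have hexp := (isLittleO_exp_neg_mul_rpow_atTop one_pos b).comp_tendsto tendsto_inv_nhdsGT_zero
  refine Asymptotics.IsLittleO.of_norm_left (hexp.congr' (Eventually.of_forall fun t => ?_) ?_)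
  · simp only [Function.comp_apply, neg_one_mul, norm_exp_neg_inv]
  · filter_upwards [self_mem_nhdsWithin] with t (ht : 0 < t)
    rw [Function.comp_apply, Real.inv_rpow ht.le, Real.rpow_neg ht.le]

theorem tendsto_cpow_mul_exp_neg_inv (s : ℂ) :
    Tendsto (fun t : ℝ => (t : ℂ) ^ s * Complex.exp (-(t : ℂ)⁻¹)) (𝓝[>] 0) (𝓝 0) := by
  have hcpow : (fun t : ℝ => (t : ℂ) ^ s) =O[𝓝[>] 0] fun t : ℝ => t ^ s.re :=
    Asymptotics.IsBigO.of_norm_eventuallyLE (by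
      filter_upwards [self_mem_nhdsWithin] with t ht
      exact (Complex.norm_cpow_eq_rpow_re_of_pos ht s).le)
  rw [← Asymptotics.isLittleO_one_iff ℝ]
  refine (hcpow.mul_isLittleO (exp_neg_inv_isLittleO_rpow s.re)).congr' EventuallyEq.rfl ?_
  filter_upwards [self_mem_nhdsWithin] with t (ht : 0 < t)
  rw [← Real.rpow_add ht, add_neg_cancel, Real.rpow_zero]

theorem hasDerivAt_exp_neg_inv {t : ℝ} (ht : 0 < t) :
    HasDerivAt (fun t : ℝ => Complex.exp (-(t : ℂ)⁻¹))
      ((t : ℂ) ^ (-2 : ℂ) * Complex.exp (-(t : ℂ)⁻¹)) t := by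
  refine (hasDerivAt_inv (ofReal_ne_zero_of_pos ht)).fun_neg.cexp.comp_ofReal.congr_deriv ?_
  rw [neg_neg, mul_comm, Complex.cpow_neg, Complex.cpow_ofNat]

theorem laplaceMellinConvergent_exp_neg_inv (s : ℂ) :
    LaplaceMellinConvergent (fun t : ℝ => Complex.exp (-(t : ℂ)⁻¹)) s := by
  refine LaplaceMellinConvergent.of_isBigO (k := 0)
    (fun t ht => (hasDerivAt_exp_neg_inv ht).continuousAt.continuousWithinAt) ?_
    (exp_neg_inv_isLittleO_rpow (s.re - 1)).isBigO (sub_one_lt _)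
  refine Asymptotics.IsBigO.of_norm_eventuallyLE ?_
  filter_upwards [eventually_gt_atTop 0] with t ht
  rw [pow_zero]
  exact norm_exp_neg_inv_le_one ht

theorem laplaceMellinConvergent_one {s : ℂ} (hs : 0 < s.re) :
    LaplaceMellinConvergent (fun _ => 1) s := by
  refine LaplaceMellinConvergent.of_isBigO (k := 0) (b := 0) continuousOn_const ?_ ?_ hs
  · simpa only [pow_zero] using Asymptotics.isBigO_const_const (1 : ℂ) one_ne_zero atTop
  · simpa only [neg_zero, Real.rpow_zero]
      using Asymptotics.isBigO_const_const (1 : ℂ) one_ne_zero (𝓝[>] 0)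

/-- The integral `∫₀^∞ t^{u-1} e^{-xt-1/t} dt`; up to a constant, `x^{-u} K_u(x)` is its value at
`x² / 4`. -/
def macdonaldIntegral (u : ℂ) (x : ℝ) : ℂ :=
  laplaceMellin (fun t : ℝ => Complex.exp (-(t : ℂ)⁻¹)) u x

theorem macdonaldIntegral_recurrence (u : ℂ) {x : ℝ} (hx : 0 < x) :
    x * macdonaldIntegral (u + 1) x = u * macdonaldIntegral u x + macdonaldIntegral (u - 1) x := by
  have hshift : u + 1 + (-2) = u - 1 := by ring
  have hparts := laplaceMellin_by_parts (z := x) (fun t ht => hasDerivAt_exp_neg_inv ht)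
    (fun _ => laplaceMellinConvergent_exp_neg_inv u) (laplaceMellinConvergent_exp_neg_inv (u + 1))
    (laplaceMellinConvergent_exp_neg_inv _).cpow_mul (tendsto_cpow_mul_exp_neg_inv u) hx
  rw [laplaceMellin_cpow_mul, hshift, sub_zero] at hparts
  exact hparts.symm

theorem pow_mul_macdonaldIntegral_isBigO (k : ℕ) (u : ℂ) :
    (fun x : ℝ => (x : ℂ) ^ k * macdonaldIntegral u x) =O[atTop] fun _ => (1 : ℝ) := by
  induction k generalizing u with
  | zero =>
    simp only [pow_zero, one_mul]
    exact isBigO_one_laplaceMellin (laplaceMellinConvergent_exp_neg_inv u)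
  | succ k ih =>
    refine (((ih (u - 1)).const_mul_left (u - 1)).add (ih (u - 1 - 1))).congr' ?_ EventuallyEq.rfl
    filter_upwards [eventually_gt_atTop 0] with x hx
    have hrec := macdonaldIntegral_recurrence (u - 1) hx
    rw [sub_add_cancel] at hrec
    rw [pow_succ]
    linear_combination -((x : ℂ) ^ k * hrec)

theorem exists_macdonaldIntegral_ne_zero {u : ℂ} (hu : 0 < u.re) :
    ∃ x : ℝ, 0 < x ∧ macdonaldIntegral u x ≠ 0 := by
  refine exists_laplaceMellin_ne_zero (laplaceMellinConvergent_exp_neg_inv u) hu (l := 𝓝[>] 0)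
    self_mem_nhdsWithin (fun t _ => ?_) (B := fun _ => 1) ?_ (laplaceMellinConvergent_one hu)
  · have hcont : ContinuousAt (fun x : ℝ => Complex.exp (-((x / t : ℝ) : ℂ))) 0 := by fun_prop
    have hlim := hcont.tendsto
    simp only [zero_div, Complex.ofReal_zero, neg_zero, Complex.exp_zero] at hlim
    refine (hlim.mono_left nhdsWithin_le_nhds).congr fun x => ?_
    rw [← Complex.ofReal_inv, inv_div]
  · filter_upwards [self_mem_nhdsWithin] with x hx t ht
    rw [norm_one]
    exact norm_exp_neg_inv_le_one (div_pos ht hx)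

theorem integral_exp_neg_sub_div_eq_macdonaldIntegral (u : ℂ) (x : ℝ) :
    ∫ t in Ioi (0 : ℝ), Complex.exp (-t - x ^ 2 / (4 * t)) * (t : ℂ) ^ (-u - 1) =
      macdonaldIntegral u (x ^ 2 / 4) := by
  have hinv := mellin_comp_inv (fun t : ℝ => Complex.exp (-t - x ^ 2 / (4 * t))) u
  have hmellin : mellin (fun t : ℝ => Complex.exp (-t - x ^ 2 / (4 * t))) (-u) =
      ∫ t in Ioi (0 : ℝ), Complex.exp (-t - x ^ 2 / (4 * t)) * (t : ℂ) ^ (-u - 1) := by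
    simp only [mellin, smul_eq_mul, mul_comm]
  rw [← hmellin, ← hinv, macdonaldIntegral, laplaceMellin]
  congr 1
  funext t
  rw [← Complex.exp_add]
  push_cast
  rw [← div_div, div_inv_eq_mul]
  ring_nf

theorem cpow_neg_mul_macdonaldK (u : ℂ) {x : ℝ} (hx : 0 < x) :
    (x : ℂ) ^ (-u) * macdonaldK u x =
      1 / 2 * ((1 / 2 : ℝ) : ℂ) ^ u * macdonaldIntegral u (x ^ 2 / 4) := by
  have hcpow : ((x : ℂ) / 2) ^ u = (x : ℂ) ^ u * ((1 / 2 : ℝ) : ℂ) ^ u := by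
    rw [← Complex.mul_cpow_ofReal_nonneg hx.le one_half_pos.le]
    push_cast
    rw [mul_one_div]
  have hne : (x : ℂ) ^ u ≠ 0 :=
    Complex.cpow_ne_zero_iff.2 (Or.inl (ofReal_ne_zero_of_pos hx))
  rw [macdonaldK, hcpow, integral_exp_neg_sub_div_eq_macdonaldIntegral, Complex.cpow_neg]
  field_simp

theorem hasDerivAt_macdonaldIntegral_sq (u : ℂ) {x : ℝ} (hx : 0 < x) :
    HasDerivAt (fun x : ℝ => macdonaldIntegral u (x ^ 2 / 4))
      (-(1 / 2) * x * macdonaldIntegral (u + 1) (x ^ 2 / 4)) x := by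
  have hsq : HasDerivAt (fun x : ℝ => x ^ 2 / 4) (x / 2) x := by
    refine ((hasDerivAt_pow 2 x).div_const 4).congr_deriv ?_
    push_cast
    ring
  refine ((hasDerivAt_laplaceMellin_ofReal (laplaceMellinConvergent_exp_neg_inv u)
    (x := x ^ 2 / 4) (by positivity)).scomp x hsq).congr_deriv ?_
  rw [Complex.real_smul, macdonaldIntegral]
  push_cast
  ring

theorem tendsto_pow_mul_macdonaldIntegral_sq (u : ℂ) (k : ℕ) :
    Tendsto (fun x : ℝ => (x : ℂ) ^ k * macdonaldIntegral u (x ^ 2 / 4)) atTop (𝓝 0) := by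
  have hsq : Tendsto (fun x : ℝ => x ^ 2 / 4) atTop atTop :=
    (tendsto_pow_atTop two_ne_zero).atTop_div_const four_pos
  have hbound := ((pow_mul_macdonaldIntegral_isBigO (k + 1) u).comp_tendsto hsq).const_mul_left
    (4 ^ (k + 1))
  have hinv : (fun x : ℝ => ((x : ℂ) ^ (k + 2))⁻¹) =o[atTop] fun _ => (1 : ℝ) := by
    rw [Asymptotics.isLittleO_one_iff, tendsto_zero_iff_norm_tendsto_zero]
    simp only [norm_inv, norm_pow, Complex.norm_real]
    exact (tendsto_inv_atTop_zero.comp (tendsto_pow_atTop (k + 1).succ_ne_zero)).comp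
      tendsto_norm_atTop_atTop
  refine ((Asymptotics.isLittleO_one_iff ℝ).1 ((hinv.mul_isBigO hbound).congr_right
    (g₂ := fun _ => (1 : ℝ)) fun _ => mul_one _)).congr' ?_
  filter_upwards [eventually_gt_atTop 0] with x hx
  have hne := ofReal_ne_zero_of_pos hx
  simp only [Function.comp_apply]
  push_cast
  rw [div_pow]
  field_simp
  ring

theorem analyticOfGrowth_macdonaldIntegral_sq (u : ℂ) :
    AnalyticOfGrowth RapidlyDecaying (onPos fun x => macdonaldIntegral u (x ^ 2 / 4)) := by
  refine AnalyticOfGrowth.of_deriv_eq isGrowthClass_rapidlyDecaying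
    (F := fun u => onPos fun x => macdonaldIntegral u (x ^ 2 / 4))
    (m := fun _ x => onPos (fun _ => -(1 / 2)) x * onPos (fun x => (x : ℂ)) x)
    (h := fun _ _ => 0) (σ := fun u => u + 1)
    (fun _ x hx => onPos_of_nonpos _ hx)
    (fun u => analyticOnNhd_onPos fun x (hx : 0 < x) => ?_)
    (fun u => isGrowthClass_rapidlyDecaying.congr (tendsto_pow_mul_macdonaldIntegral_sq u)
      (onPos_eventuallyEq_atTop _).symm)
    (fun _ => (AnalyticOfGrowth.const _).mul isGrowthClass_polyBounded AnalyticOfGrowth.ofReal)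
    (fun _ => AnalyticOfGrowth.zero isGrowthClass_rapidlyDecaying) (fun u x hx => ?_) u
  · exact (analyticOnNhd_laplaceMellin (laplaceMellinConvergent_exp_neg_inv u) (x ^ 2 / 4)
      (show 0 < x ^ 2 / 4 by positivity)).comp (f := fun x : ℝ => x ^ 2 / 4) (by fun_prop)
  · rw [(onPos_eventuallyEq_nhds _ hx).deriv_eq, (hasDerivAt_macdonaldIntegral_sq u hx).deriv,
      onPos_of_pos _ hx, onPos_of_pos _ hx, onPos_of_pos _ hx, add_zero]

end Macdonald

/-! ### Tricomi's function -/

section Tricomi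

variable {s : ℂ} {x : ℝ}

theorem re_add_one_pos (hs : 0 < s.re) : 0 < (s + 1).re := by
  rw [Complex.add_re, Complex.one_re]
  linarith

theorem induction_of_re_pos {P : ℂ → Prop} (hpos : ∀ u : ℂ, 0 < u.re → P u)
    (hstep : ∀ u, P (u + 1) → P u) (u : ℂ) : P u := by
  obtain ⟨n, hn⟩ := exists_nat_gt (-u.re)
  induction n generalizing u with
  | zero => exact hpos u (by simpa only [Nat.cast_zero, neg_lt_zero] using hn)
  | succ n ih =>
    refine hstep u (ih (u + 1) ?_)
    rw [Complex.add_re, Complex.one_re]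
    push_cast at hn
    linarith

theorem one_add_ofReal_mem_slitPlane {t : ℝ} (ht : -1 < t) : 1 + (t : ℂ) ∈ Complex.slitPlane := by
  refine Or.inl ?_
  rw [Complex.add_re, Complex.one_re, Complex.ofReal_re]
  linarith

theorem hasDerivAt_one_add_cpow (b : ℂ) {t : ℝ} (ht : -1 < t) :
    HasDerivAt (fun t : ℝ => (1 + (t : ℂ)) ^ b) (b * (1 + (t : ℂ)) ^ (b - 1)) t := by
  simpa only [id_eq, mul_one] using (((hasDerivAt_id (t : ℂ)).const_add 1).cpow_const (c := b)
    (one_add_ofReal_mem_slitPlane ht)).comp_ofReal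

theorem tendsto_one_add_cpow (b : ℂ) :
    Tendsto (fun t : ℝ => (1 + (t : ℂ)) ^ b) (𝓝 0) (𝓝 1) := by
  have hlim := (hasDerivAt_one_add_cpow b (t := 0) neg_one_lt_zero).continuousAt.tendsto
  rwa [Complex.ofReal_zero, add_zero, Complex.one_cpow] at hlim

theorem norm_one_add_cpow (b : ℂ) {t : ℝ} (ht : -1 < t) :
    ‖(1 + (t : ℂ)) ^ b‖ = (1 + t) ^ b.re := by
  rw [← Complex.ofReal_one, ← Complex.ofReal_add, Complex.norm_cpow_eq_rpow_re_of_pos (by linarith)]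

theorem norm_one_add_cpow_le {b : ℂ} {k : ℕ} (hk : b.re ≤ k) {t : ℝ} (ht : 0 ≤ t) :
    ‖(1 + (t : ℂ)) ^ b‖ ≤ (1 + t) ^ k := by
  rw [norm_one_add_cpow b (by linarith), ← Real.rpow_natCast]
  exact Real.rpow_le_rpow_of_exponent_le (by linarith) hk

theorem laplaceMellinConvergent_one_add_cpow (hs : 0 < s.re) (b : ℂ) :
    LaplaceMellinConvergent (fun t : ℝ => (1 + (t : ℂ)) ^ b) s := by
  obtain ⟨k, hk⟩ := exists_nat_ge b.re
  refine LaplaceMellinConvergent.of_isBigO (b := 0) (k := k) (fun t (ht : 0 < t) =>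
    (hasDerivAt_one_add_cpow b (by linarith)).continuousAt.continuousWithinAt) ?_ ?_ hs
  · refine Asymptotics.IsBigO.of_bound (2 ^ k) ?_
    filter_upwards [eventually_ge_atTop 1] with t ht
    refine (norm_one_add_cpow_le hk (by linarith)).trans ?_
    rw [Real.norm_of_nonneg (by positivity), ← mul_pow]
    exact pow_le_pow_left₀ (by linarith) (by linarith) k
  · simp only [neg_zero, Real.rpow_zero]
    exact ((tendsto_one_add_cpow b).mono_left nhdsWithin_le_nhds).isBigO_one ℝ

/-- The integral `∫₀^∞ t^{s-1} e^{-xt} (1+t)^b dt`, which is `Γ(s) Ψ(s, s+b+1; x)`. -/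
def tricomiIntegral (s b : ℂ) (x : ℝ) : ℂ := laplaceMellin (fun t : ℝ => (1 + (t : ℂ)) ^ b) s x

theorem tricomiIntegral_by_parts (hs : 0 < s.re) (b : ℂ) (hx : 0 < x) :
    s * tricomiIntegral s b x + b * tricomiIntegral (s + 1) (b - 1) x =
      x * tricomiIntegral (s + 1) b x := by
  have hlim : Tendsto (fun t : ℝ => (t : ℂ) ^ s * (1 + (t : ℂ)) ^ b) (𝓝[>] 0) (𝓝 0) := by
    have hcpow := (Complex.continuousAt_ofReal_cpow_const 0 s (Or.inl hs)).tendsto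
    have hs0 : s ≠ 0 := fun h => hs.ne' (by rw [h, Complex.zero_re])
    rw [Complex.ofReal_zero, Complex.zero_cpow hs0] at hcpow
    simpa only [zero_mul] using (hcpow.mul (tendsto_one_add_cpow b)).mono_left nhdsWithin_le_nhds
  have hparts := laplaceMellin_by_parts (z := x)
    (fun t ht => hasDerivAt_one_add_cpow b (by linarith))
    (fun _ => laplaceMellinConvergent_one_add_cpow hs b)
    (laplaceMellinConvergent_one_add_cpow (re_add_one_pos hs) b)
    ((laplaceMellinConvergent_one_add_cpow (re_add_one_pos hs) (b - 1)).const_mul b) hlim hx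
  rwa [laplaceMellin_const_mul, sub_zero] at hparts

theorem tricomiIntegral_one_by_parts (b : ℂ) (hx : 0 < x) :
    b * tricomiIntegral 1 (b - 1) x + 1 = x * tricomiIntegral 1 b x := by
  have hone : 0 < (0 + 1 : ℂ).re := by
    rw [zero_add, Complex.one_re]
    exact one_pos
  have hlim : Tendsto (fun t : ℝ => (t : ℂ) ^ (0 : ℂ) * (1 + (t : ℂ)) ^ b) (𝓝[>] 0) (𝓝 1) := by
    simpa only [Complex.cpow_zero, one_mul]
      using (tendsto_one_add_cpow b).mono_left nhdsWithin_le_nhds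
  have hparts := laplaceMellin_by_parts (s := 0) (z := x)
    (fun t ht => hasDerivAt_one_add_cpow b (by linarith)) (fun h => absurd rfl h)
    (laplaceMellinConvergent_one_add_cpow hone b)
    ((laplaceMellinConvergent_one_add_cpow hone (b - 1)).const_mul b) hlim hx
  rw [laplaceMellin_const_mul, zero_mul, zero_add, zero_add] at hparts
  exact eq_sub_iff_add_eq.1 hparts

theorem tricomiIntegral_split (hs : 0 < s.re) (b : ℂ) (hx : 0 < x) :
    tricomiIntegral s b x = tricomiIntegral s (b - 1) x + tricomiIntegral (s + 1) (b - 1) x := by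
  have hsplit : EqOn (fun t : ℝ => (1 + (t : ℂ)) ^ b)
      (fun t : ℝ => (1 + (t : ℂ)) ^ (b - 1) + (t : ℂ) ^ (1 : ℂ) * (1 + (t : ℂ)) ^ (b - 1))
      (Ioi 0) := by
    intro t (ht : 0 < t)
    have hne := Complex.slitPlane_ne_zero (one_add_ofReal_mem_slitPlane (t := t) (by linarith))
    simp only [Complex.cpow_one]
    rw [← one_add_mul, Complex.cpow_sub _ _ hne, Complex.cpow_one,
      mul_div_cancel₀ _ hne]
  rw [tricomiIntegral, laplaceMellin_congr hsplit,
    laplaceMellin_add (laplaceMellinConvergent_one_add_cpow hs _)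
      (laplaceMellinConvergent_one_add_cpow (re_add_one_pos hs) _).cpow_mul hx,
    laplaceMellin_cpow_mul, tricomiIntegral, tricomiIntegral]

theorem exists_tricomiIntegral_ne_zero (hs : 0 < s.re) (b : ℂ) :
    ∃ x : ℝ, 0 < x ∧ tricomiIntegral s b x ≠ 0 := by
  obtain ⟨k, hk⟩ := exists_nat_ge b.re
  refine exists_laplaceMellin_ne_zero (laplaceMellinConvergent_one_add_cpow hs b) hs (l := atTop)
    (eventually_gt_atTop 0) (fun t _ => ?_) (B := fun t => (1 + (t : ℂ)) ^ (k : ℂ)) ?_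
    (laplaceMellinConvergent_one_add_cpow hs k)
  · exact (tendsto_one_add_cpow b).comp (tendsto_const_nhds.div_atTop tendsto_id)
  · filter_upwards [eventually_ge_atTop 1] with x hx t ht
    have hdiv : 0 < t / x := div_pos ht (one_pos.trans_le hx)
    refine (norm_one_add_cpow_le hk hdiv.le).trans ?_
    rw [norm_one_add_cpow _ (by linarith), Complex.natCast_re, Real.rpow_natCast]
    exact pow_le_pow_left₀ (by linarith) (by linarith [div_le_self ht.le hx]) k

/-! ### Analytic continuation of Tricomi's function in its first parameter -/

/-- The function `g(t) = e^{-xt} (1+t)^b` whose derivatives enter the definition of Tricomi's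
function. -/
def tricomiKernel (x : ℝ) (b : ℂ) (t : ℝ) : ℂ := Complex.exp (-(x * t)) * (1 + (t : ℂ)) ^ b

theorem hasDerivAt_tricomiKernel (x : ℝ) (b : ℂ) {t : ℝ} (ht : -1 < t) :
    HasDerivAt (tricomiKernel x b)
      (-x * tricomiKernel x b t + b * tricomiKernel x (b - 1) t) t := by
  refine ((hasDerivAt_exp_neg_mul x t).mul (hasDerivAt_one_add_cpow b ht)).congr_deriv ?_
  simp only [tricomiKernel]
  ring

theorem contDiffAt_tricomiKernel (x : ℝ) (b : ℂ) {t : ℝ} (ht : -1 < t) (n : ℕ) :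
    ContDiffAt ℝ n (tricomiKernel x b) t := by
  have hana : AnalyticAt ℂ (fun z : ℂ => Complex.exp (-((x : ℂ) * z)) * (1 + z) ^ b) (t : ℂ) :=
    (by fun_prop : AnalyticAt ℂ (fun z : ℂ => Complex.exp (-((x : ℂ) * z))) (t : ℂ)).mul
      ((analyticAt_const.add analyticAt_id).cpow analyticAt_const
        (one_add_ofReal_mem_slitPlane ht))
  exact ((hana.restrictScalars (𝕜 := ℝ)).comp (f := fun y : ℝ => (y : ℂ))
    (Complex.ofRealCLM.analyticAt t)).contDiffAt

theorem iteratedDeriv_succ_tricomiKernel (N : ℕ) (x : ℝ) (b : ℂ) {t : ℝ} (ht : -1 < t) :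
    iteratedDeriv (N + 1) (tricomiKernel x b) t =
      -x * iteratedDeriv N (tricomiKernel x b) t +
        b * iteratedDeriv N (tricomiKernel x (b - 1)) t := by
  have hderiv : EqOn (deriv (tricomiKernel x b))
      (fun t => -x * tricomiKernel x b t + b * tricomiKernel x (b - 1) t) (Ioi (-1)) :=
    fun t ht => (hasDerivAt_tricomiKernel x b ht).deriv
  rw [iteratedDeriv_succ', hderiv.iteratedDeriv_of_isOpen isOpen_Ioi N ht,
    iteratedDeriv_fun_add (contDiffAt_const.mul (contDiffAt_tricomiKernel x b ht N))
      (contDiffAt_const.mul (contDiffAt_tricomiKernel x (b - 1) ht N)),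
    iteratedDeriv_const_mul_field, iteratedDeriv_const_mul_field]

theorem hasMellin_const_mul_add {f g : ℝ → ℂ} (hf : MellinConvergent f s)
    (hg : MellinConvergent g s) (p q : ℂ) :
    HasMellin (fun t => p * f t + q * g t) s (p * mellin f s + q * mellin g s) := by
  refine ⟨(hasMellin_add (hf.const_smul p) (hg.const_smul q)).1, ?_⟩
  have hp := mellin_const_smul f s p
  have hq := mellin_const_smul g s q
  have hadd := (hasMellin_add (hf.const_smul p) (hg.const_smul q)).2
  rw [hp, hq] at hadd
  exact hadd

theorem mellinConvergent_iteratedDeriv_tricomiKernel (N : ℕ) (hs : 0 < s.re) (b : ℂ)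
    (hx : 0 < x) : MellinConvergent (iteratedDeriv N (tricomiKernel x b)) s := by
  induction N generalizing b with
  | zero =>
    rw [iteratedDeriv_zero]
    exact laplaceMellinConvergent_one_add_cpow hs b x hx
  | succ N ih =>
    refine IntegrableOn.congr_fun (hasMellin_const_mul_add (ih b) (ih (b - 1)) (-x) b).1
      (fun t (ht : 0 < t) => ?_) measurableSet_Ioi
    simp only [iteratedDeriv_succ_tricomiKernel N x b (neg_one_lt_zero.trans ht)]

theorem mellin_iteratedDeriv_succ_tricomiKernel (N : ℕ) (hs : 0 < s.re) (b : ℂ) (hx : 0 < x) :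
    mellin (iteratedDeriv (N + 1) (tricomiKernel x b)) s =
      -x * mellin (iteratedDeriv N (tricomiKernel x b)) s +
        b * mellin (iteratedDeriv N (tricomiKernel x (b - 1))) s := by
  rw [← (hasMellin_const_mul_add (mellinConvergent_iteratedDeriv_tricomiKernel N hs b hx)
    (mellinConvergent_iteratedDeriv_tricomiKernel N hs (b - 1) hx) (-x) b).2]
  refine setIntegral_congr_fun measurableSet_Ioi fun t (ht : 0 < t) => ?_
  simp only [iteratedDeriv_succ_tricomiKernel N x b (neg_one_lt_zero.trans ht)]

theorem tricomiPsi_eq_mellin (a c : ℂ) (x : ℝ) :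
    tricomiPsi a c x = (-1) ^ ⌊1 - a.re⌋₊ * ((Complex.Gamma (a + ⌊1 - a.re⌋₊))⁻¹ *
      mellin (iteratedDeriv ⌊1 - a.re⌋₊ (tricomiKernel x (c - a - 1))) (a + ⌊1 - a.re⌋₊)) := by
  rw [tricomiPsi, mellin, div_eq_mul_inv, mul_assoc]
  rfl

/-- The function `x ↦ Γ(s)⁻¹ ∫₀^∞ t^{s-1} g⁽ᴺ⁾(t) dt`, where `g(t) = e^{-xt} (1+t)^b`, as an element
of the space of functions of polynomial growth. The recursion in `N` is the formula for `g'`. -/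
def tricomiVec (s : ℂ) (hs : 0 < s.re) : ℕ → ℂ → polyGrowthSpace
  | 0, b => (Complex.Gamma s)⁻¹ • (⟨onPos (tricomiIntegral s b),
      (laplaceMellinConvergent_one_add_cpow hs b).analyticOfGrowth⟩ : polyGrowthSpace)
  | N + 1, b => -mulXEnd _ (tricomiVec s hs N b) + b • tricomiVec s hs N (b - 1)

theorem tricomiVec_zero_apply (hs : 0 < s.re) (b : ℂ) (hx : 0 < x) :
    (tricomiVec s hs 0 b : ℝ → ℂ) x = (Complex.Gamma s)⁻¹ * tricomiIntegral s b x :=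
  congrArg ((Complex.Gamma s)⁻¹ * ·) (onPos_of_pos (tricomiIntegral s b) hx)

theorem tricomiVec_succ_apply (hs : 0 < s.re) (N : ℕ) (b : ℂ) (hx : 0 < x) :
    (tricomiVec s hs (N + 1) b : ℝ → ℂ) x =
      -(x * (tricomiVec s hs N b : ℝ → ℂ) x) + b * (tricomiVec s hs N (b - 1) : ℝ → ℂ) x :=
  congr(-$(mulXEnd_apply (tricomiVec s hs N b) hx) + b * (tricomiVec s hs N (b - 1) : ℝ → ℂ) x)

theorem tricomiVec_apply (hs : 0 < s.re) (N : ℕ) (b : ℂ) (hx : 0 < x) :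
    (tricomiVec s hs N b : ℝ → ℂ) x =
      (Complex.Gamma s)⁻¹ * mellin (iteratedDeriv N (tricomiKernel x b)) s := by
  induction N generalizing b with
  | zero =>
    rw [tricomiVec_zero_apply hs b hx, iteratedDeriv_zero]
    rfl
  | succ N ih =>
    rw [tricomiVec_succ_apply hs N b hx, mellin_iteratedDeriv_succ_tricomiKernel N hs b hx, ih, ih]
    ring

/-- The operator `x∂ - x + r`; in type C', `A(u)` is this operator for `r = c - 1 + u`. -/
def tricomiLowering (r : ℂ) : Module.End ℂ polyGrowthSpace :=
  mulXEnd _ * (derivEnd _ - 1) + r • 1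

theorem tricomiLowering_apply (r : ℂ) (f : polyGrowthSpace) {x : ℝ} (hx : 0 < x) :
    (tricomiLowering r f : ℝ → ℂ) x =
      x * (deriv f x - (f : ℝ → ℂ) x) + r * (f : ℝ → ℂ) x := by
  change (mulXEnd _ (derivEnd _ f - f) : ℝ → ℂ) x + r * (f : ℝ → ℂ) x = _
  rw [mulXEnd_apply _ hx, Submodule.coe_sub, Pi.sub_apply, derivEnd_apply f hx]

theorem tricomiLowering_mulXEnd (r : ℂ) (f : polyGrowthSpace) :
    tricomiLowering r (mulXEnd _ f) = mulXEnd _ (tricomiLowering (r + 1) f) := by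
  simp only [tricomiLowering, LinearMap.add_apply, LinearMap.sub_apply, LinearMap.smul_apply,
    Module.End.mul_apply, Module.End.one_apply, derivEnd_mulXEnd, map_add, map_sub, map_smul]
  module

theorem derivEnd_tricomiLowering (r : ℂ) (f : polyGrowthSpace) :
    derivEnd _ (tricomiLowering r f) = tricomiLowering (r + 1) (derivEnd _ f) - f := by
  simp only [tricomiLowering, LinearMap.add_apply, LinearMap.sub_apply, LinearMap.smul_apply,
    Module.End.mul_apply, Module.End.one_apply, derivEnd_mulXEnd, map_add, map_sub, map_smul]
  module

theorem derivEnd_tricomiVec_zero (hs : 0 < s.re) (b : ℂ) :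
    derivEnd _ (tricomiVec s hs 0 b) = (-s) • tricomiVec (s + 1) (re_add_one_pos hs) 0 b := by
  refine ext_of_pos fun x hx => ?_
  have hvec : (tricomiVec s hs 0 b : ℝ → ℂ) =ᶠ[𝓝 x]
      fun x => (Complex.Gamma s)⁻¹ * tricomiIntegral s b x := by
    filter_upwards [Ioi_mem_nhds hx] with y hy using tricomiVec_zero_apply hs b hy
  have hderiv : HasDerivAt (fun x => (Complex.Gamma s)⁻¹ * tricomiIntegral s b x)
      ((Complex.Gamma s)⁻¹ * -tricomiIntegral (s + 1) b x) x :=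
    (hasDerivAt_laplaceMellin_ofReal (laplaceMellinConvergent_one_add_cpow hs b) hx).const_mul _
  rw [derivEnd_apply _ hx, hvec.deriv_eq, Submodule.coe_smul, Pi.smul_apply,
    tricomiVec_zero_apply _ b hx, smul_eq_mul, hderiv.deriv,
    Complex.one_div_Gamma_eq_self_mul_one_div_Gamma_add_one s]
  ring

theorem tricomiLowering_tricomiVec_zero (hs : 0 < s.re) (b : ℂ) :
    tricomiLowering (b + s) (tricomiVec s hs 0 b) = tricomiVec s hs 1 b := by
  refine ext_of_pos fun x hx => ?_
  have hderiv := congr(($(derivEnd_tricomiVec_zero hs b) : ℝ → ℂ) x)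
  rw [derivEnd_apply _ hx, Submodule.coe_smul, Pi.smul_apply, tricomiVec_zero_apply _ _ hx,
    smul_eq_mul] at hderiv
  rw [tricomiLowering_apply _ _ hx, tricomiVec_succ_apply _ _ _ hx, hderiv]
  simp only [tricomiVec_zero_apply _ _ hx]
  have hΓ := Complex.one_div_Gamma_eq_self_mul_one_div_Gamma_add_one s
  linear_combination (Complex.Gamma s)⁻¹ * tricomiIntegral_by_parts hs b hx +
    b * (Complex.Gamma s)⁻¹ * tricomiIntegral_split hs b hx +
    x * tricomiIntegral (s + 1) b x * hΓ

theorem tricomiLowering_tricomiVec (hs : 0 < s.re) (N : ℕ) (b : ℂ) :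
    tricomiLowering (b - N + s) (tricomiVec s hs N b) = tricomiVec s hs (N + 1) b := by
  induction N generalizing b with
  | zero => rw [Nat.cast_zero, sub_zero, tricomiLowering_tricomiVec_zero]
  | succ N ih =>
    have hb : b - (N + 1 : ℕ) + s + 1 = b - N + s := by
      push_cast
      ring
    have hb' : b - (N + 1 : ℕ) + s = b - 1 - N + s := by
      push_cast
      ring
    calc tricomiLowering (b - (N + 1 : ℕ) + s) (tricomiVec s hs (N + 1) b)
        = -mulXEnd _ (tricomiLowering (b - (N + 1 : ℕ) + s + 1) (tricomiVec s hs N b)) +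
            b • tricomiLowering (b - (N + 1 : ℕ) + s) (tricomiVec s hs N (b - 1)) := by
          rw [tricomiVec, map_add, map_neg, map_smul, tricomiLowering_mulXEnd]
      _ = tricomiVec s hs (N + 1 + 1) b := by rw [hb, hb', ih, ih]; rfl

theorem tricomiVec_add_one_one (hs : 0 < s.re) (b : ℂ) :
    tricomiVec (s + 1) (re_add_one_pos hs) 1 b = -tricomiVec s hs 0 b := by
  refine ext_of_pos fun x hx => ?_
  rw [tricomiVec_succ_apply _ _ _ hx, Submodule.coe_neg, Pi.neg_apply]
  simp only [tricomiVec_zero_apply _ _ hx]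
  have hΓ := Complex.one_div_Gamma_eq_self_mul_one_div_Gamma_add_one s
  linear_combination (Complex.Gamma (s + 1))⁻¹ * tricomiIntegral_by_parts hs b hx +
    tricomiIntegral s b x * hΓ

theorem onPos_tricomiPsi {c u : ℂ} {N : ℕ} (hN : ⌊1 - u.re⌋₊ = N) (hs : 0 < s.re)
    (h : s = u + N) :
    onPos (tricomiPsi u (c + u)) =
      ((-1 : ℂ) ^ N • tricomiVec s hs N (c - 1) : polyGrowthSpace) := by
  refine eq_of_eqOn_pos (fun x hx => onPos_of_nonpos _ hx) (coe_eq_zero_of_nonpos _) fun x hx => ?_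
  rw [onPos_of_pos _ hx, tricomiPsi_eq_mellin, Submodule.coe_smul, Pi.smul_apply,
    tricomiVec_apply hs N _ hx, hN, ← h, smul_eq_mul, add_sub_cancel_right]

theorem re_add_floor_one_sub_re_pos (u : ℂ) : 0 < (u + (⌊1 - u.re⌋₊ : ℕ)).re := by
  rw [Complex.add_re, Complex.natCast_re]
  linarith [Nat.lt_floor_add_one (1 - u.re)]

/-- The function `x ↦ Ψ(u, c + u; x)` as an element of the space of functions of polynomial
growth. -/
def tricomiFun (c u : ℂ) : polyGrowthSpace :=
  ⟨onPos (tricomiPsi u (c + u)), by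
    rw [onPos_tricomiPsi rfl (re_add_floor_one_sub_re_pos u) rfl]
    exact Subtype.mem _⟩

theorem tricomiFun_eq_tricomiVec {c u : ℂ} {N : ℕ} (hN : ⌊1 - u.re⌋₊ = N) (hs : 0 < s.re)
    (h : s = u + N) : tricomiFun c u = (-1 : ℂ) ^ N • tricomiVec s hs N (c - 1) :=
  Subtype.ext (onPos_tricomiPsi hN hs h)

theorem tricomiFun_of_re_pos (c : ℂ) {u : ℂ} (hu : 0 < u.re) :
    tricomiFun c u = tricomiVec u hu 0 (c - 1) := by
  rw [tricomiFun_eq_tricomiVec (N := 0) (Nat.floor_eq_zero.2 (by linarith)) hu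
    (by rw [Nat.cast_zero, add_zero]), pow_zero, one_smul]

theorem tricomiLowering_tricomiFun (c u : ℂ) :
    tricomiLowering (c - 1 + u) (tricomiFun c u) = -tricomiFun c (u - 1) := by
  rcases lt_or_ge 0 (u - 1).re with hu | hu
  · obtain ⟨v, rfl⟩ : ∃ v, u = v + 1 := ⟨u - 1, (sub_add_cancel u 1).symm⟩
    rw [add_sub_cancel_right] at hu ⊢
    rw [tricomiFun_of_re_pos c hu, tricomiFun_of_re_pos c (re_add_one_pos hu),
      tricomiLowering_tricomiVec_zero, tricomiVec_add_one_one hu]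
  · set N : ℕ := ⌊1 - u.re⌋₊ with hN
    have hs := re_add_floor_one_sub_re_pos u
    have hN' : ⌊1 - (u - 1).re⌋₊ = N + 1 := by
      rw [Complex.sub_re, Complex.one_re] at hu ⊢
      rw [hN, ← Nat.floor_add_one (by linarith)]
      ring_nf
    rw [tricomiFun_eq_tricomiVec hN.symm hs rfl,
      tricomiFun_eq_tricomiVec hN' hs (by push_cast; ring), ← tricomiLowering_tricomiVec, pow_succ,
      show c - 1 - (N : ℂ) + (u + N) = c - 1 + u by ring, map_smul]
    module

theorem derivEnd_tricomiFun (c u : ℂ) :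
    derivEnd _ (tricomiFun c u) = (-u) • tricomiFun c (u + 1) := by
  induction u using induction_of_re_pos with
  | hpos u hu =>
    rw [tricomiFun_of_re_pos c hu, tricomiFun_of_re_pos c (re_add_one_pos hu),
      derivEnd_tricomiVec_zero]
  | hstep u ih =>
    have hlower := tricomiLowering_tricomiFun c (u + 1)
    have hlower' := tricomiLowering_tricomiFun c (u + 1 + 1)
    rw [add_sub_cancel_right] at hlower hlower'
    rw [← neg_neg (tricomiFun c u), ← hlower, map_neg, derivEnd_tricomiLowering, ih, map_smul,
      add_assoc (c - 1), hlower']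
    module

theorem tricomiFun_zero_apply (c : ℂ) (hx : 0 < x) : (tricomiFun c 0 : ℝ → ℂ) x = 1 := by
  have hone : 0 < (1 : ℂ).re := Complex.one_re.symm ▸ one_pos
  have hfloor : ⌊1 - (0 : ℂ).re⌋₊ = 1 := by rw [Complex.zero_re, sub_zero, Nat.floor_one]
  rw [tricomiFun_eq_tricomiVec hfloor hone (by rw [zero_add, Nat.cast_one]), Submodule.coe_smul,
    Pi.smul_apply, tricomiVec_succ_apply _ _ _ hx, tricomiVec_zero_apply _ _ hx,
    tricomiVec_zero_apply _ _ hx, Complex.Gamma_one, smul_eq_mul]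
  linear_combination -tricomiIntegral_one_by_parts (c - 1) hx

theorem tricomiFun_ne_zero (c u : ℂ) : tricomiFun c u ≠ 0 := by
  induction u using induction_of_re_pos with
  | hpos u hu =>
    obtain ⟨x, hx, hne⟩ := exists_tricomiIntegral_ne_zero hu (c - 1)
    intro h
    have happly := tricomiVec_zero_apply hu (c - 1) hx
    rw [← tricomiFun_of_re_pos, h] at happly
    exact mul_ne_zero (inv_ne_zero (Complex.Gamma_ne_zero_of_re_pos hu)) hne happly.symm
  | hstep u ih =>
    intro h
    rcases eq_or_ne u 0 with rfl | hu
    · have happly := tricomiFun_zero_apply c one_pos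
      rw [h] at happly
      exact zero_ne_one happly
    · have hderiv := derivEnd_tricomiFun c u
      rw [h, map_zero] at hderiv
      exact smul_ne_zero (neg_ne_zero.2 hu) ih hderiv.symm

end Tricomi

/-! ### Laguerre polynomials -/

section Laguerre

/-- The coefficient of `x ^ k`, `k ≤ n`, in the Laguerre polynomial `L_n^α`. -/
def laguerreCoeff (n : ℕ) (α : ℂ) (k : ℕ) : ℂ :=
  (-1) ^ k * (ascPochhammer ℂ (n - k)).eval (α + k + 1) /
    ((k.factorial : ℂ) * ((n - k).factorial : ℂ))

theorem laguerreL_eq_sum (n : ℕ) (α x : ℂ) :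
    laguerreL n α x = ∑ k ∈ Finset.range (n + 1), laguerreCoeff n α k * x ^ k :=
  rfl

theorem sub_mul_laguerreCoeff {n k : ℕ} (hk : k ≤ n) (α : ℂ) :
    (n + 1 - k) * laguerreCoeff (n + 1) (α - 1) k = (k + α) * laguerreCoeff n α k := by
  obtain ⟨m, rfl⟩ := Nat.exists_eq_add_of_le hk
  have hm : (m : ℂ) + 1 ≠ 0 := Nat.cast_add_one_ne_zero m
  simp only [laguerreCoeff, add_assoc k m 1, Nat.add_sub_cancel_left, ascPochhammer_succ_left,
    Polynomial.eval_mul, Polynomial.eval_X, Polynomial.eval_comp, Polynomial.eval_add,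
    Polynomial.eval_one, Nat.factorial_succ]
  push_cast
  rw [show α - 1 + k + 1 = α + k by ring]
  field_simp
  ring

theorem succ_mul_laguerreCoeff_succ (n k : ℕ) (α : ℂ) :
    (k + 1) * laguerreCoeff (n + 1) (α - 1) (k + 1) = -laguerreCoeff n α k := by
  have hk : (k : ℂ) + 1 ≠ 0 := Nat.cast_add_one_ne_zero k
  simp only [laguerreCoeff, Nat.add_sub_add_right, Nat.factorial_succ]
  push_cast
  rw [show α - 1 + (k + 1) + 1 = α + k + 1 by ring]
  field_simp
  ring

theorem sum_sub_mul_laguerreCoeff (n : ℕ) (α x : ℂ) :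
    ∑ k ∈ Finset.range (n + 2), (n + 1 - k) * laguerreCoeff (n + 1) (α - 1) k * x ^ k =
      ∑ k ∈ Finset.range (n + 1), (k + α) * laguerreCoeff n α k * x ^ k := by
  rw [Finset.sum_range_succ, Nat.cast_add_one, sub_self, zero_mul, zero_mul, add_zero]
  refine Finset.sum_congr rfl fun k hk => ?_
  rw [sub_mul_laguerreCoeff (Finset.mem_range_succ_iff.1 hk)]

theorem sum_mul_laguerreCoeff (n : ℕ) (α x : ℂ) :
    ∑ k ∈ Finset.range (n + 2), k * laguerreCoeff (n + 1) (α - 1) k * x ^ k =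
      -(x * laguerreL n α x) := by
  rw [Finset.sum_range_succ', Nat.cast_zero, zero_mul, zero_mul, add_zero, laguerreL_eq_sum,
    Finset.mul_sum, ← Finset.sum_neg_distrib]
  refine Finset.sum_congr rfl fun k _ => ?_
  rw [Nat.cast_add_one, succ_mul_laguerreCoeff_succ]
  ring

theorem hasDerivAt_laguerreL (n : ℕ) (α x : ℂ) :
    HasDerivAt (laguerreL n α)
      (∑ k ∈ Finset.range (n + 1), laguerreCoeff n α k * (k * x ^ (k - 1))) x :=
  HasDerivAt.fun_sum fun k _ => (hasDerivAt_pow k x).const_mul _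

theorem mul_deriv_laguerreL (n : ℕ) (α x : ℂ) :
    x * deriv (laguerreL n α) x =
      ∑ k ∈ Finset.range (n + 1), k * laguerreCoeff n α k * x ^ k := by
  rw [(hasDerivAt_laguerreL n α x).deriv, Finset.mul_sum]
  refine Finset.sum_congr rfl fun k _ => ?_
  rcases k with _ | k
  · rw [Nat.cast_zero, zero_mul, zero_mul, zero_mul, mul_zero, mul_zero]
  · rw [Nat.add_sub_cancel, pow_succ]
    ring

theorem sum_add_mul_laguerreCoeff (n : ℕ) (α x : ℂ) :
    ∑ k ∈ Finset.range (n + 1), (k + α) * laguerreCoeff n α k * x ^ k =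
      x * deriv (laguerreL n α) x + α * laguerreL n α x := by
  rw [mul_deriv_laguerreL, laguerreL_eq_sum, Finset.mul_sum, ← Finset.sum_add_distrib]
  exact Finset.sum_congr rfl fun k _ => by ring

theorem succ_mul_laguerreL_succ (n : ℕ) (α x : ℂ) :
    (n + 1) * laguerreL (n + 1) (α - 1) x =
      x * (deriv (laguerreL n α) x - laguerreL n α x) + α * laguerreL n α x :=
  calc (n + 1) * laguerreL (n + 1) (α - 1) x
      = ∑ k ∈ Finset.range (n + 2), (n + 1 - k) * laguerreCoeff (n + 1) (α - 1) k * x ^ k +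
          ∑ k ∈ Finset.range (n + 2), k * laguerreCoeff (n + 1) (α - 1) k * x ^ k := by
        rw [laguerreL_eq_sum, Finset.mul_sum, ← Finset.sum_add_distrib]
        exact Finset.sum_congr rfl fun k _ => by ring
    _ = x * (deriv (laguerreL n α) x - laguerreL n α x) + α * laguerreL n α x := by
        rw [sum_sub_mul_laguerreCoeff, sum_mul_laguerreCoeff, sum_add_mul_laguerreCoeff]
        ring

theorem laguerreL_zero (α x : ℂ) : laguerreL 0 α x = 1 := by
  simp only [laguerreL, zero_add, Finset.sum_range_one, Nat.sub_zero, ascPochhammer_zero,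
    Polynomial.eval_one, pow_zero, Nat.factorial_zero, Nat.cast_one, mul_one, div_one]

theorem tricomiFun_neg_natCast_apply (c : ℂ) (n : ℕ) {x : ℝ} (hx : 0 < x) :
    (tricomiFun c (-n) : ℝ → ℂ) x = (-1) ^ n * (n.factorial : ℂ) * laguerreL n (c - n - 1) x := by
  induction n generalizing x with
  | zero =>
    rw [Nat.cast_zero, neg_zero, tricomiFun_zero_apply c hx, laguerreL_zero, Nat.factorial_zero,
      Nat.cast_one, pow_zero, one_mul, one_mul]
  | succ n ih =>
    have hderiv : deriv (tricomiFun c (-n)) x =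
        (-1) ^ n * (n.factorial : ℂ) * deriv (laguerreL n (c - n - 1)) x := by
      have hih : (tricomiFun c (-n) : ℝ → ℂ) =ᶠ[𝓝 x]
          fun x : ℝ => (-1) ^ n * (n.factorial : ℂ) * laguerreL n (c - n - 1) x := by
        filter_upwards [Ioi_mem_nhds hx] with y hy using ih hy
      rw [hih.deriv_eq, ((hasDerivAt_laguerreL n _ (x : ℂ)).comp_ofReal.const_mul _).deriv,
        (hasDerivAt_laguerreL n _ _).deriv]
    have hlower := congr(($(tricomiLowering_tricomiFun c (-n)) : ℝ → ℂ) x)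
    rw [tricomiLowering_apply _ _ hx, hderiv, ih hx, Submodule.coe_neg, Pi.neg_apply] at hlower
    rw [show -((n + 1 : ℕ) : ℂ) = -(n : ℂ) - 1 by push_cast; ring,
      show c - ((n + 1 : ℕ) : ℂ) - 1 = c - n - 1 - 1 by push_cast; ring, Nat.factorial_succ]
    push_cast
    linear_combination (-1) ^ n * (n.factorial : ℂ) * succ_mul_laguerreL_succ n (c - n - 1) x +
      hlower

end Laguerre

/-! ### Type C' -/

section TypeC'

/-- The operator `∂ - 1`, with inverse `(∂ - 1)⁻¹`. -/
def derivSubOneEquiv : polyGrowthSpace ≃ₗ[ℂ] polyGrowthSpace :=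
  derivSubEquiv polyGrowthSpace isDerivSubInvertible_polyBounded

theorem derivSubOneEquiv_eq :
    derivSubOneEquiv.toLinearMap = (1 : ℂ) • derivEnd _ - (1 : ℂ) • 1 := by
  rw [one_smul]
  rfl

theorem derivSubOneEquiv_apply (f : polyGrowthSpace) : derivSubOneEquiv f = derivEnd _ f - f :=
  congrArg (derivEnd _ f - ·) (one_smul ℂ f)

theorem coe_derivSubOneEquiv (f : polyGrowthSpace) :
    (derivSubOneEquiv f : ℝ → ℂ) = opBC' f :=
  coe_eq_onPos fun x hx => by
    rw [derivSubOneEquiv_apply, Submodule.coe_sub, Pi.sub_apply, derivEnd_apply _ hx]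

theorem coe_derivSubOneEquiv_symm (f : polyGrowthSpace) :
    (derivSubOneEquiv.symm f : ℝ → ℂ) = invDerivSubOne f :=
  invDerivSub_one f

theorem integrableOn_exp_neg_mul_of_mem {f : ℝ → ℂ} (hf : f ∈ polyGrowthSpace) {x : ℝ}
    (hx : 0 < x) : IntegrableOn (fun y : ℝ => Complex.exp (-y) * f y) (Ioi x) := by
  have hgrowth := analyticOfGrowth_coe ⟨f, hf⟩
  simpa only [one_mul] using
    isDerivSubInvertible_polyBounded.integrableOn hgrowth.continuousOn hgrowth.growth x hx

theorem invDerivSubOne_mem {f : ℝ → ℂ} (hf : f ∈ polyGrowthSpace) :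
    invDerivSubOne f ∈ polyGrowthSpace :=
  coe_derivSubOneEquiv_symm ⟨f, hf⟩ ▸ Subtype.mem _

theorem opBC'_invDerivSubOne {f : ℝ → ℂ} (hf : f ∈ polyGrowthSpace) :
    opBC' (invDerivSubOne f) = f := by
  have hright := derivSubOneEquiv.apply_symm_apply ⟨f, hf⟩
  rw [← coe_derivSubOneEquiv_symm ⟨f, hf⟩, ← coe_derivSubOneEquiv, hright]

theorem invDerivSubOne_opBC' {f : ℝ → ℂ} (hf : f ∈ polyGrowthSpace) :
    invDerivSubOne (opBC' f) = f := by
  have hleft := derivSubOneEquiv.symm_apply_apply ⟨f, hf⟩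
  rw [← coe_derivSubOneEquiv ⟨f, hf⟩, ← coe_derivSubOneEquiv_symm, hleft]

/-- Kummer's operator `x∂² + (c + u - x)∂ - u`. -/
def kummerEnd (c u : ℂ) : Module.End ℂ polyGrowthSpace :=
  mulXEnd _ * derivEnd _ * derivEnd _ + (c + u) • derivEnd _ - mulXEnd _ * derivEnd _ - u • 1

theorem coe_kummerEnd (c u : ℂ) (f : polyGrowthSpace) :
    (kummerEnd c u f : ℝ → ℂ) = diffOpC' c u f :=
  coe_eq_onPos fun x hx => by
    simp only [kummerEnd, LinearMap.add_apply, LinearMap.sub_apply, LinearMap.smul_apply,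
      Module.End.mul_apply, Module.End.one_apply, Submodule.coe_add, Submodule.coe_sub,
      Submodule.coe_smul, Pi.add_apply, Pi.sub_apply, Pi.smul_apply, smul_eq_mul,
      mulXEnd_apply _ hx, derivEnd_apply _ hx, deriv_derivEnd_apply _ hx]
    ring

theorem diffOpC'_mem (c u : ℂ) {f : ℝ → ℂ} (hf : f ∈ polyGrowthSpace) :
    diffOpC' c u f ∈ polyGrowthSpace :=
  coe_kummerEnd c u ⟨f, hf⟩ ▸ Subtype.mem _

theorem derivEnd_mul_tricomiLowering (c : ℂ) :
    derivEnd _ * tricomiLowering (c - 1) =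
      derivSubOneEquiv.toLinearMap * (derivSubOneEquiv.symm.toLinearMap * kummerEnd c 0) +
        (-1 : ℂ) • 1 := by
  rw [← mul_assoc, show derivSubOneEquiv.toLinearMap * derivSubOneEquiv.symm.toLinearMap = 1 from
    derivSubOneEquiv.comp_symm, one_mul]
  refine LinearMap.ext fun f => ?_
  rw [Module.End.mul_apply, derivEnd_tricomiLowering]
  simp only [tricomiLowering, kummerEnd, LinearMap.add_apply, LinearMap.sub_apply,
    LinearMap.smul_apply, Module.End.mul_apply, Module.End.one_apply, map_sub]
  module

theorem tricomiLowering_mul_derivEnd (r : ℂ) :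
    tricomiLowering r * derivEnd _ =
      derivEnd _ * tricomiLowering r - derivSubOneEquiv.toLinearMap := by
  refine LinearMap.ext fun f => ?_
  rw [LinearMap.sub_apply, Module.End.mul_apply, Module.End.mul_apply, derivEnd_tricomiLowering,
    LinearEquiv.coe_coe, derivSubOneEquiv_apply]
  simp only [tricomiLowering, LinearMap.add_apply, LinearMap.smul_apply, Module.End.one_apply]
  module

/-- The representation of type C'. -/
def repC' (c : ℂ) : ℂ → Matrix (Fin 2) (Fin 2) (Module.End ℂ polyGrowthSpace) :=
  linearFamily 1 (tricomiLowering (c - 1)) derivSubOneEquiv.toLinearMap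
    (derivSubOneEquiv.symm.toLinearMap * kummerEnd c 0) (derivEnd _)

theorem repC'_zero_zero (c u : ℂ) : repC' c u 0 0 = tricomiLowering (c - 1 + u) := by
  change tricomiLowering (c - 1) + (1 * u) • 1 = _
  simp only [tricomiLowering]
  module

theorem repC'_one_zero (c u : ℂ) :
    repC' c u 1 0 = derivSubOneEquiv.symm.toLinearMap * kummerEnd c u := by
  have hkummer (f : polyGrowthSpace) :
      kummerEnd c u f = kummerEnd c 0 f + u • derivSubOneEquiv f := by
    simp only [kummerEnd, derivSubOneEquiv_apply, LinearMap.add_apply, LinearMap.sub_apply,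
      LinearMap.smul_apply, Module.End.one_apply]
    module
  refine LinearMap.ext fun f => derivSubOneEquiv.injective ?_
  change derivSubOneEquiv (derivSubOneEquiv.symm (kummerEnd c 0 f) + u • f) =
    derivSubOneEquiv (derivSubOneEquiv.symm (kummerEnd c u f))
  rw [map_add, map_smul, LinearEquiv.apply_symm_apply, LinearEquiv.apply_symm_apply, hkummer]

theorem coe_repC'_zero_zero (c u : ℂ) (f : polyGrowthSpace) :
    (repC' c u 0 0 f : ℝ → ℂ) = opAC' c u f :=
  coe_eq_onPos fun x hx => by
    rw [repC'_zero_zero, tricomiLowering_apply _ _ hx, mul_sub]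

theorem coe_repC'_one_zero (c u : ℂ) (f : polyGrowthSpace) :
    (repC' c u 1 0 f : ℝ → ℂ) = opCC' c u f := by
  rw [repC'_one_zero, opCC', ← coe_kummerEnd]
  exact coe_derivSubOneEquiv_symm _

theorem isQISMIRep_repC' (c : ℂ) : IsQISMIRep (repC' c) :=
  isQISMIRep_linearFamily derivSubOneEquiv.injective (tricomiLowering_mul_derivEnd _)
    (derivEnd_mul_tricomiLowering c) derivSubOneEquiv_eq

theorem hasQuantumDet_repC' (c : ℂ) : HasQuantumDet (repC' c) fun u => u - 1 / 2 := by
  rw [show (fun u : ℂ => u - 1 / 2) = fun u => -1 + 1 * (u + 1 / 2) from funext fun u => by ring]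
  exact hasQuantumDet_linearFamily derivSubOneEquiv.injective (tricomiLowering_mul_derivEnd _)
    (derivEnd_mul_tricomiLowering c) derivSubOneEquiv_eq

theorem isShiftFamily_repC' (c : ℂ) :
    IsShiftFamily (repC' c) (tricomiFun c) (fun u => -(u - 1 / 2)) fun _ => -1 where
  ne_zero := tricomiFun_ne_zero c
  lower u := by rw [repC'_zero_zero, tricomiLowering_tricomiFun, neg_one_smul]
  raise u := by
    rw [add_sub_cancel_right]
    exact derivEnd_tricomiFun c u
  det := by simpa only [neg_mul_neg, mul_one] using hasQuantumDet_repC' c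

theorem repC'_one_zero_tricomiFun (c u : ℂ) : repC' c u 1 0 (tricomiFun c u) = 0 :=
  (isShiftFamily_repC' c).mem_ker (fun _ => derivSubOneEquiv.injective) u

theorem kummer_ode_of_repC'_eq_zero {c u : ℂ} {f : polyGrowthSpace} (hf : repC' c u 1 0 f = 0)
    {x : ℝ} (hx : 0 < x) :
    x * deriv (deriv f) x + (c + u - 1 * x) * deriv f x + -u * (f : ℝ → ℂ) x = 0 := by
  rw [repC'_one_zero] at hf
  have hkummer : kummerEnd c u f = 0 := derivSubOneEquiv.symm.map_eq_zero_iff.1 hf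
  have hode := congrFun (coe_kummerEnd c u f) x
  rw [hkummer, diffOpC', onPos_of_pos _ hx] at hode
  rw [one_mul, neg_mul, ← sub_eq_add_neg]
  exact hode.symm

theorem ker_repC'_one_zero_le (c u : ℂ) : LinearMap.ker (repC' c u 1 0) ≤ ℂ ∙ tricomiFun c u :=
  fun _ hf => mem_span_singleton_of_linear_ode isDerivSubInvertible_polyBounded
    (tricomiFun_ne_zero c u)
    (fun _ hx => kummer_ode_of_repC'_eq_zero (repC'_one_zero_tricomiFun c u) hx)
    fun _ hx => kummer_ode_of_repC'_eq_zero hf hx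

theorem stringConditions_repC' {c u₀ : ℂ} {jp : WithTop ℤ}
    (hzero : ∀ u ∈ paramString u₀ ⊥ jp, u = 0 ↔ IsHighest u₀ jp u) :
    StringConditions (repC' c) u₀ ⊥ jp (tricomiFun c) :=
  (isShiftFamily_repC' c).stringConditions (isQISMIRep_repC' c)
    (fun _ => derivSubOneEquiv.injective) (ker_repC'_one_zero_le c)
    (fun u _ => iff_of_false (neg_ne_zero.2 one_ne_zero) (not_isLowest_bot u₀ u)) fun u hu => by
      rw [add_sub_cancel_right, neg_eq_zero, hzero u hu]

theorem stringShifts_repC' {c u₀ : ℂ} {jp : WithTop ℤ}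
    (hzero : ∀ u ∈ paramString u₀ ⊥ jp, IsHighest u₀ jp u → u = 0) :
    StringShifts (repC' c) u₀ ⊥ jp (tricomiFun c) (fun u => -(u - 1 / 2)) fun _ => -1 :=
  (isShiftFamily_repC' c).stringShifts (fun u _ hu => absurd hu (not_isLowest_bot u₀ u))
    fun u hu hhigh => by rw [add_sub_cancel_right, neg_eq_zero, hzero u hu hhigh]

theorem eq_zero_iff_isHighest_top {u₀ u : ℂ} (hu₀ : ∀ m : ℤ, u₀ ≠ m)
    (hu : u ∈ paramString u₀ ⊥ ⊤) : u = 0 ↔ IsHighest u₀ ⊤ u := by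
  refine iff_of_false ?_ (not_isHighest_top u₀ u)
  obtain ⟨m, -, -, rfl⟩ := hu
  intro hzero
  exact hu₀ (-m) (by rw [Int.cast_neg, eq_neg_of_add_eq_zero_left hzero])

theorem eq_zero_iff_isHighest_one {u : ℂ} : u = 0 ↔ IsHighest 0 ((1 : ℤ) : WithTop ℤ) u := by
  rw [isHighest_coe_iff, Int.cast_one, zero_add, sub_self]

end TypeC'

/-! ### Type C'' -/

section TypeC''

/-- The operator `∂`, with inverse `∂⁻¹`. -/
def derivEquiv : rapidDecaySpace ≃ₗ[ℂ] rapidDecaySpace :=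
  derivSubEquiv rapidDecaySpace isDerivSubInvertible_rapidlyDecaying

theorem derivEquiv_apply (f : rapidDecaySpace) : derivEquiv f = derivEnd _ f :=
  (congrArg (derivEnd _ f - ·) (zero_smul ℂ f)).trans (sub_zero _)

theorem coe_derivEquiv (f : rapidDecaySpace) : (derivEquiv f : ℝ → ℂ) = onPos (deriv f) := by
  rw [derivEquiv_apply, coe_derivEnd]

theorem coe_derivEquiv_symm (f : rapidDecaySpace) : (derivEquiv.symm f : ℝ → ℂ) = invDeriv f :=
  invDerivSub_zero f

theorem injective_derivEnd_rapidDecaySpace : Function.Injective (derivEnd rapidDecaySpace) := by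
  intro f g hfg
  rw [← derivEquiv_apply, ← derivEquiv_apply] at hfg
  exact derivEquiv.injective hfg

theorem integrableOn_of_mem_rapidDecaySpace {f : ℝ → ℂ} (hf : f ∈ rapidDecaySpace) {x : ℝ}
    (hx : 0 < x) : IntegrableOn f (Ioi x) := by
  have hgrowth := analyticOfGrowth_coe ⟨f, hf⟩
  exact hgrowth.growth.integrableOn_Ioi hgrowth.continuousOn hx

theorem invDeriv_mem {f : ℝ → ℂ} (hf : f ∈ rapidDecaySpace) : invDeriv f ∈ rapidDecaySpace :=
  coe_derivEquiv_symm ⟨f, hf⟩ ▸ Subtype.mem _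

theorem onPos_deriv_invDeriv {f : ℝ → ℂ} (hf : f ∈ rapidDecaySpace) :
    onPos (deriv (invDeriv f)) = f := by
  have hright := derivEquiv.apply_symm_apply ⟨f, hf⟩
  rw [← coe_derivEquiv_symm ⟨f, hf⟩, ← coe_derivEquiv, hright]

theorem invDeriv_onPos_deriv {f : ℝ → ℂ} (hf : f ∈ rapidDecaySpace) :
    invDeriv (onPos (deriv f)) = f := by
  have hleft := derivEquiv.symm_apply_apply ⟨f, hf⟩
  rw [← coe_derivEquiv ⟨f, hf⟩, ← coe_derivEquiv_symm, hleft]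

/-- The operator `x∂² + (2u + 1)∂ - x`, a form of Bessel's. -/
def besselEnd (u : ℂ) : Module.End ℂ rapidDecaySpace :=
  mulXEnd _ * derivEnd _ * derivEnd _ + (2 * u + 1) • derivEnd _ - mulXEnd _

theorem coe_besselEnd (u : ℂ) (f : rapidDecaySpace) :
    (besselEnd u f : ℝ → ℂ) = diffOpC'' u f :=
  coe_eq_onPos fun x hx => by
    simp only [besselEnd, LinearMap.add_apply, LinearMap.sub_apply, LinearMap.smul_apply,
      Module.End.mul_apply, Submodule.coe_add, Submodule.coe_sub, Submodule.coe_smul, Pi.add_apply,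
      Pi.sub_apply, Pi.smul_apply, smul_eq_mul, mulXEnd_apply _ hx, derivEnd_apply _ hx,
      deriv_derivEnd_apply _ hx]

theorem diffOpC''_mem (u : ℂ) {f : ℝ → ℂ} (hf : f ∈ rapidDecaySpace) :
    diffOpC'' u f ∈ rapidDecaySpace :=
  coe_besselEnd u ⟨f, hf⟩ ▸ Subtype.mem _

/-- The representation of type C''. -/
def repC'' : ℂ → Matrix (Fin 2) (Fin 2) (Module.End ℂ rapidDecaySpace) :=
  linearFamily 2 (mulXEnd _ * derivEnd _) ((2 : ℂ) • (mulInvXEnd _ * derivEnd _))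
    ((1 / 2 : ℂ) • (derivEquiv.symm.toLinearMap * besselEnd 0)) (mulInvXEnd _ * derivEnd _)

theorem repC''_one_zero (u : ℂ) :
    repC'' u 1 0 = (1 / 2 : ℂ) • (derivEquiv.symm.toLinearMap * besselEnd u) := by
  have hbessel (f : rapidDecaySpace) :
      besselEnd u f = besselEnd 0 f + (2 * u) • derivEquiv f := by
    simp only [besselEnd, derivEquiv_apply, LinearMap.add_apply, LinearMap.sub_apply,
      LinearMap.smul_apply]
    module
  refine LinearMap.ext fun f => ?_
  change (1 / 2 : ℂ) • derivEquiv.symm (besselEnd 0 f) + u • f =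
    (1 / 2 : ℂ) • derivEquiv.symm (besselEnd u f)
  rw [hbessel, map_add, map_smul, LinearEquiv.symm_apply_apply]
  module

theorem coe_repC''_zero_zero (u : ℂ) (f : rapidDecaySpace) :
    (repC'' u 0 0 f : ℝ → ℂ) = opAC'' u f :=
  coe_eq_onPos fun x hx => by
    change (mulXEnd _ (derivEnd _ f) : ℝ → ℂ) x + 2 * u * (f : ℝ → ℂ) x = _
    rw [mulXEnd_apply _ hx, derivEnd_apply _ hx]

theorem coe_repC''_zero_one (u : ℂ) (f : rapidDecaySpace) :
    (repC'' u 0 1 f : ℝ → ℂ) = opBC'' f :=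
  coe_eq_onPos fun x hx => by
    change 2 * (mulInvXEnd _ (derivEnd _ f) : ℝ → ℂ) x = _
    rw [mulInvXEnd_apply _ hx, derivEnd_apply _ hx, mul_assoc]

theorem coe_repC''_one_zero (u : ℂ) (f : rapidDecaySpace) :
    (repC'' u 1 0 f : ℝ → ℂ) = opCC'' u f := by
  rw [repC''_one_zero, opCC'', ← coe_besselEnd]
  exact congrArg ((1 / 2 : ℂ) • ·) (coe_derivEquiv_symm _)

theorem coe_repC''_one_one (u : ℂ) (f : rapidDecaySpace) :
    (repC'' u 1 1 f : ℝ → ℂ) = opDC'' f :=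
  coe_eq_onPos fun x hx => (mulInvXEnd_apply _ hx).trans (by rw [derivEnd_apply _ hx])

theorem injective_two_smul_mulInvXEnd_derivEnd :
    Function.Injective ⇑((2 : ℂ) • (mulInvXEnd rapidDecaySpace * derivEnd rapidDecaySpace)) := by
  intro f g hfg
  have hinv : mulInvXEnd _ (derivEnd _ f) = mulInvXEnd _ (derivEnd _ g) :=
    smul_right_injective _ (two_ne_zero : (2 : ℂ) ≠ 0) hfg
  exact injective_derivEnd_rapidDecaySpace
    ((Function.LeftInverse.injective mulXEnd_mulInvXEnd) hinv)

theorem injective_repC''_zero_one (u : ℂ) : Function.Injective (repC'' u 0 1) :=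
  injective_two_smul_mulInvXEnd_derivEnd

theorem mulXEnd_derivEnd_mulInvXEnd (f : rapidDecaySpace) :
    mulXEnd _ (derivEnd _ (mulInvXEnd _ f)) = derivEnd _ f - mulInvXEnd _ f := by
  rw [eq_sub_iff_add_eq, ← derivEnd_mulXEnd, mulXEnd_mulInvXEnd]

theorem eulerEnd_mul_mulInvXEnd_derivEnd :
    mulXEnd rapidDecaySpace * derivEnd _ * (mulInvXEnd _ * derivEnd _) =
      mulInvXEnd _ * derivEnd _ * (mulXEnd _ * derivEnd _) -
        (2 : ℂ) • (mulInvXEnd _ * derivEnd _) := by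
  refine LinearMap.ext fun f => ?_
  simp only [LinearMap.sub_apply, LinearMap.smul_apply, Module.End.mul_apply, map_add,
    derivEnd_mulXEnd, mulXEnd_derivEnd_mulInvXEnd, mulInvXEnd_mulXEnd]
  module

theorem mulInvXEnd_derivEnd_mul_eulerEnd :
    mulInvXEnd rapidDecaySpace * derivEnd _ * (mulXEnd _ * derivEnd _) =
      (2 : ℂ) • (mulInvXEnd _ * derivEnd _) *
        ((1 / 2 : ℂ) • (derivEquiv.symm.toLinearMap * besselEnd 0)) + (1 : ℂ) • 1 := by
  have hsymm (f : rapidDecaySpace) : derivEnd _ (derivEquiv.symm f) = f := by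
    rw [← derivEquiv_apply, LinearEquiv.apply_symm_apply]
  refine LinearMap.ext fun f => ?_
  simp only [besselEnd, LinearMap.add_apply, LinearMap.sub_apply, LinearMap.smul_apply,
    Module.End.mul_apply, Module.End.one_apply, map_add, map_sub, map_smul, LinearEquiv.coe_coe,
    derivEnd_mulXEnd, mulInvXEnd_mulXEnd, hsymm]
  module

theorem two_smul_mulInvXEnd_derivEnd_eq :
    (2 : ℂ) • (mulInvXEnd rapidDecaySpace * derivEnd _) =
      (2 : ℂ) • (mulInvXEnd _ * derivEnd _) - (0 : ℂ) • 1 := by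
  module

theorem isQISMIRep_repC'' : IsQISMIRep repC'' :=
  isQISMIRep_linearFamily injective_two_smul_mulInvXEnd_derivEnd eulerEnd_mul_mulInvXEnd_derivEnd
    mulInvXEnd_derivEnd_mul_eulerEnd two_smul_mulInvXEnd_derivEnd_eq

theorem hasQuantumDet_repC'' : HasQuantumDet repC'' fun _ => 1 := by
  rw [show (fun _ : ℂ => (1 : ℂ)) = fun u => 1 + 0 * (u + 1 / 2) from funext fun u => by ring]
  exact hasQuantumDet_linearFamily injective_two_smul_mulInvXEnd_derivEnd
    eulerEnd_mul_mulInvXEnd_derivEnd mulInvXEnd_derivEnd_mul_eulerEnd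
    two_smul_mulInvXEnd_derivEnd_eq

/-- The function `x ↦ x^{-u} K_u(x)` as an element of the space of rapidly decaying functions. -/
def macdonaldFun (u : ℂ) : rapidDecaySpace :=
  ⟨onPos fun x => (x : ℂ) ^ (-u) * macdonaldK u x, by
    have hmem := rapidDecaySpace.smul_mem (1 / 2 * ((1 / 2 : ℝ) : ℂ) ^ u)
      (analyticOfGrowth_macdonaldIntegral_sq u)
    convert hmem using 1
    refine eq_of_eqOn_pos (fun x hx => onPos_of_nonpos _ hx)
      (coe_eq_zero_of_nonpos (⟨_, hmem⟩ : rapidDecaySpace)) fun x hx => ?_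
    rw [onPos_of_pos _ hx, cpow_neg_mul_macdonaldK u hx, Pi.smul_apply, onPos_of_pos _ hx,
      smul_eq_mul]⟩

theorem macdonaldFun_apply (u : ℂ) {x : ℝ} (hx : 0 < x) :
    (macdonaldFun u : ℝ → ℂ) x =
      1 / 2 * ((1 / 2 : ℝ) : ℂ) ^ u * macdonaldIntegral u (x ^ 2 / 4) := by
  rw [← cpow_neg_mul_macdonaldK u hx]
  exact onPos_of_pos (fun x => (x : ℂ) ^ (-u) * macdonaldK u x) hx

theorem half_cpow_add_one (u : ℂ) :
    ((1 / 2 : ℝ) : ℂ) ^ (u + 1) = ((1 / 2 : ℝ) : ℂ) ^ u * (1 / 2) := by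
  rw [Complex.cpow_add _ _ (by norm_num), Complex.cpow_one]
  norm_num

theorem deriv_macdonaldFun (u : ℂ) {x : ℝ} (hx : 0 < x) :
    deriv (macdonaldFun u : ℝ → ℂ) x = -(x * (macdonaldFun (u + 1) : ℝ → ℂ) x) := by
  have hinteg : (macdonaldFun u : ℝ → ℂ) =ᶠ[𝓝 x]
      fun x => 1 / 2 * ((1 / 2 : ℝ) : ℂ) ^ u * macdonaldIntegral u (x ^ 2 / 4) := by
    filter_upwards [Ioi_mem_nhds hx] with y hy using macdonaldFun_apply u hy
  rw [hinteg.deriv_eq, ((hasDerivAt_macdonaldIntegral_sq u hx).const_mul _).deriv,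
    macdonaldFun_apply _ hx, half_cpow_add_one]
  ring

theorem mulInvXEnd_derivEnd_macdonaldFun (u : ℂ) :
    mulInvXEnd _ (derivEnd _ (macdonaldFun u)) = -macdonaldFun (u + 1) :=
  ext_of_pos fun x hx => by
    rw [mulInvXEnd_apply _ hx, derivEnd_apply _ hx, deriv_macdonaldFun u hx, Submodule.coe_neg,
      Pi.neg_apply, mul_neg, inv_mul_cancel_left₀ (ofReal_ne_zero_of_pos hx)]

theorem mulXEnd_derivEnd_macdonaldFun (u : ℂ) :
    mulXEnd _ (derivEnd _ (macdonaldFun u)) + (2 * u) • macdonaldFun u = -macdonaldFun (u - 1) := by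
  refine ext_of_pos fun x hx => ?_
  have hrec := macdonaldIntegral_recurrence u (x := x ^ 2 / 4) (by positivity)
  have hpow := half_cpow_add_one (u - 1)
  rw [sub_add_cancel] at hpow
  simp only [Submodule.coe_add, Submodule.coe_neg, Submodule.coe_smul, Pi.add_apply,
    Pi.neg_apply, Pi.smul_apply, smul_eq_mul, mulXEnd_apply _ hx, derivEnd_apply _ hx,
    deriv_macdonaldFun u hx, macdonaldFun_apply _ hx, half_cpow_add_one, hpow]
  push_cast at hrec ⊢
  linear_combination -(1 / 2) * ((1 / 2 : ℂ) ^ (u - 1)) * hrec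

theorem macdonaldFun_ne_zero (u : ℂ) : macdonaldFun u ≠ 0 := by
  induction u using induction_of_re_pos with
  | hpos u hu =>
    obtain ⟨z, hz, hne⟩ := exists_macdonaldIntegral_ne_zero hu
    intro hzero
    have hval := macdonaldFun_apply u (x := 2 * √z) (by positivity)
    rw [hzero, mul_pow, Real.sq_sqrt hz.le, show (2 : ℝ) ^ 2 * z / 4 = z by ring] at hval
    have hhalf : ((1 / 2 : ℝ) : ℂ) ^ u ≠ 0 :=
      Complex.cpow_ne_zero_iff.2 (.inl (ofReal_ne_zero_of_pos one_half_pos))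
    exact mul_ne_zero (mul_ne_zero (by norm_num) hhalf) hne hval.symm
  | hstep u ih =>
    intro hzero
    have hraise := mulInvXEnd_derivEnd_macdonaldFun u
    rw [hzero, map_zero, map_zero] at hraise
    exact ih (neg_eq_zero.1 hraise.symm)

theorem isShiftFamily_repC'' :
    IsShiftFamily repC'' macdonaldFun (fun _ => -1) fun _ => -1 where
  ne_zero := macdonaldFun_ne_zero
  lower u := (mulXEnd_derivEnd_macdonaldFun u).trans (neg_one_smul ℂ _).symm
  raise u := (mulInvXEnd_derivEnd_macdonaldFun u).trans (neg_one_smul ℂ _).symm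
  det := by simpa only [neg_mul_neg, mul_one] using hasQuantumDet_repC''

theorem repC''_one_zero_macdonaldFun (u : ℂ) : repC'' u 1 0 (macdonaldFun u) = 0 :=
  isShiftFamily_repC''.mem_ker injective_repC''_zero_one u

theorem bessel_ode_of_repC''_eq_zero {u : ℂ} {f : rapidDecaySpace} (hf : repC'' u 1 0 f = 0)
    {x : ℝ} (hx : 0 < x) :
    x * deriv (deriv f) x + (2 * u + 1 - 0 * x) * deriv f x + -x * (f : ℝ → ℂ) x = 0 := by
  rw [repC''_one_zero, LinearMap.smul_apply, smul_eq_zero_iff_right (one_div_ne_zero two_ne_zero)]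
    at hf
  have hbessel : besselEnd u f = 0 := derivEquiv.symm.map_eq_zero_iff.1 hf
  have hode := congrFun (coe_besselEnd u f) x
  rw [hbessel, diffOpC'', onPos_of_pos _ hx] at hode
  rw [zero_mul, sub_zero, neg_mul, ← sub_eq_add_neg]
  exact hode.symm

theorem ker_repC''_one_zero_le (u : ℂ) : LinearMap.ker (repC'' u 1 0) ≤ ℂ ∙ macdonaldFun u :=
  fun _ hf => mem_span_singleton_of_linear_ode isDerivSubInvertible_rapidlyDecaying
    (macdonaldFun_ne_zero u)
    (fun _ hx => bessel_ode_of_repC''_eq_zero (repC''_one_zero_macdonaldFun u) hx)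
    fun _ hx => bessel_ode_of_repC''_eq_zero hf hx

theorem stringConditions_repC'' (u₀ : ℂ) : StringConditions repC'' u₀ ⊥ ⊤ macdonaldFun :=
  isShiftFamily_repC''.stringConditions isQISMIRep_repC'' injective_repC''_zero_one
    ker_repC''_one_zero_le
    (fun u _ => iff_of_false (neg_ne_zero.2 one_ne_zero) (not_isLowest_bot u₀ u))
    fun u _ => iff_of_false (neg_ne_zero.2 one_ne_zero) (not_isHighest_top u₀ u)

theorem stringShifts_repC'' (u₀ : ℂ) :
    StringShifts repC'' u₀ ⊥ ⊤ macdonaldFun (fun _ => -1) fun _ => -1 :=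
  isShiftFamily_repC''.stringShifts (fun u _ hu => absurd hu (not_isLowest_bot u₀ u))
    fun u _ hu => absurd hu (not_isHighest_top u₀ u)

end TypeC''

end

theorem mainTheorem8 :
    -- Type C'
    ((∀ f ∈ polyGrowthSpace,
        (∀ x : ℝ, 0 < x → IntegrableOn (fun y : ℝ => Complex.exp (-y) * f y) (Ioi x)) ∧
        invDerivSubOne f ∈ polyGrowthSpace ∧
        opBC' (invDerivSubOne f) = f ∧ invDerivSubOne (opBC' f) = f) ∧
      ∀ c : ℂ,
        (∀ u : ℂ, ∀ f ∈ polyGrowthSpace, diffOpC' c u f ∈ polyGrowthSpace) ∧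
        ∃ T : ℂ → Matrix (Fin 2) (Fin 2) (Module.End ℂ polyGrowthSpace),
        ∃ F : ℂ → polyGrowthSpace,
          (∀ (u : ℂ) (f : polyGrowthSpace),
            (T u 0 0 f : ℝ → ℂ) = opAC' c u f ∧ (T u 0 1 f : ℝ → ℂ) = opBC' f ∧
            (T u 1 0 f : ℝ → ℂ) = opCC' c u f ∧ (T u 1 1 f : ℝ → ℂ) = opDC' f) ∧
          (∀ u : ℂ, Function.Injective (T u 0 1)) ∧
          IsQISMIRep T ∧
          HasQuantumDet T (fun u => u - 1 / 2) ∧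
          (∀ u : ℂ, (F u : ℝ → ℂ) = onPos (tricomiPsi u (c + u))) ∧
          (∀ u₀ : ℂ, (∀ m : ℤ, u₀ ≠ m) →
            StringConditions T u₀ ⊥ ⊤ F ∧
            StringShifts T u₀ ⊥ ⊤ F (fun u => -(u - 1 / 2)) (fun _ => -1)) ∧
          -- the string `{0, -1, -2, …}`
          StringConditions T 0 ⊥ ((1 : ℤ) : WithTop ℤ) F ∧
          StringShifts T 0 ⊥ ((1 : ℤ) : WithTop ℤ) F (fun u => -(u - 1 / 2)) (fun _ => -1) ∧
          ∀ (n : ℕ) (x : ℝ), 0 < x →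
            (F (-n) : ℝ → ℂ) x = (-1) ^ n * (n.factorial : ℂ) * laguerreL n (c - n - 1) x) ∧
    -- Type C''
    ((∀ f ∈ rapidDecaySpace,
        (∀ x : ℝ, 0 < x → IntegrableOn f (Ioi x)) ∧
        invDeriv f ∈ rapidDecaySpace ∧
        onPos (deriv (invDeriv f)) = f ∧ invDeriv (onPos (deriv f)) = f) ∧
      (∀ u : ℂ, ∀ f ∈ rapidDecaySpace, diffOpC'' u f ∈ rapidDecaySpace) ∧
      ∃ T : ℂ → Matrix (Fin 2) (Fin 2) (Module.End ℂ rapidDecaySpace),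
      ∃ F : ℂ → rapidDecaySpace,
        (∀ (u : ℂ) (f : rapidDecaySpace),
          (T u 0 0 f : ℝ → ℂ) = opAC'' u f ∧ (T u 0 1 f : ℝ → ℂ) = opBC'' f ∧
          (T u 1 0 f : ℝ → ℂ) = opCC'' u f ∧ (T u 1 1 f : ℝ → ℂ) = opDC'' f) ∧
        (∀ u : ℂ, Function.Injective (T u 0 1)) ∧
        IsQISMIRep T ∧
        HasQuantumDet T (fun _ => 1) ∧
        (∀ u : ℂ, (F u : ℝ → ℂ) = onPos fun x => (x : ℂ) ^ (-u) * macdonaldK u x) ∧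
        ∀ u₀ : ℂ,
          StringConditions T u₀ ⊥ ⊤ F ∧
          StringShifts T u₀ ⊥ ⊤ F (fun _ => -1) (fun _ => -1)) := by
  refine ⟨⟨fun f hf => ⟨fun x hx => integrableOn_exp_neg_mul_of_mem hf hx, invDerivSubOne_mem hf,
      opBC'_invDerivSubOne hf, invDerivSubOne_opBC' hf⟩,
    fun c => ⟨fun u f hf => diffOpC'_mem c u hf, repC' c, tricomiFun c,
      fun u f => ⟨coe_repC'_zero_zero c u f, coe_derivSubOneEquiv f,
        coe_repC'_one_zero c u f, coe_derivEnd f⟩,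
      fun _ => derivSubOneEquiv.injective, isQISMIRep_repC' c, hasQuantumDet_repC' c,
      fun _ => rfl, fun u₀ hu₀ => ⟨?_, ?_⟩, ?_, ?_,
      fun n x hx => tricomiFun_neg_natCast_apply c n hx⟩⟩,
    fun f hf => ⟨fun x hx => integrableOn_of_mem_rapidDecaySpace hf hx, invDeriv_mem hf,
      onPos_deriv_invDeriv hf, invDeriv_onPos_deriv hf⟩,
    fun u f hf => diffOpC''_mem u hf, repC'', macdonaldFun,
    fun u f => ⟨coe_repC''_zero_zero u f, coe_repC''_zero_one u f, coe_repC''_one_zero u f,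
      coe_repC''_one_one u f⟩,
    injective_repC''_zero_one, isQISMIRep_repC'', hasQuantumDet_repC'', fun _ => rfl,
    fun u₀ => ⟨stringConditions_repC'' u₀, stringShifts_repC'' u₀⟩⟩
  · exact stringConditions_repC' fun u hu => eq_zero_iff_isHighest_top hu₀ hu
  · exact stringShifts_repC' fun u hu => (eq_zero_iff_isHighest_top hu₀ hu).2
  · exact stringConditions_repC' fun u _ => eq_zero_iff_isHighest_one
  · exact stringShifts_repC' fun u _ => eq_zero_iff_isHighest_one.2
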